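/- Let $(X,\omega)$ be a compact Kähler manifold and let $(E,D)$ be a non-Hermitian Yang–Mills (NHYM) bundle over $X$: $E$ is a smooth complex vector bundle of rank $r$, and $D$ is a smooth connection on $E$ whose curvature $F_D$ is of type $(1,1)$ and satisfies $\sqrt{-1}\,\Lambda_\omega F_D=\lambda\,\mathrm{Id}_E$ for some constant $\lambda\in\mathbb{R}$. For a smooth Hermitian metric $H$ on $E$ write $D=D_H+\psi_H$, where $D_H$ is an $H$-unitary connection and $\psi_H\in\Omega^1(\mathrm{End}\,E)$ is $H$-self-adjoint, and let $G_H=(\bar\partial_H+\psi_H^{1,0})^2$, where $\bar\partial_H$ is the $(0,1)$-part of $D_H$ and $\psi_H^{1,0}$ is the $(1,0)$-part of $\psi_H$. Let $K$ be a smooth Hermitian metric on $E$ and let $C_1>0$. Then there exists a constant $C_2>0$, depending only on $C_1$, $K$, $(E,D)$ and $(X,\omega)$, with the following property. Let $T\in(0,+\infty]$ and let $H(t)$, $0\le t<T$, be a smooth solution of the heat flow $$H^{-1}(t)\frac{\partial H(t)}{\partial t}=4\sqrt{-1}\,\Lambda_\omega G_{H(t)},\qquad H(0)=K,$$ and let $h(t)=K^{-1}H(t)$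 be the positive endomorphism given by $H(t)(\cdot,\cdot)=K(h(t)\,\cdot,\cdot)$. If $$\sup_{X\times[0,T)}|\log h|_K<C_1,$$ then $$\sup_{X\times[0,T)}|\psi_{H}|_{H,\omega}<C_2.$$ -/

import Mathlib

open Bundle Manifold ContDiff Topology

noncomputable section

/-- The model space `ℂⁿ` of an `n`-dimensional complex manifold. -/
abbrev Cn (n : ℕ) : Type := EuclideanSpace ℂ (Fin n)

/-- The real basis `e₁, i e₁, …, eₙ, i eₙ` of `ℂⁿ`. -/
def realBasis (n : ℕ) : Module.Basis (Fin 2 × Fin n) ℝ (Cn n) :=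
  Complex.basisOneI.smulTower (EuclideanSpace.basisFun (Fin n) ℂ).toBasis

/-- A complex manifold is in particular a real manifold. -/
instance realManifoldOfComplex {n : ℕ} {X : Type*} [TopologicalSpace X] [ChartedSpace (Cn n) X]
    [IsManifold 𝓘(ℂ, Cn n) ω X] : IsManifold 𝓘(ℝ, Cn n) ω X := by
  apply isManifold_of_contDiffOn
  intro e e' he he'
  have h := (contDiffGroupoid ω 𝓘(ℂ, Cn n)).compatible he he'
  rw [contDiffGroupoid, mem_groupoid_of_pregroupoid] at h
  have h1 : ContDiffOn ℂ ω (e.symm ≫ₕ e') (e.symm ≫ₕ e').source := by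
    simpa [contDiffPregroupoid] using h.1
  simpa using h1.restrict_scalars ℝ

/-! ### Hermitian forms on a finite-dimensional complex vector space -/

section LinearAlgebra

variable {W : Type*} [AddCommGroup W] [Module ℂ W]

/-- `B` is a Hermitian inner product, conjugate-linear in the first variable. -/
structure IsHermitianInner (B : W →ₗ⋆[ℂ] W →ₗ[ℂ] ℂ) : Prop where
  conj_symm : ∀ u w, starRingEnd ℂ (B u w) = B w u
  pos : ∀ u, u ≠ 0 → 0 < (B u u).re

/-- `f` is self-adjoint with respect to `B`. -/
def IsSelfAdjointFor (B : W →ₗ⋆[ℂ] W →ₗ[ℂ] ℂ) (f : Module.End ℂ W) : Prop :=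
  ∀ u w, B (f u) w = B u (f w)

/-- The inner product space structure given by a Hermitian inner product. -/
@[reducible] def IsHermitianInner.core {B : W →ₗ⋆[ℂ] W →ₗ[ℂ] ℂ} (hB : IsHermitianInner B) :
    InnerProductSpace.Core ℂ W where
  inner u w := B u w
  conj_inner_symm u w := hB.conj_symm w u
  re_inner_nonneg u := by
    by_cases hu : u = 0
    · simp [hu]
    · exact (hB.pos u hu).le
  add_left u v w := by simp
  smul_left u v c := by simp
  definite u hu := by
    by_contra h
    have := hB.pos u h
    rw [hu] at this
    simp at this

variable [FiniteDimensional ℂ W]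

/-- A self-adjoint endomorphism has an orthonormal basis of eigenvectors with real eigenvalues. -/
theorem IsHermitianInner.exists_eigenbasis {B : W →ₗ⋆[ℂ] W →ₗ[ℂ] ℂ} (hB : IsHermitianInner B)
    {f : Module.End ℂ W} (hf : IsSelfAdjointFor B f) :
    ∃ (b : Module.Basis (Fin (Module.finrank ℂ W)) ℂ W) (l : Fin (Module.finrank ℂ W) → ℝ),
      (∀ i j, B (b i) (b j) = if i = j then 1 else 0) ∧ ∀ i, f (b i) = (l i : ℂ) • b i := by
  let _ : NormedAddCommGroup W := @InnerProductSpace.Core.toNormedAddCommGroup ℂ W _ _ _ hB.core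
  let _ : InnerProductSpace ℂ W := InnerProductSpace.ofCore hB.core.toCore
  have hs : f.IsSymmetric := hf
  refine ⟨(hs.eigenvectorBasis rfl).toBasis, hs.eigenvalues rfl, fun i j => ?_, fun i => ?_⟩
  · have := orthonormal_iff_ite.mp (hs.eigenvectorBasis rfl).orthonormal i j
    simp only [OrthonormalBasis.coe_toBasis]
    exact this
  · simp [hs.apply_eigenvectorBasis rfl i]

/-- Riesz representation: a sesquilinear form is `B (·, T ·)` for an endomorphism `T`. -/
theorem IsHermitianInner.exists_rep {B : W →ₗ⋆[ℂ] W →ₗ[ℂ] ℂ} (hB : IsHermitianInner B)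
    (C : W →ₗ⋆[ℂ] W →ₗ[ℂ] ℂ) : ∃ T : Module.End ℂ W, ∀ u w, C u w = B u (T w) := by
  obtain ⟨b, -, hb, -⟩ := hB.exists_eigenbasis (f := 0) (by intro u w; simp)
  refine ⟨∑ j, (C (b j)).smulRight (b j), fun u w => ?_⟩
  have key : ∀ i, C (b i) w = B (b i) ((∑ j, (C (b j)).smulRight (b j)) w) := by
    intro i
    simp [hb]
  have : C.flip w = B.flip ((∑ j, (C (b j)).smulRight (b j)) w) :=
    b.ext fun i => by simpa only [LinearMap.flip_apply] using key i
  simpa only [LinearMap.flip_apply] using LinearMap.congr_fun this u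

/-- The endomorphism `T` with `C (u, w) = B (u, T w)`. -/
def rieszEnd {B : W →ₗ⋆[ℂ] W →ₗ[ℂ] ℂ} (hB : IsHermitianInner B) (C : W →ₗ⋆[ℂ] W →ₗ[ℂ] ℂ) :
    Module.End ℂ W :=
  Classical.choose (hB.exists_rep C)

theorem rieszEnd_spec {B : W →ₗ⋆[ℂ] W →ₗ[ℂ] ℂ} (hB : IsHermitianInner B)
    (C : W →ₗ⋆[ℂ] W →ₗ[ℂ] ℂ) (u w : W) : B u (rieszEnd hB C w) = C u w :=
  (Classical.choose_spec (hB.exists_rep C) u w).symm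

/-- The adjoint `f*` of `f`, characterised by `B (u, f* w) = B (f u, w)`. -/
def adjointFor {B : W →ₗ⋆[ℂ] W →ₗ[ℂ] ℂ} (hB : IsHermitianInner B) (f : Module.End ℂ W) :
    Module.End ℂ W :=
  rieszEnd hB (B.comp f)

theorem adjointFor_spec {B : W →ₗ⋆[ℂ] W →ₗ[ℂ] ℂ} (hB : IsHermitianInner B)
    (f : Module.End ℂ W) (u w : W) : B u (adjointFor hB f w) = B (f u) w :=
  rieszEnd_spec hB _ u w

/-- The Hermitian inner product `⟨f, f'⟩ = tr (f* f')` on endomorphisms. -/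
def endInner {B : W →ₗ⋆[ℂ] W →ₗ[ℂ] ℂ} (hB : IsHermitianInner B) (f f' : Module.End ℂ W) : ℂ :=
  LinearMap.trace ℂ W (adjointFor hB f * f')

/-- The norm `|f| = (tr (f* f))^{1/2}` on endomorphisms. -/
def endNorm {B : W →ₗ⋆[ℂ] W →ₗ[ℂ] ℂ} (hB : IsHermitianInner B) (f : Module.End ℂ W) : ℝ :=
  √(endInner hB f f).re

/-- The endomorphism `h = K⁻¹ H`, characterised by `H (u, w) = K (u, h w)`. -/
def relEnd {K : W →ₗ⋆[ℂ] W →ₗ[ℂ] ℂ} (hK : IsHermitianInner K) (H : W →ₗ⋆[ℂ] W →ₗ[ℂ] ℂ) :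
    Module.End ℂ W :=
  rieszEnd hK H

/-- `s` is the logarithm of `h` (by functional calculus): it acts on the eigenspace of `h` for the
real eigenvalue `μ` as multiplication by `log μ`. -/
def IsLogOf (h s : Module.End ℂ W) : Prop :=
  ∀ (μ : ℝ) (w : W), h w = (μ : ℂ) • w → s w = (Real.log μ : ℂ) • w

/-- The positive endomorphism `h = K⁻¹ H` has exactly one logarithm. -/
theorem existsUnique_log {K H : W →ₗ⋆[ℂ] W →ₗ[ℂ] ℂ} (hK : IsHermitianInner K)
    (hH : IsHermitianInner H) : ∃! s : Module.End ℂ W, IsLogOf (relEnd hK H) s := by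
  have hsa : IsSelfAdjointFor K (relEnd hK H) := by
    intro u w
    rw [relEnd, rieszEnd_spec, ← hK.conj_symm, rieszEnd_spec, hH.conj_symm]
  obtain ⟨b, l, -, hl⟩ := hK.exists_eigenbasis hsa
  refine ⟨b.constr ℂ fun i => ((Real.log (l i) : ℝ) : ℂ) • b i, ?_, ?_⟩
  · intro μ w hw
    have hc : ∀ i, b.repr w i * (l i : ℂ) = b.repr w i * (μ : ℂ) := by
      intro i
      have h1 : relEnd hK H w = ∑ j, b.repr w j • (l j : ℂ) • b j := by
        conv_lhs => rw [← b.sum_repr w]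
        simp only [map_sum, map_smul, hl]
      have h2 := congrArg (fun v => b.repr v i) (h1.symm.trans hw)
      simp only [smul_smul] at h2
      rw [b.repr_sum_self] at h2
      simpa [-Complex.coe_smul, mul_comm] using h2
    have hc' : ∀ i, b.repr w i * (Real.log (l i) : ℂ) = b.repr w i * (Real.log μ : ℂ) := by
      intro i
      by_cases h0 : b.repr w i = 0
      · simp [h0]
      · have : l i = μ := by exact_mod_cast mul_left_cancel₀ h0 (hc i)
        rw [this]
    rw [b.constr_apply_fintype ℂ]
    conv_rhs => rw [← b.sum_repr w, Finset.smul_sum]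
    refine Finset.sum_congr rfl fun i _ => ?_
    rw [Module.Basis.equivFun_apply, smul_smul, smul_smul, hc' i, mul_comm]
  · intro s hs
    refine b.ext fun i => ?_
    exact (hs _ _ (hl i)).trans
      (b.constr_basis ℂ (fun i => ((Real.log (l i) : ℝ) : ℂ) • b i) i).symm

/-- The logarithm `log (K⁻¹ H)`. -/
def logEnd {K H : W →ₗ⋆[ℂ] W →ₗ[ℂ] ℂ} (hK : IsHermitianInner K) (hH : IsHermitianInner H) :
    Module.End ℂ W :=
  Classical.choose (existsUnique_log hK hH).exists

theorem logEnd_spec {K H : W →ₗ⋆[ℂ] W →ₗ[ℂ] ℂ} (hK : IsHermitianInner K)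
    (hH : IsHermitianInner H) : IsLogOf (relEnd hK H) (logEnd hK hH) :=
  Classical.choose_spec (existsUnique_log hK hH).exists

end LinearAlgebra

/-! ### Compact Kähler manifolds -/

section Kahler

set_option linter.unusedSectionVars false

variable {n : ℕ} {X : Type*} [TopologicalSpace X] [ChartedSpace (Cn n) X]

/-- The complex structure `J` on the tangent space: multiplication by `i` in `T_x X = ℂⁿ` (the
identification being given by the preferred holomorphic chart at `x`). -/
def tangentJ (x : X) : TangentSpace 𝓘(ℝ, Cn n) x →ₗ[ℝ] TangentSpace 𝓘(ℝ, Cn n) x :=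
  (Complex.I • LinearMap.id : Cn n →ₗ[ℝ] Cn n)

/-- The coordinate vector field of the chart `φ` in the constant direction `v ∈ ℂⁿ`. -/
def coordField (φ : OpenPartialHomeomorph X (Cn n)) (v : Cn n) (x : X) :
    TangentSpace 𝓘(ℝ, Cn n) x :=
  (mfderiv 𝓘(ℝ, Cn n) 𝓘(ℝ, Cn n) φ x).inverse ((NormedSpace.fromTangentSpace (φ x)).symm v)

/-- The derivative `v f (x)` of a function `f` along a tangent vector `v`. -/
def dirDeriv {M : Type*} [NormedAddCommGroup M] [NormedSpace ℝ M] (f : X → M) (x : X)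
    (v : TangentSpace 𝓘(ℝ, Cn n) x) : M :=
  mvfderiv 𝓘(ℝ, Cn n) f x v

variable (n X) in
/-- A Kähler metric: a smooth Riemannian metric `g` on `X` which is invariant under `J` and whose
fundamental form `ω(u, v) = g(J u, v)` is closed. Closedness is expressed in the holomorphic
charts, on the coordinate vector fields. -/
structure KahlerMetric [IsManifold 𝓘(ℂ, Cn n) ω X] where
  g : ContMDiffRiemannianMetric 𝓘(ℝ, Cn n) ∞ (Cn n)
    (fun x : X => TangentSpace 𝓘(ℝ, Cn n) x)
  invariant : ∀ (x : X) (u v : TangentSpace 𝓘(ℝ, Cn n) x),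
    g.inner x (tangentJ x u) (tangentJ x v) = g.inner x u v
  closed : ∀ φ ∈ IsManifold.maximalAtlas 𝓘(ℂ, Cn n) ω X, ∀ x ∈ φ.source, ∀ u v w : Cn n,
    dirDeriv (fun y => g.inner y (tangentJ y (coordField φ v y)) (coordField φ w y)) x
        (coordField φ u x) +
      dirDeriv (fun y => g.inner y (tangentJ y (coordField φ w y)) (coordField φ u y)) x
        (coordField φ v x) +
      dirDeriv (fun y => g.inner y (tangentJ y (coordField φ u y)) (coordField φ v y)) x
        (coordField φ w x) = 0

variable [IsManifold 𝓘(ℂ, Cn n) ω X]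

/-- The inverse matrix `g^{ab}` of the metric at `x`, in the real coordinates of the chart `φ`. -/
def KahlerMetric.inv (κ : KahlerMetric n X) (φ : OpenPartialHomeomorph X (Cn n)) (x : X) :
    Matrix (Fin 2 × Fin n) (Fin 2 × Fin n) ℝ :=
  (Matrix.of fun a b => κ.g.inner x (coordField φ (realBasis n a) x)
    (coordField φ (realBasis n b) x))⁻¹

/-- The contraction `Λ_ω β` at `x` of a `2`-form `β` given in the chart `φ`, namely
`½ ∑ g^{ab} β(∂_a, J ∂_b)`. For a unitary basis `e_j` of `T_x X` it is `∑ β(e_j, J e_j)`;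
in particular `Λ_ω ω = n`. -/
def KahlerMetric.contract (κ : KahlerMetric n X) (φ : OpenPartialHomeomorph X (Cn n)) (x : X)
    {M : Type*} [AddCommGroup M] [Module ℝ M] (β : Cn n → Cn n → M) : M :=
  (1 / 2 : ℝ) • ∑ a, ∑ b, κ.inv φ x a b • β (realBasis n a) (Complex.I • realBasis n b)

end Kahler

/-! ### Connections and Hermitian metrics on complex vector bundles -/

section Bundles

set_option linter.unusedSectionVars false

variable {n r : ℕ} {X : Type*} [TopologicalSpace X] [ChartedSpace (Cn n) X]
  [IsManifold 𝓘(ℂ, Cn n) ω X]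
  {V : X → Type*} [TopologicalSpace (TotalSpace (Fin r → ℂ) V)]
  [∀ x, AddCommGroup (V x)] [∀ x, Module ℂ (V x)] [∀ x, TopologicalSpace (V x)]
  [∀ x, IsTopologicalAddGroup (V x)] [∀ x, ContinuousSMul ℝ (V x)]
  [FiberBundle (Fin r → ℂ) V] [VectorBundle ℝ (Fin r → ℂ) V] [VectorBundle ℂ (Fin r → ℂ) V]
  [ContMDiffVectorBundle ∞ (Fin r → ℂ) V 𝓘(ℝ, Cn n)]

variable (n r) in
/-- The section `σ` of `V` is smooth at `x`. -/
def SmoothSectionAt (σ : Π x, V x) (x : X) : Prop :=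
  ContMDiffAt 𝓘(ℝ, Cn n) (𝓘(ℝ, Cn n).prod 𝓘(ℝ, Fin r → ℂ)) ∞
    (fun y => TotalSpace.mk' (Fin r → ℂ) y (σ y)) x

variable (n r) in
/-- The section `σ` of `V` is differentiable at `x`. -/
def DiffSectionAt (σ : Π x, V x) (x : X) : Prop :=
  MDifferentiableAt 𝓘(ℝ, Cn n) (𝓘(ℝ, Cn n).prod 𝓘(ℝ, Fin r → ℂ))
    (fun y => TotalSpace.mk' (Fin r → ℂ) y (σ y)) x

variable (n r V) in
/-- A smooth connection on the complex vector bundle `V`: a smooth covariant derivative (along real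
tangent vectors) which is complex linear. -/
structure ComplexConnection extends CovariantDerivative 𝓘(ℝ, Cn n) (Fin r → ℂ) V where
  map_I_smul : ∀ (σ : Π x, V x) (x : X), DiffSectionAt n r σ x →
    ∀ v, toFun (fun y => Complex.I • σ y) x v = Complex.I • toFun σ x v
  smooth : CovariantDerivative.ContMDiffCovariantDerivative toCovariantDerivative ∞

variable (n r V) in
/-- A smooth Hermitian metric on `V`, conjugate-linear in the first variable. Smoothness means that
the Gram matrices in the local frames of `V` are smooth. -/
structure HermitianMetric where
  inner : ∀ x, V x →ₗ⋆[ℂ] V x →ₗ[ℂ] ℂ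
  isInner : ∀ x, IsHermitianInner (inner x)
  smooth : ∀ (e : Trivialization (Fin r → ℂ) (π (Fin r → ℂ) V)) [MemTrivializationAtlas e]
    (a b : Fin r → ℂ), ContMDiffOn 𝓘(ℝ, Cn n) 𝓘(ℝ, ℂ) ∞
      (fun x => inner x (e.symm x a) (e.symm x b)) e.baseSet

/-- The decomposition `D = D_H + ψ` at the point `x`: `ψ` is an `H`-self-adjoint endomorphism-valued
covector, and `D_H = D - ψ` satisfies `d H(σ, τ) = H(D_H σ, τ) + H(σ, D_H τ)`. -/
structure IsSelfAdjointPart (D : ComplexConnection n r V) (H : HermitianMetric n r V) (x : X)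
    (ψ : TangentSpace 𝓘(ℝ, Cn n) x →ₗ[ℝ] Module.End ℂ (V x)) : Prop where
  selfAdjoint : ∀ v, IsSelfAdjointFor (H.inner x) (ψ v)
  unitary : ∀ σ τ : Π x, V x, DiffSectionAt n r σ x → DiffSectionAt n r τ x →
    ∀ v, dirDeriv (fun y => H.inner y (σ y) (τ y)) x v =
      H.inner x (D.toFun σ x v - ψ v (σ x)) (τ x) + H.inner x (σ x) (D.toFun τ x v - ψ v (τ x))

theorem sesq_real_smul_left {W : Type*} [AddCommGroup W] [Module ℂ W] (B : W →ₗ⋆[ℂ] W →ₗ[ℂ] ℂ)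
    (c : ℝ) (u w : W) : B (c • u) w = (c : ℂ) * B u w := by
  rw [← Complex.coe_smul, LinearMap.map_smulₛₗ]
  simp

theorem sesq_real_smul_right {W : Type*} [AddCommGroup W] [Module ℂ W] (B : W →ₗ⋆[ℂ] W →ₗ[ℂ] ℂ)
    (c : ℝ) (u w : W) : B u (c • w) = (c : ℂ) * B u w := by
  rw [← Complex.coe_smul, LinearMap.map_smul]
  simp

theorem mdifferentiableAt_sum' {ι : Type} [Fintype ι] {x : X} (f : ι → X → ℂ)
    (hf : ∀ i, MDifferentiableAt 𝓘(ℝ, Cn n) 𝓘(ℝ, ℂ) (f i) x) :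
    MDifferentiableAt 𝓘(ℝ, Cn n) 𝓘(ℝ, ℂ) (fun y => ∑ i, f i y) x := by
  have := MDifferentiableAt.sum (t := Finset.univ) (f := f) (z := x) (fun i _ => hf i)
  convert this using 1
  ext y
  simp

/-- The inner product of two differentiable sections is differentiable. -/
theorem HermitianMetric.mdifferentiableAt (H : HermitianMetric n r V) {σ τ : Π x, V x} {x : X}
    (hσ : DiffSectionAt n r σ x) (hτ : DiffSectionAt n r τ x) :
    MDifferentiableAt 𝓘(ℝ, Cn n) 𝓘(ℝ, ℂ) (fun y => H.inner y (σ y) (τ y)) x := by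
  have : ContMDiffVectorBundle 1 (Fin r → ℂ) V 𝓘(ℝ, Cn n) :=
    ContMDiffVectorBundle.of_le (n := ∞) (by simp)
  let e := trivializationAt (Fin r → ℂ) V x
  have hx : x ∈ e.baseSet := FiberBundle.mem_baseSet_trivializationAt' x
  let b := Module.finBasis ℝ (Fin r → ℂ)
  have hc : ∀ (σ : Π x, V x), DiffSectionAt n r σ x → ∀ i,
      MDifferentiableAt 𝓘(ℝ, Cn n) 𝓘(ℝ, ℝ)
        (fun y => e.localFrameCoeff 𝓘(ℝ, Cn n) b i y (σ y)) x := fun σ hσ i =>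
    mdifferentiableAt_localFrameCoeff b hx hσ i
  have hg : ∀ i j, MDifferentiableAt 𝓘(ℝ, Cn n) 𝓘(ℝ, ℂ)
      (fun y => H.inner y (e.symm y (b i)) (e.symm y (b j))) x := fun i j =>
    ((H.smooth e (b i) (b j)).contMDiffAt (e.open_baseSet.mem_nhds hx)).mdifferentiableAt (by simp)
  have hcC : ∀ (σ : Π x, V x), DiffSectionAt n r σ x → ∀ i,
      MDifferentiableAt 𝓘(ℝ, Cn n) 𝓘(ℝ, ℂ)
        (fun y => ((e.localFrameCoeff 𝓘(ℝ, Cn n) b i y (σ y) : ℝ) : ℂ)) x := fun σ hσ i =>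
    (Complex.ofRealCLM.differentiableAt.mdifferentiableAt
      (x := e.localFrameCoeff 𝓘(ℝ, Cn n) b i x (σ x))).comp x (hc σ hσ i)
  have hsum : MDifferentiableAt 𝓘(ℝ, Cn n) 𝓘(ℝ, ℂ)
      (fun y => ∑ i, ∑ j, ((e.localFrameCoeff 𝓘(ℝ, Cn n) b i y (σ y) : ℝ) : ℂ) *
        (((e.localFrameCoeff 𝓘(ℝ, Cn n) b j y (τ y) : ℝ) : ℂ) *
          H.inner y (e.symm y (b i)) (e.symm y (b j)))) x :=
    mdifferentiableAt_sum' _ fun i => mdifferentiableAt_sum' _ fun j =>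
      (hcC σ hσ i).mul ((hcC τ hτ j).mul (hg i j))
  refine hsum.congr_of_eventuallyEq ?_
  filter_upwards [e.open_baseSet.mem_nhds hx] with y hy
  have hfr : ∀ i, e.localFrame b i y = e.symm y (b i) := fun i => by
    rw [Bundle.Trivialization.localFrame_apply_of_mem_baseSet e b hy]
    simp [Bundle.Trivialization.basisAt]
  have h1 := Bundle.Trivialization.eq_sum_localFrameCoeff_smul (I := 𝓘(ℝ, Cn n)) (e := e) (b := b)
    (s := σ) hy
  have h2 := Bundle.Trivialization.eq_sum_localFrameCoeff_smul (I := 𝓘(ℝ, Cn n)) (e := e) (b := b)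
    (s := τ) hy
  conv_lhs => rw [h1, h2]
  simp only [map_sum, LinearMap.sum_apply, sesq_real_smul_left, sesq_real_smul_right, hfr]
  rw [Finset.sum_comm]
  exact Finset.sum_congr rfl fun i _ => Finset.sum_congr rfl fun j _ => by ring

/-- The expression `H(σ, D_v τ) + H(D_v σ, τ) - v H(σ, τ)` at the point `x`. -/
def metricDefect (D : ComplexConnection n r V) (H : HermitianMetric n r V) (x : X)
    (v : TangentSpace 𝓘(ℝ, Cn n) x) (σ τ : Π x, V x) : ℂ :=
  H.inner x (σ x) (D.toFun τ x v) + H.inner x (D.toFun σ x v) (τ x) -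
    dirDeriv (fun y => H.inner y (σ y) (τ y)) x v

theorem metricDefect_tensorial_left (D : ComplexConnection n r V) (H : HermitianMetric n r V)
    (x : X) (v : TangentSpace 𝓘(ℝ, Cn n) x) (τ : Π x, V x) (hτ : DiffSectionAt n r τ x) :
    TensorialAt 𝓘(ℝ, Cn n) (Fin r → ℂ) (fun σ => metricDefect D H x v σ τ) x where
  smul {f σ} hf hσ := by
    have h1 := D.isCovariantDerivativeOnUniv.leibniz hσ hf
    have h2 : (fun y => H.inner y ((f • σ) y) (τ y)) = fun y => f y • H.inner y (σ y) (τ y) := by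
      ext y
      simp [sesq_real_smul_left]
    simp only [metricDefect, h1, h2, dirDeriv]
    rw [mvfderiv_fun_smul hf (H.mdifferentiableAt hσ hτ)]
    simp [sesq_real_smul_left]
    ring
  add {σ σ'} hσ hσ' := by
    have h1 := D.isCovariantDerivativeOnUniv.add hσ hσ'
    have h2 : (fun y => H.inner y ((σ + σ') y) (τ y)) =
        fun y => H.inner y (σ y) (τ y) + H.inner y (σ' y) (τ y) := by
      ext y
      simp
    simp only [metricDefect, h1, h2, dirDeriv]
    rw [mvfderiv_fun_add (H.mdifferentiableAt hσ hτ) (H.mdifferentiableAt hσ' hτ)]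
    simp
    ring

theorem metricDefect_tensorial_right (D : ComplexConnection n r V) (H : HermitianMetric n r V)
    (x : X) (v : TangentSpace 𝓘(ℝ, Cn n) x) (σ : Π x, V x) (hσ : DiffSectionAt n r σ x) :
    TensorialAt 𝓘(ℝ, Cn n) (Fin r → ℂ) (fun τ => metricDefect D H x v σ τ) x where
  smul {f τ} hf hτ := by
    have h1 := D.isCovariantDerivativeOnUniv.leibniz hτ hf
    have h2 : (fun y => H.inner y (σ y) ((f • τ) y)) = fun y => f y • H.inner y (σ y) (τ y) := by
      ext y
      simp [sesq_real_smul_right]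
    simp only [metricDefect, h1, h2, dirDeriv]
    rw [mvfderiv_fun_smul hf (H.mdifferentiableAt hσ hτ)]
    simp [sesq_real_smul_right]
    ring
  add {τ τ'} hτ hτ' := by
    have h1 := D.isCovariantDerivativeOnUniv.add hτ hτ'
    have h2 : (fun y => H.inner y (σ y) ((τ + τ') y)) =
        fun y => H.inner y (σ y) (τ y) + H.inner y (σ y) (τ' y) := by
      ext y
      simp
    simp only [metricDefect, h1, h2, dirDeriv]
    rw [mvfderiv_fun_add (H.mdifferentiableAt hσ hτ) (H.mdifferentiableAt hσ hτ')]
    simp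
    ring

theorem dirDeriv_clm (L : ℂ →L[ℝ] ℂ) {f : X → ℂ} {x : X}
    (hf : MDifferentiableAt 𝓘(ℝ, Cn n) 𝓘(ℝ, ℂ) f x) (v : TangentSpace 𝓘(ℝ, Cn n) x) :
    dirDeriv (fun y => L (f y)) x v = L (dirDeriv f x v) := by
  have h := ((L.hasMFDerivAt (x := f x)).comp x hf.hasMFDerivAt).mfderiv
  exact DFunLike.congr_fun h v

theorem diffSectionAt_I_smul {σ : Π x, V x} {x : X} (hσ : DiffSectionAt n r σ x) :
    DiffSectionAt n r (fun y => Complex.I • σ y) x := by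
  unfold DiffSectionAt at *
  rw [mdifferentiableAt_section] at *
  have h := ((Complex.I • ContinuousLinearMap.id ℝ (Fin r → ℂ)).hasMFDerivAt
    (x := (trivializationAt (Fin r → ℂ) V x ⟨x, σ x⟩).2)).mdifferentiableAt.comp x hσ
  refine h.congr_of_eventuallyEq ?_
  filter_upwards [(trivializationAt (Fin r → ℂ) V x).open_baseSet.mem_nhds
    (FiberBundle.mem_baseSet_trivializationAt' x)] with y hy
  exact ((trivializationAt (Fin r → ℂ) V x).linear ℂ hy).map_smul Complex.I (σ y)

theorem IsHermitianInner.ext_right {W : Type*} [AddCommGroup W] [Module ℂ W]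
    {B : W →ₗ⋆[ℂ] W →ₗ[ℂ] ℂ} (hB : IsHermitianInner B) {w w' : W} (h : ∀ u, B u w = B u w') :
    w = w' := by
  by_contra hne
  have h1 := hB.pos (w - w') (sub_ne_zero.mpr hne)
  have h2 : B (w - w') (w - w') = 0 := by rw [map_sub (B (w - w')), h, sub_self]
  rw [h2] at h1
  simp at h1

theorem metricDefect_I_left (D : ComplexConnection n r V) (H : HermitianMetric n r V)
    (x : X) (v : TangentSpace 𝓘(ℝ, Cn n) x) {σ τ : Π x, V x} (hσ : DiffSectionAt n r σ x)
    (hτ : DiffSectionAt n r τ x) :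
    metricDefect D H x v (fun y => Complex.I • σ y) τ = -Complex.I * metricDefect D H x v σ τ := by
  have h := dirDeriv_clm (ContinuousLinearMap.mul ℝ ℂ (-Complex.I)) (H.mdifferentiableAt hσ hτ) v
  simp only [ContinuousLinearMap.mul_apply'] at h
  simp only [metricDefect, D.map_I_smul σ x hσ, LinearMap.map_smulₛₗ, LinearMap.smul_apply,
    Complex.conj_I, smul_eq_mul, h]
  ring

theorem metricDefect_I_right (D : ComplexConnection n r V) (H : HermitianMetric n r V)
    (x : X) (v : TangentSpace 𝓘(ℝ, Cn n) x) {σ τ : Π x, V x} (hσ : DiffSectionAt n r σ x)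
    (hτ : DiffSectionAt n r τ x) :
    metricDefect D H x v σ (fun y => Complex.I • τ y) = Complex.I * metricDefect D H x v σ τ := by
  have h := dirDeriv_clm (ContinuousLinearMap.mul ℝ ℂ Complex.I) (H.mdifferentiableAt hσ hτ) v
  simp only [ContinuousLinearMap.mul_apply'] at h
  simp only [metricDefect, D.map_I_smul τ x hτ, LinearMap.map_smul, smul_eq_mul, h]
  ring

theorem metricDefect_conj (D : ComplexConnection n r V) (H : HermitianMetric n r V)
    (x : X) (v : TangentSpace 𝓘(ℝ, Cn n) x) {σ τ : Π x, V x} (hσ : DiffSectionAt n r σ x)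
    (hτ : DiffSectionAt n r τ x) :
    starRingEnd ℂ (metricDefect D H x v σ τ) = metricDefect D H x v τ σ := by
  have h := dirDeriv_clm Complex.conjCLE.toContinuousLinearMap (H.mdifferentiableAt hσ hτ) v
  simp [(H.isInner _).conj_symm] at h
  simp only [metricDefect, map_sub, map_add, (H.isInner _).conj_symm, h]
  ring

/-- Every Hermitian metric `H` gives a unique decomposition `D = D_H + ψ` into an `H`-unitary
connection and an `H`-self-adjoint endomorphism-valued one-form. -/
theorem existsUnique_selfAdjointPart (D : ComplexConnection n r V) (H : HermitianMetric n r V)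
    (x : X) : ∃! ψ, IsSelfAdjointPart D H x ψ := by
  have : ContMDiffVectorBundle 1 (Fin r → ℂ) V 𝓘(ℝ, Cn n) :=
    ContMDiffVectorBundle.of_le (n := ∞) (by simp)
  have : FiniteDimensional ℂ (V x) := VectorBundle.finiteDimensional ℂ (Fin r → ℂ) V x
  have hext : ∀ u : V x, DiffSectionAt n r (FiberBundle.extend (Fin r → ℂ) u) x := fun u =>
    FiberBundle.mdifferentiableAt_extend 𝓘(ℝ, Cn n) (Fin r → ℂ) u
  have hpt : ∀ (v : TangentSpace 𝓘(ℝ, Cn n) x) {σ σ' τ τ' : Π x, V x}, DiffSectionAt n r σ x →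
      DiffSectionAt n r σ' x → DiffSectionAt n r τ x → DiffSectionAt n r τ' x →
      σ x = σ' x → τ x = τ' x → metricDefect D H x v σ τ = metricDefect D H x v σ' τ' :=
    fun v {σ σ' τ τ'} h1 h2 h3 h4 h5 h6 =>
      TensorialAt.pointwise₂ (fun τ hτ => metricDefect_tensorial_left D H x v τ hτ)
        (fun σ hσ => metricDefect_tensorial_right D H x v σ hσ) h1 h2 h3 h4 h5 h6
  have haddL : ∀ v (u u' w : V x), metricDefect D H x v (FiberBundle.extend (Fin r → ℂ) (u + u'))
      (FiberBundle.extend (Fin r → ℂ) w) =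
      metricDefect D H x v (FiberBundle.extend (Fin r → ℂ) u) (FiberBundle.extend (Fin r → ℂ) w) +
      metricDefect D H x v (FiberBundle.extend (Fin r → ℂ) u')
        (FiberBundle.extend (Fin r → ℂ) w) := by
    intro v u u' w
    have h := (metricDefect_tensorial_left D H x v _ (hext w)).add (hext u) (hext u')
    rw [← h]
    exact hpt v (hext _) (mdifferentiableAt_add_section (hext u) (hext u')) (hext w) (hext w)
      (by simp) rfl
  have hrealL : ∀ v (c : ℝ) (u w : V x),
      metricDefect D H x v (FiberBundle.extend (Fin r → ℂ) (c • u))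
        (FiberBundle.extend (Fin r → ℂ) w) =
      c * metricDefect D H x v (FiberBundle.extend (Fin r → ℂ) u)
        (FiberBundle.extend (Fin r → ℂ) w) := by
    intro v c u w
    have h := (metricDefect_tensorial_left D H x v _ (hext w)).smul (f := fun _ => c)
      mdifferentiableAt_const (hext u)
    rw [← Complex.real_smul, ← h]
    exact hpt v (hext _) (MDifferentiableAt.smul_section mdifferentiableAt_const (hext u))
      (hext w) (hext w) (by simp) rfl
  have hIL : ∀ v (u w : V x),
      metricDefect D H x v (FiberBundle.extend (Fin r → ℂ) (Complex.I • u))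
        (FiberBundle.extend (Fin r → ℂ) w) =
      -Complex.I * metricDefect D H x v (FiberBundle.extend (Fin r → ℂ) u)
        (FiberBundle.extend (Fin r → ℂ) w) := by
    intro v u w
    rw [← metricDefect_I_left D H x v (hext u) (hext w)]
    exact hpt v (hext _) (diffSectionAt_I_smul (hext u)) (hext w) (hext w) (by simp) rfl
  have hsmulL : ∀ v (c : ℂ) (u w : V x),
      metricDefect D H x v (FiberBundle.extend (Fin r → ℂ) (c • u))
        (FiberBundle.extend (Fin r → ℂ) w) =
      starRingEnd ℂ c * metricDefect D H x v (FiberBundle.extend (Fin r → ℂ) u)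
        (FiberBundle.extend (Fin r → ℂ) w) := by
    intro v c u w
    have hc : c • u = c.re • u + c.im • (Complex.I • u) := by
      conv_lhs => rw [← Complex.re_add_im c]
      rw [add_smul, mul_smul, Complex.coe_smul, Complex.coe_smul]
    have hc' : starRingEnd ℂ c = c.re - c.im * Complex.I := by
      apply Complex.ext <;> simp
    rw [hc, haddL, hrealL, hrealL, hIL, hc']
    ring
  have hconj : ∀ v (u w : V x),
      metricDefect D H x v (FiberBundle.extend (Fin r → ℂ) u) (FiberBundle.extend (Fin r → ℂ) w) =
      starRingEnd ℂ (metricDefect D H x v (FiberBundle.extend (Fin r → ℂ) w)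
        (FiberBundle.extend (Fin r → ℂ) u)) := fun v u w =>
    (metricDefect_conj D H x v (hext w) (hext u)).symm
  let C : TangentSpace 𝓘(ℝ, Cn n) x → (V x →ₗ⋆[ℂ] V x →ₗ[ℂ] ℂ) := fun v =>
    LinearMap.mk₂'ₛₗ (starRingEnd ℂ) (RingHom.id ℂ)
      (fun u w => (1 / 2 : ℂ) * metricDefect D H x v (FiberBundle.extend (Fin r → ℂ) u)
        (FiberBundle.extend (Fin r → ℂ) w))
      (fun u u' w => by rw [haddL, mul_add])
      (fun c u w => by rw [hsmulL, smul_eq_mul]; ring)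
      (fun u w w' => by rw [hconj, haddL, map_add, ← hconj, ← hconj, mul_add])
      (fun c u w => by
        rw [hconj, hsmulL, map_mul, ← hconj, Complex.conj_conj, RingHom.id_apply, smul_eq_mul]
        ring)
  have hC : ∀ v {σ τ : Π x, V x}, DiffSectionAt n r σ x → DiffSectionAt n r τ x →
      C v (σ x) (τ x) = (1 / 2 : ℂ) * metricDefect D H x v σ τ := by
    intro v σ τ hσ hτ
    simp only [C, LinearMap.mk₂'ₛₗ_apply]
    rw [hpt v (hext (σ x)) hσ (hext (τ x)) hτ (by simp) (by simp)]
  have hCadd : ∀ v v' u w, C (v + v') u w = C v u w + C v' u w := by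
    intro v v' u w
    simp only [C, LinearMap.mk₂'ₛₗ_apply, metricDefect, dirDeriv, map_add, LinearMap.add_apply]
    ring
  have hCsmul : ∀ (c : ℝ) v u w, C (c • v) u w = c * C v u w := by
    intro c v u w
    simp only [C, LinearMap.mk₂'ₛₗ_apply, metricDefect, dirDeriv, map_smul, sesq_real_smul_left,
      sesq_real_smul_right, Complex.real_smul]
    ring
  let ψ : TangentSpace 𝓘(ℝ, Cn n) x →ₗ[ℝ] Module.End ℂ (V x) :=
    { toFun := fun v => rieszEnd (H.isInner x) (C v)
      map_add' := fun v v' => by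
        ext w
        refine (H.isInner x).ext_right fun u => ?_
        rw [rieszEnd_spec, LinearMap.add_apply, map_add (H.inner x u), rieszEnd_spec, rieszEnd_spec, hCadd]
      map_smul' := fun c v => by
        ext w
        refine (H.isInner x).ext_right fun u => ?_
        rw [rieszEnd_spec, RingHom.id_apply, LinearMap.smul_apply, sesq_real_smul_right, rieszEnd_spec,
          hCsmul] }
  have hψ : ∀ v u w, H.inner x u (ψ v w) = C v u w := fun v u w => rieszEnd_spec (H.isInner x) (C v) u w
  have hCconj : ∀ v u w, starRingEnd ℂ (C v u w) = C v w u := by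
    intro v u w
    have h2 : starRingEnd ℂ (1 / 2 : ℂ) = 1 / 2 := by
      rw [map_div₀, map_one, Complex.conj_ofNat]
    simp only [C, LinearMap.mk₂'ₛₗ_apply, map_mul, h2]
    rw [← hconj]
  have hψ' : ∀ v u w, H.inner x (ψ v u) w = C v u w := fun v u w => by
    rw [← (H.isInner x).conj_symm, hψ, hCconj]
  refine ⟨ψ, ⟨fun v u w => by rw [hψ, hψ'], fun σ τ hσ hτ v => ?_⟩, fun ψ' h' => ?_⟩
  · rw [map_sub, LinearMap.sub_apply, map_sub (H.inner x (σ x)), hψ, hψ', hC v hσ hτ, metricDefect]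
    ring
  · refine LinearMap.ext fun v => LinearMap.ext fun w => (H.isInner x).ext_right fun u => ?_
    have h1 := h'.unitary _ _ (hext u) (hext w) v
    rw [FiberBundle.extend_apply_self, FiberBundle.extend_apply_self, map_sub, LinearMap.sub_apply,
      map_sub (H.inner x u), h'.selfAdjoint v u w] at h1
    have h2 := hC v (hext u) (hext w)
    rw [metricDefect, FiberBundle.extend_apply_self, FiberBundle.extend_apply_self, h1] at h2
    rw [hψ, h2]
    ring

/-- The self-adjoint one-form `ψ_H` of the decomposition `D = D_H + ψ_H`. -/
def psi (D : ComplexConnection n r V) (H : HermitianMetric n r V) (x : X) :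
    TangentSpace 𝓘(ℝ, Cn n) x →ₗ[ℝ] Module.End ℂ (V x) :=
  Classical.choose (existsUnique_selfAdjointPart D H x).exists

theorem psi_spec (D : ComplexConnection n r V) (H : HermitianMetric n r V) (x : X) :
    IsSelfAdjointPart D H x (psi D H x) :=
  Classical.choose_spec (existsUnique_selfAdjointPart D H x).exists

/-- The `H`-unitary connection `D_H = D - ψ_H`. -/
def unitaryPart (D : ComplexConnection n r V) (H : HermitianMetric n r V) (σ : Π x, V x) (x : X)
    (v : TangentSpace 𝓘(ℝ, Cn n) x) : V x :=
  D.toFun σ x v - psi D H x v (σ x)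

/-- The curvature `F_D = D²`, evaluated on the (commuting) coordinate vector fields of `φ` in the
directions `v, w ∈ ℂⁿ` and applied to the section `σ`. -/
def curvature (D : ComplexConnection n r V) (φ : OpenPartialHomeomorph X (Cn n)) (v w : Cn n)
    (σ : Π x, V x) (x : X) : V x :=
  D.toFun (fun y => D.toFun σ y (coordField φ w y)) x (coordField φ v x) -
    D.toFun (fun y => D.toFun σ y (coordField φ v y)) x (coordField φ w x)

/-- The operator `D''_H = ∂̄_H + ψ_H^{1,0}` in the direction of the coordinate vector field `v` of
`φ`, where `∂̄_H` is the `(0,1)`-part of `D_H`, i.e. `∂̄_{H,v} = ½ (D_{H,v} + i D_{H,Jv})`, and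
`ψ_H^{1,0}` is the `(1,0)`-part of `ψ_H`, i.e. `ψ_H^{1,0}(v) = ½ (ψ_H(v) - i ψ_H(J v))`. -/
def dbarHiggs (D : ComplexConnection n r V) (H : HermitianMetric n r V)
    (φ : OpenPartialHomeomorph X (Cn n)) (v : Cn n) (σ : Π x, V x) (x : X) : V x :=
  (1 / 2 : ℂ) • (unitaryPart D H σ x (coordField φ v x) +
      Complex.I • unitaryPart D H σ x (coordField φ (Complex.I • v) x)) +
    (1 / 2 : ℂ) • (psi D H x (coordField φ v x) (σ x) -
      Complex.I • psi D H x (coordField φ (Complex.I • v) x) (σ x))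

/-- The pseudo-curvature `G_H = (D''_H)²`, evaluated on the coordinate vector fields of the
holomorphic chart `φ` in the directions `v, w ∈ ℂⁿ` and applied to the section `σ`. -/
def pseudoCurvature (D : ComplexConnection n r V) (H : HermitianMetric n r V)
    (φ : OpenPartialHomeomorph X (Cn n)) (v w : Cn n) (σ : Π x, V x) (x : X) : V x :=
  dbarHiggs D H φ v (dbarHiggs D H φ w σ) x - dbarHiggs D H φ w (dbarHiggs D H φ v σ) x

/-- `D` is a non-Hermitian Yang-Mills connection: `F_D` is of type `(1,1)`, that is
`F_D(J v, J w) = F_D(v, w)`, and `√-1 Λ_ω F_D = lam Id` for a real constant `lam`. -/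
def IsNHYM (κ : KahlerMetric n X) (D : ComplexConnection n r V) : Prop :=
  ∃ lam : ℝ, ∀ φ ∈ IsManifold.maximalAtlas 𝓘(ℂ, Cn n) ω X, ∀ x ∈ φ.source,
    ∀ σ : Π x, V x, SmoothSectionAt n r σ x →
      (∀ v w : Cn n,
        curvature D φ (Complex.I • v) (Complex.I • w) σ x = curvature D φ v w σ x) ∧
      Complex.I • κ.contract φ x (fun v w => curvature D φ v w σ x) = (lam : ℂ) • σ x

/-- The time interval `[0, T)`, for `T ≤ +∞`. -/
def timeInterval (T : EReal) : Set ℝ := {t | 0 ≤ t ∧ (t : EReal) < T}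

/-- `H(t)`, `0 ≤ t < T`, is a smooth solution of `H⁻¹ ∂H/∂t = 4 √-1 Λ_ω G_H`. The Gram matrices of
`H` in the local frames are jointly smooth in `(t, x)`, up to `t = 0`; the equation is paired with
the metric, `∂_t H(u, σ) = H(u, 4 √-1 Λ_ω G_H σ)`. -/
structure IsHeatFlow (κ : KahlerMetric n X) (D : ComplexConnection n r V) (T : EReal)
    (H : ℝ → HermitianMetric n r V) : Prop where
  smooth : ∀ (e : Trivialization (Fin r → ℂ) (π (Fin r → ℂ) V)) [MemTrivializationAtlas e]
    (a b : Fin r → ℂ), ContMDiffOn (𝓘(ℝ, ℝ).prod 𝓘(ℝ, Cn n)) 𝓘(ℝ, ℂ) ∞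
      (fun p : ℝ × X => (H p.1).inner p.2 (e.symm p.2 a) (e.symm p.2 b))
      (timeInterval T ×ˢ e.baseSet)
  flow : ∀ t ∈ timeInterval T, ∀ φ ∈ IsManifold.maximalAtlas 𝓘(ℂ, Cn n) ω X, ∀ x ∈ φ.source,
    ∀ (u : V x) (σ : Π x, V x), SmoothSectionAt n r σ x →
      HasDerivWithinAt (fun s => (H s).inner x u (σ x))
        ((H t).inner x u ((4 * Complex.I) •
          κ.contract φ x (fun v w => pseudoCurvature D (H t) φ v w σ x)))
        (timeInterval T) t

/-- The pointwise norm `|log h|_K` of the logarithm of `h = K⁻¹ H`. -/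
def logNorm (K H : HermitianMetric n r V) (x : X) : ℝ :=
  haveI : FiniteDimensional ℂ (V x) := VectorBundle.finiteDimensional ℂ (Fin r → ℂ) V x
  endNorm (K.isInner x) (logEnd (K.isInner x) (H.isInner x))

/-- The pointwise norm `|ψ_H|_{H,ω}`, where `|ψ_H|² = ∑ g^{ab} ⟨ψ_H(∂_a), ψ_H(∂_b)⟩_H`. -/
def psiNorm (κ : KahlerMetric n X) (D : ComplexConnection n r V) (H : HermitianMetric n r V)
    (x : X) : ℝ :=
  haveI : FiniteDimensional ℂ (V x) := VectorBundle.finiteDimensional ℂ (Fin r → ℂ) V x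
  √(∑ a, ∑ b, κ.inv (chartAt (Cn n) x) x a b *
    (endInner (H.isInner x) (psi D H x (coordField (chartAt (Cn n) x) (realBasis n a) x))
      (psi D H x (coordField (chartAt (Cn n) x) (realBasis n b) x))).re)

end Bundles

end

open Bundle Manifold ContDiff Topology

noncomputable section

/-! The proof is a maximum principle for `|ψ_H|² + a tr (K⁻¹ H)` with a large constant `a`. Work in
a holomorphic chart and a local frame. Let `A` be the connection form of `D`, let `B = A - ψ` be the
form of its unitary part, and let `∇` be the coordinate derivative twisted by `B`. Then `∂_a H =
A_a^* H + H A_a - 2 H ψ_a`, and for a Yang-Mills connection the flow reads `∂_t H = -2 H g^{ab} ∇_a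
ψ_b` (`LocalMetric.gSum_localPseudo`).

The curvature splits as `F_A = (F_B + [ψ, ψ]) + dψ`, where `dψ` is formed with `∇`. The first part
is skew-adjoint and the second self-adjoint, so the two are orthogonal for the real trace. Commuting
derivatives with the help of this splitting gives a Bochner formula (`FlowData.bochner`) for the
operator `g^{ck} ∂_c ∂_k - ∂_t` applied to the energy `g^{ab} tr (ψ_a ψ_b)`. The second derivatives
of `ψ` cancel against the evolution of `ψ`. The squares of `∇ψ` and of `[ψ, ψ]` appear with a good
sign. All other terms are bounded by `|ψ| |∇ψ|`, `|ψ|²` and `|ψ|`, with coefficients from the fixed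
geometry. Hence the operator applied to the energy is at least `-C (1 + |ψ|²)`
(`exists_heatOp_energy_bound`).

Applied to `tr (K⁻¹ H)`, the same operator is at least `c |ψ|² - C` with `c > 0`: differentiating
`H` twice produces `4 H ψ ψ`, and the flow equation cancels the derivative of `ψ`
(`exists_heatOp_trace_bound`).

The bound on `log h` says that `e^{-C₁} K ≤ H ≤ e^{C₁} K`. It makes the constants above uniform over
all flows, and it bounds `tr (K⁻¹ H)`. Once `a c ≥ C + 1`, a maximum over `[0, t] × X` at a positive
time forces a bound on `|ψ|²` there (`IsFrameOn.exists_energy_bound_at_max`), while at time zero the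
metric is `K`. A finite cover of `X` by coordinate patches then gives the global bound
(`exists_energy_bound`).

The identities are proved in an abstract ring with commuting derivations, an involution and a trace.
They are then applied to the ring of smooth matrix-valued functions, where every derivative exists,
and evaluated at a point. -/

/-! ### The Bochner identity in a ring with commuting derivations -/

section Bochner

variable {ι R : Type*} [Ring R]

/-- The derivation `X ↦ ∂_a X + [B_a, X]` obtained by twisting with a connection form `B`. -/
def twist (d : ι → R →+ R) (B : ι → R) (a : ι) (x : R) : R :=
  d a x + (B a * x - x * B a)

/-- The curvature `∂_a B_b - ∂_b B_a + [B_a, B_b]` of a connection form. -/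
def curvForm (d : ι → R →+ R) (B : ι → R) (a b : ι) : R :=
  d a (B b) - d b (B a) + (B a * B b - B b * B a)

variable {d : ι → R →+ R} {B : ι → R}

theorem twist_add (a : ι) (x y : R) : twist d B a (x + y) = twist d B a x + twist d B a y := by
  simp only [twist, map_add]
  noncomm_ring

theorem twist_sub (a : ι) (x y : R) : twist d B a (x - y) = twist d B a x - twist d B a y := by
  simp only [twist, map_sub]
  noncomm_ring

theorem twist_neg (a : ι) (x : R) : twist d B a (-x) = -twist d B a x := by
  simp only [twist, map_neg]
  noncomm_ring

theorem twist_sum {κ : Type*} (s : Finset κ) (a : ι) (x : κ → R) :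
    twist d B a (∑ k ∈ s, x k) = ∑ k ∈ s, twist d B a (x k) := by
  simp only [twist, map_sum, Finset.sum_add_distrib, Finset.sum_sub_distrib, Finset.mul_sum,
    Finset.sum_mul]

theorem twist_mul (hL : ∀ a x y, d a (x * y) = d a x * y + x * d a y) (a : ι) (x y : R) :
    twist d B a (x * y) = twist d B a x * y + x * twist d B a y := by
  simp only [twist, hL]
  noncomm_ring

/-- Differentiate `g * x = x * g` and cancel. Derivatives of the metric coefficients thus stay
central and can be moved out of products. -/
theorem deriv_central {δ : R →+ R} (hL : ∀ x y, δ (x * y) = δ x * y + x * δ y) {g : R}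
    (hg : ∀ x, g * x = x * g) (x : R) : δ g * x = x * δ g := by
  have h := congrArg δ (hg x)
  rw [hL, hL, hg (δ x), add_comm (δ x * g)] at h
  exact add_right_cancel h

theorem twist_central {g : R} (hg : ∀ x, g * x = x * g) (a : ι) : twist d B a g = d a g := by
  simp [twist, hg]

/-- The Ricci identity: the `d a` commute, so only zeroth-order terms survive, and they form the
commutator with the curvature. -/
theorem twist_comm (hL : ∀ a x y, d a (x * y) = d a x * y + x * d a y)
    (hC : ∀ a b x, d a (d b x) = d b (d a x)) (a b : ι) (x : R) :
    twist d B a (twist d B b x) =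
      twist d B b (twist d B a x) + (curvForm d B a b * x - x * curvForm d B a b) := by
  simp only [twist, curvForm, hL, map_add, map_sub, hC a b x]
  noncomm_ring

/-- A trace annihilates the commutator terms of the twisted second derivative. -/
theorem trace_twist_twist (τ : R →+ ℝ) (hτ : ∀ x y, τ (x * y) = τ (y * x))
    (hL : ∀ a x y, d a (x * y) = d a x * y + x * d a y) {g : R} (hg : ∀ x, g * x = x * g)
    (a b : ι) (x : R) : τ (g * twist d B a (twist d B b x)) = τ (g * d a (d b x)) := by
  have h : ∀ y z, τ (g * (y * z)) = τ (g * (z * y)) := fun y z => by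
    rw [← mul_assoc, hτ, ← mul_assoc, ← hg, mul_assoc]
  simp only [twist, hL, map_add, map_sub, mul_add, mul_sub, add_mul, sub_mul]
  have h1 := h (d a (B b)) x
  have h2 := h (B b) (d a x)
  have h3 := h (B a) (d b x)
  have h4 := h (B a) (B b * x)
  have h5 := h (B a) (x * B b)
  rw [h1, h2, h3, h4, h5]
  ring

/-- This is `F_A = F_B + d_B ψ + [ψ, ψ]` for `B = A - ψ`. When `B` is unitary and `ψ` self-adjoint,
the middle term is the self-adjoint part of `F_A` and the other two form its skew part. The Bochner
computation rests on this splitting. -/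
theorem curvForm_sub_form (A ψ : ι → R) (a b : ι) :
    curvForm d A a b = curvForm d (A - ψ) a b +
      (twist d (A - ψ) a (ψ b) - twist d (A - ψ) b (ψ a)) + (ψ a * ψ b - ψ b * ψ a) := by
  simp only [curvForm, twist, Pi.sub_apply, map_sub]
  noncomm_ring

theorem twist_sub_form (A ψ : ι → R) (a : ι) (x : R) :
    twist d (A - ψ) a x = twist d A a x - (ψ a * x - x * ψ a) := by
  simp only [twist, Pi.sub_apply]
  noncomm_ring

end Bochner

/-! ### Adjoints with respect to a metric, and the heat flow in a ring with derivations. -/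

section SelfAdjoint

variable {ι R : Type*} [Ring R] [StarRing R] {d : ι → R →+ R} {B : ι → R} {H Hi : R}

/-- `x` is self-adjoint with respect to the metric `H`. -/
def IsSaFor (H x : R) : Prop := star x * H = H * x

/-- `x` is skew-adjoint with respect to the metric `H`. -/
def IsSkewFor (H x : R) : Prop := star x * H = -(H * x)

theorem IsSaFor.sub {x y : R} (hx : IsSaFor H x) (hy : IsSaFor H y) : IsSaFor H (x - y) := by
  simp only [IsSaFor, star_sub, sub_mul, mul_sub] at *
  rw [hx, hy]

theorem IsSkewFor.add {x y : R} (hx : IsSkewFor H x) (hy : IsSkewFor H y) :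
    IsSkewFor H (x + y) := by
  simp only [IsSkewFor, star_add, add_mul, mul_add] at *
  rw [hx, hy]
  abel

theorem IsSaFor.commutator {x y : R} (hx : IsSaFor H x) (hy : IsSaFor H y) :
    IsSkewFor H (x * y - y * x) := by
  simp only [IsSaFor, IsSkewFor, star_sub, star_mul, sub_mul, mul_sub, mul_assoc] at *
  rw [hx, hy, ← mul_assoc (star y), hy, ← mul_assoc (star x), hx]
  noncomm_ring

/-- The hypothesis `hB` says that `B` is unitary, that is `∇ H = 0`. Differentiating `star x * H = H
* x` therefore only moves the derivative onto `x`. -/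
theorem IsSaFor.twist (hL : ∀ a x y, d a (x * y) = d a x * y + x * d a y)
    (hS : ∀ a x, d a (star x) = star (d a x)) (hB : ∀ a, d a H = star (B a) * H + H * B a)
    {x : R} (hx : IsSaFor H x) (a : ι) : IsSaFor H (twist d B a x) := by
  have h := congrArg (d a) hx
  simp only [IsSaFor] at hx
  rw [hL, hL, hB, hS] at h
  simp only [IsSaFor, _root_.twist, star_add, star_sub, star_mul, add_mul, sub_mul, mul_add,
    mul_sub]
  have h1 : star (B a) * star x * H = star (B a) * H * x := by rw [mul_assoc, hx, mul_assoc]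
  have h2 : star x * star (B a) * H = d a H * x + H * d a x - star (d a x) * H - H * x * B a := by
    rw [← hx, hB, ← sub_eq_zero]
    have := sub_eq_zero.mpr h
    rw [← this]
    noncomm_ring
  rw [h1, h2, hB]
  noncomm_ring

theorem IsSkewFor.twist (hL : ∀ a x y, d a (x * y) = d a x * y + x * d a y)
    (hS : ∀ a x, d a (star x) = star (d a x)) (hB : ∀ a, d a H = star (B a) * H + H * B a)
    {x : R} (hx : IsSkewFor H x) (a : ι) : IsSkewFor H (twist d B a x) := by
  have h := congrArg (d a) hx
  simp only [IsSkewFor] at hx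
  rw [hL, map_neg, hL, hB, hS] at h
  simp only [IsSkewFor, _root_.twist, star_add, star_sub, star_mul, add_mul, sub_mul, mul_add,
    mul_sub]
  have h1 : star (B a) * star x * H = -(star (B a) * H * x) := by
    rw [mul_assoc, hx, mul_neg, mul_assoc]
  have h2 : star x * star (B a) * H =
      -(d a H * x + H * d a x) - star (d a x) * H + H * x * B a := by
    have hx' : H * x = -(star x * H) := by rw [hx, neg_neg]
    rw [hx', hB, ← sub_eq_zero]
    have := sub_eq_zero.mpr h
    rw [← this]
    noncomm_ring
  rw [h1, h2, hB]
  noncomm_ring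

/-- The curvature of an `H`-unitary connection form is skew-adjoint. -/
theorem isSkewFor_curvForm (hL : ∀ a x y, d a (x * y) = d a x * y + x * d a y)
    (hC : ∀ a b x, d a (d b x) = d b (d a x)) (hS : ∀ a x, d a (star x) = star (d a x))
    (hB : ∀ a, d a H = star (B a) * H + H * B a) (a b : ι) : IsSkewFor H (curvForm d B a b) := by
  have h := hC a b H
  rw [hB b, hB a] at h
  simp only [map_add, hL, hS, hB] at h
  simp only [IsSkewFor, curvForm, star_add, star_sub, star_mul]
  rw [← sub_eq_zero] at h ⊢
  rw [← h]
  noncomm_ring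

/-- Self-adjoint and skew-adjoint elements are orthogonal for a real trace. -/
theorem IsSaFor.trace_mul_skew {τ : R →+ ℝ} (hτ : ∀ x y, τ (x * y) = τ (y * x))
    (hτs : ∀ x, τ (star x) = τ x) (hi : H * Hi = 1) (hi' : Hi * H = 1) {x y : R}
    (hx : IsSaFor H x) (hy : IsSkewFor H y) : τ (x * y) = 0 := by
  have h1 : star x = H * x * Hi := by
    rw [← hx, mul_assoc, hi, mul_one]
  have h2 : star y = -(H * y * Hi) := by
    rw [← neg_mul, ← hy, mul_assoc, hi, mul_one]
  have h4 : τ (H * y * Hi * (H * x * Hi)) = τ (x * y) := by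
    have : H * y * Hi * (H * x * Hi) = H * (y * (Hi * H) * x * Hi) := by noncomm_ring
    rw [this, hi', hτ, mul_one, mul_assoc, hi', mul_one, hτ]
  -- The adjoint preserves `τ`, and it is conjugation by `H` on `x` but minus this conjugation on
  -- `y`; so `τ (x * y)` equals its own negative.
  have h3 := hτs (x * y)
  rw [star_mul, h1, h2, neg_mul, map_neg, h4] at h3
  linarith

/-- The algebraic data of the heat flow of metrics `∂_t H = H θ`, `θ = -2 g^{cd} ∇_c ψ_d`, where
`∂_a H = A_a^* H + H A_a - 2 H ψ_a` and `∇` is the connection with form `B = A - ψ`. -/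
structure FlowData [Fintype ι] (d : ι → R →+ R) (dt : R →+ R) (τ : R →+ ℝ) (H Hi : R)
    (A ψ : ι → R) (G : ι → ι → R) (g : ι → ι → ℝ) (dg : ι → ι → ι → ℝ)
    (ddg : ι → ι → ι → ι → ℝ) : Prop where
  leib : ∀ a x y, d a (x * y) = d a x * y + x * d a y
  leib_t : ∀ x y, dt (x * y) = dt x * y + x * dt y
  comm : ∀ a b x, d a (d b x) = d b (d a x)
  comm_t : ∀ a x, dt (d a x) = d a (dt x)
  star_d : ∀ a x, d a (star x) = star (d a x)
  trace_comm : ∀ x y, τ (x * y) = τ (y * x)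
  trace_star : ∀ x, τ (star x) = τ x
  mul_inv : H * Hi = 1
  inv_mul : Hi * H = 1
  central : ∀ a b x, G a b * x = x * G a b
  -- `τ` is the trace at a single point: the central coefficient `G a b` and its first two
  -- derivatives leave it as the numbers `g`, `dg` and `ddg`.
  trace_G : ∀ a b x, τ (G a b * x) = g a b * τ x
  trace_dG : ∀ c a b x, τ (d c (G a b) * x) = dg c a b * τ x
  trace_ddG : ∀ c k a b x, τ (d c (d k (G a b)) * x) = ddg c k a b * τ x
  symm_g : ∀ a b, g a b = g b a
  A_t : ∀ a, dt (A a) = 0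
  star_A_t : ∀ a, dt (star (A a)) = 0
  G_t : ∀ a b, dt (G a b) = 0
  psi_sa : ∀ a, IsSaFor H (ψ a)
  d_H : ∀ a, d a H = star (A a) * H + H * A a - 2 * (H * ψ a)
  dt_H : dt H = H * (-2 * ∑ c, ∑ k, G c k * twist d (A - ψ) c (ψ k))

namespace FlowData

variable [Fintype ι] {dt : R →+ R} {τ : R →+ ℝ} {A ψ : ι → R} {G : ι → ι → R}
  {g : ι → ι → ℝ} {dg : ι → ι → ι → ℝ} {ddg : ι → ι → ι → ι → ℝ}

/-- Self-adjointness lets `2 H ψ` be shared evenly between the two sides of `H`, so `A - ψ` is a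
unitary connection form. -/
theorem d_H' (h : FlowData d dt τ H Hi A ψ G g dg ddg) (a : ι) :
    d a H = star ((A - ψ) a) * H + H * (A - ψ) a := by
  have := h.psi_sa a
  simp only [IsSaFor] at this
  rw [h.d_H, Pi.sub_apply, star_sub, sub_mul, this]
  noncomm_ring

/-- The evolution equation `2 ∂_t ψ = -∇ θ + [ψ, θ]`. -/
theorem dt_psi (h : FlowData d dt τ H Hi A ψ G g dg ddg) (a : ι) {θ : R} (hθ : dt H = H * θ) :
    2 * dt (ψ a) = -twist d (A - ψ) a θ + (ψ a * θ - θ * ψ a) := by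
  -- Equate the two mixed derivatives of `H`. Since `A` does not depend on time, `∂_t ψ` is the only
  -- unknown, and cancelling `H` isolates it.
  have h1 := h.comm_t a H
  have h2 : dt 2 = 0 := by
    have : dt 1 = 0 := by simpa using h.leib_t 1 1
    rw [← one_add_one_eq_two, map_add, this, add_zero]
  rw [h.d_H, hθ, h.leib, h.d_H] at h1
  simp only [map_add, map_sub, h.leib_t, h.A_t, h.star_A_t, hθ, h2] at h1
  have h3 : H * (2 * dt (ψ a)) = H * (-twist d (A - ψ) a θ + (ψ a * θ - θ * ψ a)) := by
    simp only [twist, Pi.sub_apply]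
    rw [← sub_eq_zero] at h1 ⊢
    rw [← neg_eq_zero, ← h1]
    noncomm_ring
  have h4 := congrArg (Hi * ·) h3
  simpa only [← mul_assoc, h.inv_mul, one_mul] using h4

/-- The trace of `∇_c ∇_k ψ_a · ψ_b`, after commuting derivatives. -/
theorem trace_hess_psi (h : FlowData d dt τ H Hi A ψ G g dg ddg) (a b c k : ι) :
    τ (twist d (A - ψ) c (twist d (A - ψ) k (ψ a)) * ψ b) =
      τ (twist d (A - ψ) a (twist d (A - ψ) c (ψ k)) * ψ b) +
      τ (curvForm d A c a * (ψ k * ψ b - ψ b * ψ k)) -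
      τ ((ψ c * ψ a - ψ a * ψ c) * (ψ k * ψ b - ψ b * ψ k)) +
      τ ((twist d A c (curvForm d A k a) -
        (ψ c * curvForm d A k a - curvForm d A k a * ψ c)) * ψ b) := by
  have hsa : ∀ a b, IsSaFor H (twist d (A - ψ) a (ψ b)) := fun a b =>
    (h.psi_sa b).twist h.leib h.star_d h.d_H' a
  have hcv := isSkewFor_curvForm h.leib h.comm h.star_d h.d_H'
  -- The skew part `F_B + [ψ, ψ]` of the curvature stays skew under `∇_c`, so it is orthogonal to `ψ
  -- b` and disappears from the trace.
  have hS := ((hcv k a).add ((h.psi_sa k).commutator (h.psi_sa a))).twist h.leib h.star_d h.d_H' c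
  have hS0 : τ (twist d (A - ψ) c
      (curvForm d (A - ψ) k a + (ψ k * ψ a - ψ a * ψ k)) * ψ b) = 0 := by
    rw [h.trace_comm]
    exact (h.psi_sa b).trace_mul_skew h.trace_comm h.trace_star h.mul_inv h.inv_mul hS
  -- Likewise the self-adjoint part `dψ` is orthogonal to the skew commutator; this allows `F_B` to
  -- be replaced by `F_A - [ψ, ψ]` in `e2`.
  have hP0 : τ ((twist d (A - ψ) c (ψ a) - twist d (A - ψ) a (ψ c)) *
      (ψ k * ψ b - ψ b * ψ k)) = 0 :=
    ((hsa c a).sub (hsa a c)).trace_mul_skew h.trace_comm h.trace_star h.mul_inv h.inv_mul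
      ((h.psi_sa k).commutator (h.psi_sa b))
  -- Exchange the indices of `∇_k ψ_a`: the error `dψ` is the curvature of `A` minus its skew part.
  have e1 : twist d (A - ψ) k (ψ a) = twist d (A - ψ) a (ψ k) + (curvForm d A k a -
      (curvForm d (A - ψ) k a + (ψ k * ψ a - ψ a * ψ k))) := by
    rw [curvForm_sub_form A ψ]
    abel
  have e2 : τ ((curvForm d (A - ψ) c a * ψ k - ψ k * curvForm d (A - ψ) c a) * ψ b) =
      τ (curvForm d A c a * (ψ k * ψ b - ψ b * ψ k)) -
      τ ((ψ c * ψ a - ψ a * ψ c) * (ψ k * ψ b - ψ b * ψ k)) := by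
    rw [curvForm_sub_form A ψ c a, add_mul, add_mul, map_add, map_add, hP0, sub_mul (_ * _) _ (ψ b),
      mul_assoc, mul_assoc, map_sub, h.trace_comm (ψ k), mul_assoc, ← map_sub, ← mul_sub]
    ring
  conv_lhs => rw [e1]
  rw [twist_add, twist_comm h.leib h.comm c a, twist_sub, twist_sub_form A ψ c (curvForm d A k a),
    add_mul, add_mul, map_add, map_add, e2, sub_mul _ _ (ψ b), map_sub _ _ (_ * ψ b), hS0]
  ring

/-- Under the trace, plain second derivatives may be replaced by twisted ones (`trace_twist_twist`),
and the Leibniz rule does the rest. The coordinates are not normal, so derivatives of the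
coefficients remain as lower-order terms in `dg` and `ddg`. -/
theorem trace_hess_metric (h : FlowData d dt τ H Hi A ψ G g dg ddg) (a b c k : ι) :
    τ (G c k * d c (d k (G a b * (ψ a * ψ b)))) =
      g c k * (ddg c k a b * τ (ψ a * ψ b) +
        dg k a b * τ (twist d (A - ψ) c (ψ a) * ψ b + ψ a * twist d (A - ψ) c (ψ b)) +
        dg c a b * τ (twist d (A - ψ) k (ψ a) * ψ b + ψ a * twist d (A - ψ) k (ψ b))) +
      g c k * g a b * (τ (twist d (A - ψ) k (ψ a) * twist d (A - ψ) c (ψ b)) +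
        τ (twist d (A - ψ) c (ψ a) * twist d (A - ψ) k (ψ b))) +
      g c k * g a b * (τ (twist d (A - ψ) c (twist d (A - ψ) k (ψ a)) * ψ b) +
        τ (twist d (A - ψ) c (twist d (A - ψ) k (ψ b)) * ψ a)) := by
  have hdG := fun c a b => deriv_central (h.leib c) (h.central a b)
  have hL := fun a x y => twist_mul (B := A - ψ) h.leib a x y
  rw [← trace_twist_twist (B := A - ψ) τ h.trace_comm h.leib (h.central c k), hL k,
    twist_central (h.central a b), twist_add, hL c (d k (G a b)), hL c (G a b),
    twist_central (h.central a b), twist_central (hdG k a b), hL k (ψ a), hL c (ψ a), twist_add,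
    hL c (twist d (A - ψ) k (ψ a)), hL c (ψ a), h.trace_G]
  simp only [map_add, h.trace_G, h.trace_dG, h.trace_ddG]
  rw [h.trace_comm (ψ a) (twist d (A - ψ) c (twist d (A - ψ) k (ψ b)))]
  ring

/-- Insert `dt_psi`. The commutator with `θ` contributes nothing, and the derivative of `θ` produces
`∇_a ∇_c ψ_k` together with a derivative of the metric coefficients. -/
theorem trace_dt_energy (h : FlowData d dt τ H Hi A ψ G g dg ddg) :
    τ (dt (∑ a, ∑ b, G a b * (ψ a * ψ b))) =
      2 * ∑ a, ∑ b, ∑ c, ∑ k, g a b * (dg a c k * τ (twist d (A - ψ) c (ψ k) * ψ b) +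
        g c k * τ (twist d (A - ψ) a (twist d (A - ψ) c (ψ k)) * ψ b)) := by
  set θ : R := -2 * ∑ c, ∑ k, G c k * twist d (A - ψ) c (ψ k) with hθ
  have htwo : ∀ x, τ (2 * x) = 2 * τ x := fun x => by rw [two_mul, map_add, two_mul]
  have h1 : ∀ a b, 2 * τ (dt (ψ a) * ψ b) =
      -τ (twist d (A - ψ) a θ * ψ b) + τ ((ψ a * θ - θ * ψ a) * ψ b) := fun a b => by
    rw [← htwo, ← mul_assoc, h.dt_psi a h.dt_H, add_mul, map_add, neg_mul, map_neg]
  have h2 : ∀ a b, τ (twist d (A - ψ) a θ * ψ b) = -(2 * ∑ c, ∑ k,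
      (dg a c k * τ (twist d (A - ψ) c (ψ k) * ψ b) +
        g c k * τ (twist d (A - ψ) a (twist d (A - ψ) c (ψ k)) * ψ b))) := fun a b => by
    have : θ = -((∑ c, ∑ k, G c k * twist d (A - ψ) c (ψ k)) +
      ∑ c, ∑ k, G c k * twist d (A - ψ) c (ψ k)) := by rw [hθ, neg_mul, two_mul]
    rw [this, twist_neg, twist_add, ← two_mul, neg_mul, map_neg, mul_assoc, htwo]
    simp only [twist_sum, twist_mul h.leib, twist_central (h.central _ _), Finset.sum_mul, map_sum,
      add_mul, map_add, mul_assoc, h.trace_G, h.trace_dG]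
  -- The trace equals that of `θ [ψ_b, ψ_a]`, which is antisymmetric in `a, b`, while `g` is
  -- symmetric.
  have h3 : ∑ a, ∑ b, g a b * τ ((ψ a * θ - θ * ψ a) * ψ b) = 0 := by
    have e : ∀ a b, τ ((ψ a * θ - θ * ψ a) * ψ b) = τ (θ * (ψ b * ψ a)) - τ (θ * (ψ a * ψ b)) := by
      intro a b
      rw [sub_mul, map_sub, h.trace_comm, ← mul_assoc, h.trace_comm (ψ b * ψ a), mul_assoc θ (ψ a)]
    simp only [e, mul_sub, Finset.sum_sub_distrib]
    rw [sub_eq_zero, Finset.sum_comm]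
    exact Finset.sum_congr rfl fun a _ => Finset.sum_congr rfl fun b _ => by rw [h.symm_g]
  have h4 : ∑ a, ∑ b, g a b * τ (ψ a * dt (ψ b)) = ∑ a, ∑ b, g a b * τ (dt (ψ a) * ψ b) := by
    rw [Finset.sum_comm]
    exact Finset.sum_congr rfl fun a _ => Finset.sum_congr rfl fun b _ => by
      rw [h.symm_g, h.trace_comm]
  have h5 : τ (dt (∑ a, ∑ b, G a b * (ψ a * ψ b))) =
      ∑ a, ∑ b, g a b * (2 * τ (dt (ψ a) * ψ b)) := by
    simp only [map_sum, h.leib_t, h.G_t, zero_mul, zero_add, h.trace_G, map_add, mul_add,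
      Finset.sum_add_distrib]
    rw [h4, ← two_mul, Finset.mul_sum]
    refine Finset.sum_congr rfl fun a _ => ?_
    rw [Finset.mul_sum]
    exact Finset.sum_congr rfl fun b _ => by ring
  rw [h5]
  simp only [h1, mul_add, Finset.sum_add_distrib, h3, h2, neg_neg]
  simp only [Finset.mul_sum]
  ring_nf

/-- The Bochner formula for the energy density `g^{ab} τ (ψ_a ψ_b)` along the heat flow. -/
theorem bochner (h : FlowData d dt τ H Hi A ψ G g dg ddg) :
    ∑ c, ∑ k, τ (G c k * d c (d k (∑ a, ∑ b, G a b * (ψ a * ψ b)))) -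
        τ (dt (∑ a, ∑ b, G a b * (ψ a * ψ b))) =
      ∑ c, ∑ k, ∑ a, ∑ b, (g c k * (ddg c k a b * τ (ψ a * ψ b) +
          dg k a b * τ (twist d (A - ψ) c (ψ a) * ψ b + ψ a * twist d (A - ψ) c (ψ b)) +
          dg c a b * τ (twist d (A - ψ) k (ψ a) * ψ b + ψ a * twist d (A - ψ) k (ψ b))) +
        g c k * g a b * (τ (twist d (A - ψ) k (ψ a) * twist d (A - ψ) c (ψ b)) +
          τ (twist d (A - ψ) c (ψ a) * twist d (A - ψ) k (ψ b))) +
        2 * (g c k * g a b * (τ (curvForm d A c a * (ψ k * ψ b - ψ b * ψ k)) -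
          τ ((ψ c * ψ a - ψ a * ψ c) * (ψ k * ψ b - ψ b * ψ k)) +
          τ ((twist d A c (curvForm d A k a) -
            (ψ c * curvForm d A k a - curvForm d A k a * ψ c)) * ψ b))) -
        2 * (g a b * (dg a c k * τ (twist d (A - ψ) c (ψ k) * ψ b)))) := by
  -- The two derivatives may both fall on either factor of `ψ_a ψ_b`; the two contributions agree
  -- after contraction with the symmetric `g a b`.
  have hswap : ∀ (X T : ι → ι → ℝ) (c k : ι),
      ∑ a, ∑ b, (X a b + g c k * g a b * (T a b + T b a)) =
        ∑ a, ∑ b, (X a b + 2 * (g c k * g a b * T a b)) := by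
    intro X T c k
    have e : ∑ a, ∑ b, g c k * g a b * T b a = ∑ a, ∑ b, g c k * g a b * T a b := by
      rw [Finset.sum_comm]
      exact Finset.sum_congr rfl fun a _ => Finset.sum_congr rfl fun b _ => by rw [h.symm_g a b]
    simp only [mul_add, Finset.sum_add_distrib, e, ← Finset.mul_sum]
    ring
  have hord : ∀ f : ι → ι → ι → ι → ℝ, ∑ a, ∑ b, ∑ c, ∑ k, f a b c k =
      ∑ c, ∑ k, ∑ a, ∑ b, f a b c k := by
    intro f
    have e1 : ∀ a, ∑ b, ∑ c, ∑ k, f a b c k = ∑ c, ∑ k, ∑ b, f a b c k := fun a => by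
      rw [Finset.sum_comm]
      exact Finset.sum_congr rfl fun c _ => Finset.sum_comm
    simp only [e1]
    rw [Finset.sum_comm]
    exact Finset.sum_congr rfl fun c _ => Finset.sum_comm
  rw [h.trace_dt_energy, hord, Finset.mul_sum, ← Finset.sum_sub_distrib]
  refine Finset.sum_congr rfl fun c _ => ?_
  rw [Finset.mul_sum, ← Finset.sum_sub_distrib]
  refine Finset.sum_congr rfl fun k _ => ?_
  simp only [map_sum, Finset.mul_sum, h.trace_hess_metric]
  rw [hswap _ (fun a b => τ (twist d (A - ψ) c (twist d (A - ψ) k (ψ a)) * ψ b)),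
    ← Finset.sum_sub_distrib]
  refine Finset.sum_congr rfl fun a _ => ?_
  rw [← Finset.sum_sub_distrib]
  refine Finset.sum_congr rfl fun b _ => ?_
  -- Commuting derivatives turns `∇_c ∇_k ψ_a` into `∇_a ∇_c ψ_k` plus curvature terms. The new
  -- leading term is the one supplied by `∂_t`, so all second derivatives of `ψ` cancel.
  rw [h.trace_hess_psi a b c k]
  ring

/-- The heat operator applied to the trace of `κ H`, for a time-independent `κ`. -/
theorem trace_mul_metric (h : FlowData d dt τ H Hi A ψ G g dg ddg) {κ : R} (hκ : dt κ = 0) :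
    ∑ c, ∑ k, τ (G c k * d c (d k (κ * H))) - τ (dt (κ * H)) =
      ∑ c, ∑ k, g c k * (τ (d c (d k κ) * H + d k κ * d c H + d c κ * d k H) +
        τ (κ * (star (d c (A k)) * H + star (A k) * d c H + d c H * A k + H * d c (A k) -
          2 * ((star (A c) * H + H * A c) * ψ k) + 2 * (H * (A c * ψ k - ψ k * A c)))) +
        4 * τ (κ * (H * (ψ c * ψ k)))) := by
  have htwo : ∀ x, τ (2 * x) = 2 * τ x := fun x => by rw [two_mul, map_add, two_mul]
  have hd2 : ∀ a, d a 2 = 0 := fun a => by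
    have : d a 1 = 0 := by simpa using h.leib a 1 1
    rw [← one_add_one_eq_two, map_add, this, add_zero]
  -- Two derivatives of `H` produce the good term `4 H ψ_c ψ_k` and the term `-2 H ∇_c ψ_k`, which
  -- the flow equation cancels. The last bracket is antisymmetric in `c, k` under the trace and
  -- drops out of the contraction.
  have h1 : ∀ c k, d c (d k (κ * H)) = (d c (d k κ) * H + d k κ * d c H + d c κ * d k H) +
      κ * (star (d c (A k)) * H + star (A k) * d c H + d c H * A k + H * d c (A k) -
          2 * ((star (A c) * H + H * A c) * ψ k) + 2 * (H * (A c * ψ k - ψ k * A c))) +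
      2 * (2 * (κ * (H * (ψ c * ψ k)))) - 2 * (κ * (H * twist d (A - ψ) c (ψ k))) -
      (2 * (κ * (H * (ψ c * ψ k))) - 2 * (κ * (H * (ψ k * ψ c)))) := by
    intro c k
    have e1 : d c (d k H) = star (d c (A k)) * H + star (A k) * d c H + d c H * A k +
        H * d c (A k) - 2 * (d c H * ψ k) - 2 * (H * d c (ψ k)) := by
      rw [h.d_H k]
      simp only [map_add, map_sub, h.leib, h.star_d, hd2]
      noncomm_ring
    have e2 : d c H * ψ k = (star (A c) * H + H * A c) * ψ k - 2 * (H * (ψ c * ψ k)) := by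
      rw [h.d_H c]
      noncomm_ring
    have e3 : d c (d k (κ * H)) = d c (d k κ) * H + d k κ * d c H + d c κ * d k H +
        κ * d c (d k H) := by
      simp only [h.leib, map_add]
      abel
    rw [e3, e1, e2]
    simp only [twist, Pi.sub_apply]
    noncomm_ring
  have h2 : τ (dt (κ * H)) = -∑ c, ∑ k, g c k * (2 * τ (κ * (H * twist d (A - ψ) c (ψ k)))) := by
    rw [h.leib_t, hκ, zero_mul, zero_add, h.dt_H]
    have e : κ * (H * (-2 * ∑ c, ∑ k, G c k * twist d (A - ψ) c (ψ k))) =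
        -(2 * ∑ c, ∑ k, G c k * (κ * (H * twist d (A - ψ) c (ψ k)))) := by
      simp only [Finset.mul_sum, neg_mul, mul_neg, Finset.sum_neg_distrib]
      congr 1
      refine Finset.sum_congr rfl fun c _ => Finset.sum_congr rfl fun k _ => ?_
      have := h.central c k
      calc κ * (H * (2 * (G c k * twist d (A - ψ) c (ψ k))))
          = 2 * (κ * H * G c k * twist d (A - ψ) c (ψ k)) := by noncomm_ring
        _ = _ := by rw [← this]; noncomm_ring
    rw [e, map_neg, htwo]
    simp only [map_sum, h.trace_G, Finset.mul_sum]
    congr 1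
    exact Finset.sum_congr rfl fun c _ => Finset.sum_congr rfl fun k _ => by ring
  have h3 : ∑ c, ∑ k, g c k * τ (κ * (H * (ψ k * ψ c))) =
      ∑ c, ∑ k, g c k * τ (κ * (H * (ψ c * ψ k))) := by
    rw [Finset.sum_comm]
    exact Finset.sum_congr rfl fun a _ => Finset.sum_congr rfl fun b _ => by rw [h.symm_g]
  have h4 : ∑ c, ∑ k, g c k * (2 * τ (κ * (H * (ψ c * ψ k))) -
      2 * τ (κ * (H * (ψ k * ψ c)))) = 0 := by
    have : ∀ c k, g c k * (2 * τ (κ * (H * (ψ c * ψ k))) - 2 * τ (κ * (H * (ψ k * ψ c)))) =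
      2 * (g c k * τ (κ * (H * (ψ c * ψ k)))) - 2 * (g c k * τ (κ * (H * (ψ k * ψ c)))) :=
      fun c k => by ring
    simp only [this, Finset.sum_sub_distrib, ← Finset.mul_sum, h3, sub_self]
  rw [h2, sub_neg_eq_add, ← sub_zero (∑ c, ∑ k, g c k * (_ + _ + _)), ← h4]
  simp only [← Finset.sum_add_distrib, ← Finset.sum_sub_distrib]
  refine Finset.sum_congr rfl fun c _ => Finset.sum_congr rfl fun k _ => ?_
  rw [h.trace_G, h1]
  generalize star (d c (A k)) * H + star (A k) * d c H + d c H * A k + H * d c (A k) -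
          2 * ((star (A c) * H + H * A c) * ψ k) + 2 * (H * (A c * ψ k - ψ k * A c)) = Y
  simp only [map_add, map_sub, htwo]
  ring

end FlowData

end SelfAdjoint

/-! ### Matrix estimates -/

section SquareRoot

open scoped MatrixOrder ComplexOrder

theorem Matrix.PosSemidef.exists_eq_conjTranspose_mul_self {𝕜 m : Type*} [RCLike 𝕜] [Fintype m]
    [DecidableEq m] {A : Matrix m m 𝕜} (hA : A.PosSemidef) :
    ∃ S : Matrix m m 𝕜, A = S.conjTranspose * S :=
  CStarAlgebra.nonneg_iff_eq_star_mul_self.mp hA.nonneg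

end SquareRoot

section FrobeniusStar

attribute [local instance] Matrix.frobeniusNormedRing

theorem normedStarGroup_matrix {r : ℕ} : NormedStarGroup (Matrix (Fin r) (Fin r) ℂ) :=
  Matrix.frobenius_normedStarGroup

end FrobeniusStar

/-! ### The Frobenius norm and the quadratic forms `tr (P X^* Q Y)`. -/

section MatrixEstimates

open scoped Matrix ComplexOrder

attribute [local instance] Matrix.frobeniusNormedRing Matrix.frobeniusNormedAlgebra
  normedStarGroup_matrix

variable {r : ℕ}

/-- The real part of the trace. -/
def reTr (X : Matrix (Fin r) (Fin r) ℂ) : ℝ := X.trace.re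

theorem reTr_add (X Y : Matrix (Fin r) (Fin r) ℂ) : reTr (X + Y) = reTr X + reTr Y := by
  simp [reTr]

theorem reTr_sub (X Y : Matrix (Fin r) (Fin r) ℂ) : reTr (X - Y) = reTr X - reTr Y := by
  simp [reTr]

theorem reTr_smul (c : ℝ) (X : Matrix (Fin r) (Fin r) ℂ) : reTr (c • X) = c * reTr X := by
  simp [reTr, Matrix.trace_smul]

theorem reTr_mul_comm (X Y : Matrix (Fin r) (Fin r) ℂ) : reTr (X * Y) = reTr (Y * X) := by
  rw [reTr, Matrix.trace_mul_comm, reTr]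

theorem reTr_star (X : Matrix (Fin r) (Fin r) ℂ) : reTr (star X) = reTr X := by
  simp [reTr, Matrix.star_eq_conjTranspose, Matrix.trace_conjTranspose]

theorem frobenius_sq (X : Matrix (Fin r) (Fin r) ℂ) : ‖X‖ ^ 2 = ∑ i, ∑ j, ‖X i j‖ ^ 2 := by
  rw [Matrix.frobenius_norm_def, ← Real.sqrt_eq_rpow, Real.sq_sqrt (by positivity)]
  simp

theorem reTr_star_mul (X : Matrix (Fin r) (Fin r) ℂ) : reTr (star X * X) = ‖X‖ ^ 2 := by
  rw [frobenius_sq, Finset.sum_comm]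
  simp [reTr, Matrix.trace, Matrix.mul_apply, Matrix.star_eq_conjTranspose, Complex.conj_mul']
  norm_cast

theorem abs_reTr_mul_le (X Y : Matrix (Fin r) (Fin r) ℂ) : |reTr (X * Y)| ≤ ‖X‖ * ‖Y‖ := by
  have h1 : |reTr (X * Y)| ≤ ∑ p : Fin r × Fin r, ‖X p.1 p.2‖ * ‖Y p.2 p.1‖ := by
    refine (Complex.abs_re_le_norm _).trans ?_
    simp only [Matrix.trace, Matrix.diag, Matrix.mul_apply]
    rw [Fintype.sum_prod_type]
    refine (norm_sum_le _ _).trans (Finset.sum_le_sum fun i _ => (norm_sum_le _ _).trans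
      (Finset.sum_le_sum fun j _ => (norm_mul_le _ _)))
  refine h1.trans ((Real.sum_mul_le_sqrt_mul_sqrt _ _ _).trans (le_of_eq ?_))
  have e1 : ∑ p : Fin r × Fin r, ‖X p.1 p.2‖ ^ 2 = ‖X‖ ^ 2 := by
    rw [Fintype.sum_prod_type, frobenius_sq]
  have e2 : ∑ p : Fin r × Fin r, ‖Y p.2 p.1‖ ^ 2 = ‖Y‖ ^ 2 := by
    rw [Fintype.sum_prod_type_right, frobenius_sq]
  rw [e1, e2, Real.sqrt_sq (norm_nonneg _), Real.sqrt_sq (norm_nonneg _)]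

theorem abs_reTr_mul_le' {X Y : Matrix (Fin r) (Fin r) ℂ} {a b : ℝ} (ha : ‖X‖ ≤ a) (hb : ‖Y‖ ≤ b) :
    |reTr (X * Y)| ≤ a * b :=
  (abs_reTr_mul_le X Y).trans
    (mul_le_mul ha hb (norm_nonneg _) ((norm_nonneg _).trans ha))

theorem norm_mul_le_of {X Y : Matrix (Fin r) (Fin r) ℂ} {a b : ℝ} (ha : ‖X‖ ≤ a) (hb : ‖Y‖ ≤ b) :
    ‖X * Y‖ ≤ a * b :=
  (norm_mul_le X Y).trans (mul_le_mul ha hb (norm_nonneg _) ((norm_nonneg _).trans ha))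

theorem norm_commutator_le {X Y : Matrix (Fin r) (Fin r) ℂ} {a b : ℝ} (ha : ‖X‖ ≤ a)
    (hb : ‖Y‖ ≤ b) : ‖X * Y - Y * X‖ ≤ 2 * (a * b) := by
  have h1 := norm_mul_le_of ha hb
  have h2 := norm_mul_le_of hb ha
  have h3 := norm_sub_le (X * Y) (Y * X)
  linarith

/-- The bilinear form `tr (P X^* Q Y)`. -/
def traceForm (P Q : Matrix (Fin r) (Fin r) ℂ) : LinearMap.BilinForm ℝ (Matrix (Fin r) (Fin r) ℂ) :=
  LinearMap.mk₂ ℝ (fun X Y => reTr (P * (star X * (Q * Y))))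
    (fun X X' Y => by rw [star_add, add_mul, mul_add, reTr_add])
    (fun c X Y => by
      rw [star_smul, smul_mul_assoc, mul_smul_comm, star_trivial, reTr_smul, smul_eq_mul])
    (fun X Y Y' => by simp only [mul_add, reTr_add])
    (fun c X Y => by simp only [mul_smul_comm, reTr_smul, smul_eq_mul])

theorem traceForm_apply (P Q X Y : Matrix (Fin r) (Fin r) ℂ) :
    traceForm P Q X Y = reTr (P * (star X * (Q * Y))) := rfl

/-- With `P = Sᴴ S`, cyclicity turns the value into the trace of the positive matrix `(X Sᴴ)ᴴ Q (X
Sᴴ)`. -/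
theorem traceForm_self_nonneg {P Q : Matrix (Fin r) (Fin r) ℂ} (hP : P.PosSemidef)
    (hQ : Q.PosSemidef) (X : Matrix (Fin r) (Fin r) ℂ) : 0 ≤ traceForm P Q X X := by
  obtain ⟨S, rfl⟩ := hP.exists_eq_conjTranspose_mul_self
  have h := (hQ.conjTranspose_mul_mul_same (X * Sᴴ)).trace_nonneg
  have e : reTr (Sᴴ * S * (star X * (Q * X))) = reTr ((X * Sᴴ)ᴴ * Q * (X * Sᴴ)) := by
    rw [mul_assoc, reTr_mul_comm]
    simp [Matrix.star_eq_conjTranspose, mul_assoc]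
  rw [traceForm_apply, e]
  exact (Complex.le_def.mp h).1

/-- Split `P = (P - m) + m` and `Q = (Q - m) + m` and expand: three of the four terms are
nonnegative. For `P = H⁻¹` and `Q = H` this compares the `H`-norm of endomorphisms with the
Frobenius norm. -/
theorem traceForm_self_ge {P Q : Matrix (Fin r) (Fin r) ℂ} {m : ℝ} (hm : 0 ≤ m)
    (hP : (P - m • 1).PosSemidef) (hQ : (Q - m • 1).PosSemidef) (X : Matrix (Fin r) (Fin r) ℂ) :
    m ^ 2 * ‖X‖ ^ 2 ≤ traceForm P Q X X := by
  have h1 := traceForm_self_nonneg hP hQ X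
  have h2 := traceForm_self_nonneg hP Matrix.PosSemidef.one X
  have h3 := traceForm_self_nonneg Matrix.PosSemidef.one hQ X
  have e : traceForm P Q X X = traceForm (P - m • 1) (Q - m • 1) X X +
      m * traceForm (P - m • 1) 1 X X + m * traceForm 1 (Q - m • 1) X X + m ^ 2 * ‖X‖ ^ 2 := by
    rw [← reTr_star_mul]
    simp only [traceForm_apply, sub_mul, mul_sub, reTr_sub, smul_mul_assoc, mul_smul_comm,
      reTr_smul, one_mul]
    ring
  rw [e]
  have := mul_nonneg hm h2
  have := mul_nonneg hm h3
  linarith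

end MatrixEstimates

/-! ### Contraction of a bilinear form with a positive matrix. -/

section Gram

variable {ι Y : Type*} [Fintype ι] [AddCommGroup Y] [Module ℝ Y]

/-- The form `∑ g^{ab} β (x_a, y_b)` on families. -/
def gramForm (g : Matrix ι ι ℝ) (β : LinearMap.BilinForm ℝ Y) : LinearMap.BilinForm ℝ (ι → Y) :=
  LinearMap.mk₂ ℝ (fun x y => ∑ a, ∑ b, g a b * β (x a) (y b))
    (fun x x' y => by simp [mul_add, Finset.sum_add_distrib])
    (fun c x y => by simp [Finset.mul_sum, mul_left_comm])
    (fun x y y' => by simp [mul_add, Finset.sum_add_distrib])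
    (fun c x y => by simp [Finset.mul_sum, mul_left_comm])

theorem gramForm_apply (g : Matrix ι ι ℝ) (β : LinearMap.BilinForm ℝ Y) (x y : ι → Y) :
    gramForm g β x y = ∑ a, ∑ b, g a b * β (x a) (y b) := rfl

/-- A factorization `g = Eᵀ E` turns the double sum into a sum of values of `β` on the diagonal. -/
theorem gramForm_self_nonneg {g : Matrix ι ι ℝ} (hg : g.PosSemidef) {β : LinearMap.BilinForm ℝ Y}
    (hβ : ∀ y, 0 ≤ β y y) (x : ι → Y) : 0 ≤ gramForm g β x x := by
  classical
  obtain ⟨E, rfl⟩ := hg.exists_eq_conjTranspose_mul_self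
  have e : gramForm (E.conjTranspose * E) β x x =
      ∑ k, β (∑ a, E k a • x a) (∑ b, E k b • x b) := by
    have e1 : ∀ k, β (∑ a, E k a • x a) (∑ b, E k b • x b) =
        ∑ a, ∑ b, E k a * E k b * β (x a) (x b) := fun k => by
      simp only [map_sum, LinearMap.sum_apply, map_smul, LinearMap.smul_apply, smul_eq_mul,
        Finset.mul_sum, mul_assoc]
      rw [Finset.sum_comm]
      exact Finset.sum_congr rfl fun a _ => Finset.sum_congr rfl fun b _ => by ring
    simp only [gramForm_apply, Matrix.mul_apply, Matrix.conjTranspose_apply, star_trivial,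
      Finset.sum_mul, e1]
    symm
    rw [Finset.sum_comm]
    exact Finset.sum_congr rfl fun a _ => Finset.sum_comm
  rw [e]
  exact Finset.sum_nonneg fun k _ => hβ _

theorem gramForm_self_ge [DecidableEq ι] {g : Matrix ι ι ℝ} {m : ℝ} (hg : (g - m • 1).PosSemidef)
    {β : LinearMap.BilinForm ℝ Y} (hβ : ∀ y, 0 ≤ β y y) (x : ι → Y) :
    m * ∑ a, β (x a) (x a) ≤ gramForm g β x x := by
  have h := gramForm_self_nonneg hg hβ x
  have e : gramForm (g - m • 1) β x x = gramForm g β x x - m * ∑ a, β (x a) (x a) := by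
    simp [gramForm_apply, sub_mul, Matrix.one_apply, Finset.sum_sub_distrib, Finset.mul_sum]
  rw [e] at h
  linarith

end Gram

/-! ### Pointwise lower bounds for the two heat-operator formulas. -/

section PointEstimates

open scoped Matrix ComplexOrder

attribute [local instance] Matrix.frobeniusNormedRing Matrix.frobeniusNormedAlgebra
  normedStarGroup_matrix

theorem pi_norm_sq_le_sum {ι E : Type*} [Fintype ι] [SeminormedAddCommGroup E] (x : ι → E) :
    ‖x‖ ^ 2 ≤ ∑ a, ‖x a‖ ^ 2 := by
  refine (Real.le_sqrt (norm_nonneg _) (by positivity)).mp ?_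
  refine (pi_norm_le_iff_of_nonneg (Real.sqrt_nonneg _)).mpr fun a => Real.le_sqrt_of_sq_le ?_
  exact Finset.single_le_sum (f := fun a => ‖x a‖ ^ 2) (fun _ _ => by positivity)
    (Finset.mem_univ a)

variable {ι : Type*} [Fintype ι] [DecidableEq ι] {r : ℕ}

variable {g : Matrix ι ι ℝ} {dg : ι → ι → ι → ℝ} {ddg : ι → ι → ι → ι → ℝ}
  {H Hi : Matrix (Fin r) (Fin r) ℂ} {ψ : ι → Matrix (Fin r) (Fin r) ℂ}
  {N F : ι → ι → Matrix (Fin r) (Fin r) ℂ} {DF : ι → ι → ι → Matrix (Fin r) (Fin r) ℂ}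
  {κ : Matrix (Fin r) (Fin r) ℂ} {dκ A dH : ι → Matrix (Fin r) (Fin r) ℂ}
  {ddκ dA : ι → ι → Matrix (Fin r) (Fin r) ℂ}

theorem IsSaFor.inv_mul_star_mul (hi : Hi * H = 1) {x : Matrix (Fin r) (Fin r) ℂ}
    (hx : IsSaFor H x) : Hi * (star x * H) = x := by
  rw [hx, ← mul_assoc, hi, one_mul]

/-- `traceForm Hi H` is the inner product on endomorphisms induced by `H`. The adjoint disappears on
self-adjoint elements, so traces of squares become squared norms. -/
theorem IsSaFor.traceForm_eq (hi : Hi * H = 1) {x : Matrix (Fin r) (Fin r) ℂ}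
    (hx : IsSaFor H x) (y : Matrix (Fin r) (Fin r) ℂ) : traceForm Hi H x y = reTr (x * y) := by
  rw [traceForm_apply, ← mul_assoc (star x), ← mul_assoc, hx.inv_mul_star_mul hi]

/-- For skew elements the sign flips: the trace of a square is minus a squared norm. -/
theorem IsSkewFor.traceForm_eq (hi : Hi * H = 1) {x : Matrix (Fin r) (Fin r) ℂ}
    (hx : IsSkewFor H x) (y : Matrix (Fin r) (Fin r) ℂ) : traceForm Hi H x y = -reTr (x * y) := by
  have e : Hi * (star x * H) = -x := by rw [hx, mul_neg, ← mul_assoc, hi, one_mul]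
  rw [traceForm_apply, ← mul_assoc (star x), ← mul_assoc, e, neg_mul, reTr, reTr,
    Matrix.trace_neg, Complex.neg_re]

/-- Coercivity of the gradient term of the Bochner formula: each of the two contractions with `g`,
and each of `H` and `Hi`, costs one power of `m`. -/
theorem gram_gram_ge {m : ℝ} (hm : 0 ≤ m) (hg : (g - m • 1).PosSemidef) (hi : Hi * H = 1)
    (hH : (H - m • 1).PosSemidef) (hHi : (Hi - m • 1).PosSemidef)
    (hN : ∀ c a, IsSaFor H (N c a)) :
    m ^ 4 * ‖N‖ ^ 2 ≤ ∑ c, ∑ k, ∑ a, ∑ b, g c k * g a b * reTr (N c a * N k b) := by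
  have h0 := traceForm_self_nonneg (hHi.add (Matrix.PosSemidef.one.smul hm))
    (hH.add (Matrix.PosSemidef.one.smul hm))
  simp only [sub_add_cancel] at h0
  have hg0 : g.PosSemidef := by simpa using hg.add (Matrix.PosSemidef.one.smul hm)
  have h1 := gramForm_self_ge hg (gramForm_self_nonneg hg0 h0) N
  have h2 : ∀ c, m * (m ^ 2 * ‖N c‖ ^ 2) ≤ gramForm g (traceForm Hi H) (N c) (N c) := fun c => by
    refine le_trans ?_ (gramForm_self_ge hg h0 (N c))
    refine mul_le_mul_of_nonneg_left ?_ hm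
    refine (mul_le_mul_of_nonneg_left (pi_norm_sq_le_sum (N c)) (by positivity)).trans ?_
    rw [Finset.mul_sum]
    exact Finset.sum_le_sum fun a _ => traceForm_self_ge hm hHi hH _
  have h3 : m * ∑ c, m * (m ^ 2 * ‖N c‖ ^ 2) ≤ gramForm g (gramForm g (traceForm Hi H)) N N :=
    (mul_le_mul_of_nonneg_left (Finset.sum_le_sum fun c _ => h2 c) hm).trans h1
  have h4 := mul_le_mul_of_nonneg_left (pi_norm_sq_le_sum N) (by positivity : 0 ≤ m ^ 4)
  have e : gramForm g (gramForm g (traceForm Hi H)) N N =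
      ∑ c, ∑ k, ∑ a, ∑ b, g c k * g a b * reTr (N c a * N k b) := by
    simp only [gramForm_apply, (hN _ _).traceForm_eq hi, Finset.mul_sum, mul_assoc]
  rw [← e]
  refine (h4.trans (le_of_eq ?_)).trans h3
  simp only [Finset.mul_sum]
  exact Finset.sum_congr rfl fun c _ => by ring

/-- The commutators `[ψ_c, ψ_a]` are skew, so contracting their traces gives minus a squared norm.
This makes the quartic term of the Bochner formula harmless, although it may grow like `|ψ|⁴`. -/
theorem gram_commutator_nonneg {m : ℝ} (hm : 0 ≤ m) (hg : (g - m • 1).PosSemidef)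
    (hi : Hi * H = 1) (hH : (H - m • 1).PosSemidef) (hHi : (Hi - m • 1).PosSemidef)
    (hψ : ∀ a, IsSaFor H (ψ a)) :
    ∑ c, ∑ k, ∑ a, ∑ b, g c k * g a b *
      reTr ((ψ c * ψ a - ψ a * ψ c) * (ψ k * ψ b - ψ b * ψ k)) ≤ 0 := by
  have h0 := traceForm_self_nonneg (hHi.add (Matrix.PosSemidef.one.smul hm))
    (hH.add (Matrix.PosSemidef.one.smul hm))
  simp only [sub_add_cancel] at h0
  have hg0 : g.PosSemidef := by simpa using hg.add (Matrix.PosSemidef.one.smul hm)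
  have h1 := gramForm_self_nonneg hg0 (gramForm_self_nonneg hg0 h0)
    (fun c a => ψ c * ψ a - ψ a * ψ c)
  simp only [gramForm_apply, ((hψ _).commutator (hψ _)).traceForm_eq hi, Finset.mul_sum, mul_neg,
    Finset.sum_neg_distrib, ← mul_assoc] at h1
  linarith

/-- The right side of the Bochner formula is bounded below. -/
theorem exists_bochner_bound (ι : Type*) [Fintype ι] [DecidableEq ι] (r : ℕ) {m Λ : ℝ} (hm : 0 < m)
    (hΛ : 0 ≤ Λ) : ∃ C : ℝ, 0 ≤ C ∧ ∀ (g : Matrix ι ι ℝ) (dg : ι → ι → ι → ℝ)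
      (ddg : ι → ι → ι → ι → ℝ) (H Hi : Matrix (Fin r) (Fin r) ℂ)
      (ψ : ι → Matrix (Fin r) (Fin r) ℂ) (N F : ι → ι → Matrix (Fin r) (Fin r) ℂ)
      (DF : ι → ι → ι → Matrix (Fin r) (Fin r) ℂ),
      (g - m • 1).PosSemidef → (∀ a b, |g a b| ≤ Λ) → (∀ c a b, |dg c a b| ≤ Λ) →
      (∀ c k a b, |ddg c k a b| ≤ Λ) → Hi * H = 1 → (H - m • 1).PosSemidef →
      (Hi - m • 1).PosSemidef → (∀ a, IsSaFor H (ψ a)) → (∀ c a, IsSaFor H (N c a)) →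
      (∀ c a, ‖F c a‖ ≤ Λ) → (∀ c k a, ‖DF c k a‖ ≤ Λ) →
      -(C * (1 + ‖ψ‖ ^ 2)) ≤ ∑ c, ∑ k, ∑ a, ∑ b, (g c k * (ddg c k a b * reTr (ψ a * ψ b) +
          dg k a b * reTr (N c a * ψ b + ψ a * N c b) +
          dg c a b * reTr (N k a * ψ b + ψ a * N k b)) +
        g c k * g a b * (reTr (N k a * N c b) + reTr (N c a * N k b)) +
        2 * (g c k * g a b * (reTr (F c a * (ψ k * ψ b - ψ b * ψ k)) -
          reTr ((ψ c * ψ a - ψ a * ψ c) * (ψ k * ψ b - ψ b * ψ k)) +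
          reTr ((DF c k a - (ψ c * F k a - F k a * ψ c)) * ψ b))) -
        2 * (g a b * (dg a c k * reTr (N c k * ψ b)))) := by
  set n : ℝ := (Fintype.card ι : ℝ) with hn
  have hn0 : 0 ≤ n := Nat.cast_nonneg _
  -- `n ^ 4` counts the index quadruples, and `6 * Λ ^ 2` is the coefficient of `|N| |ψ|` in the
  -- bound for one summand. The constant `s` takes the terms without `N`, the linear one by `2 y ≤ 1
  -- + y ^ 2`.
  set q : ℝ := n ^ 4 * (6 * Λ ^ 2) with hq
  set s : ℝ := n ^ 4 * (Λ ^ 2 + 10 * Λ ^ 3) with hs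
  have hs0 : 0 ≤ s := by positivity
  refine ⟨q ^ 2 / (8 * m ^ 4) + s, by positivity, ?_⟩
  intro g dg ddg H Hi ψ N F DF hg hgΛ hdg hddg hi hH hHi hψ hN hF hDF
  set y := ‖ψ‖ with hy
  set z := ‖N‖ with hz
  have hy0 : 0 ≤ y := norm_nonneg _
  have hz0 : 0 ≤ z := norm_nonneg _
  have hψy : ∀ a, ‖ψ a‖ ≤ y := fun a => norm_le_pi_norm ψ a
  have hNz : ∀ c a, ‖N c a‖ ≤ z := fun c a => (norm_le_pi_norm (N c) a).trans (norm_le_pi_norm N c)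
  have hm4 := gram_gram_ge hm.le hg hi hH hHi hN
  have hcom := gram_commutator_nonneg hm.le hg hi hH hHi hψ
  have hsymm : ∀ c k, g c k = g k c := fun c k => by
    have := hg.isHermitian.apply c k
    simp only [Matrix.sub_apply, Matrix.smul_apply, Matrix.one_apply, star_trivial] at this
    rcases eq_or_ne c k with h | h
    · rw [h]
    · simpa [h, h.symm] using this.symm
  have hm4' : m ^ 4 * z ^ 2 ≤ ∑ c, ∑ k, ∑ a, ∑ b, g c k * g a b * reTr (N k a * N c b) := by
    rw [Finset.sum_comm]
    simpa only [hsymm] using hm4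
  -- Everything except the two gradient squares and the commutator square, whose signs are known.
  set rest : ι → ι → ι → ι → ℝ := fun c k a b => g c k * (ddg c k a b * reTr (ψ a * ψ b) +
          dg k a b * reTr (N c a * ψ b + ψ a * N c b) +
          dg c a b * reTr (N k a * ψ b + ψ a * N k b)) +
        2 * (g c k * g a b * (reTr (F c a * (ψ k * ψ b - ψ b * ψ k)) +
          reTr ((DF c k a - (ψ c * F k a - F k a * ψ c)) * ψ b))) -
        2 * (g a b * (dg a c k * reTr (N c k * ψ b))) with hrest
  have hmul : ∀ {x x' a a' : ℝ}, |x| ≤ a → |x'| ≤ a' → |x * x'| ≤ a * a' := fun h h' => by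
    rw [abs_mul]
    exact mul_le_mul h h' (abs_nonneg _) ((abs_nonneg _).trans h)
  have hadd : ∀ {x x' a a' : ℝ}, |x| ≤ a → |x'| ≤ a' → |x + x'| ≤ a + a' := fun h h' =>
    (abs_add_le _ _).trans (add_le_add h h')
  have hsub : ∀ {x x' a a' : ℝ}, |x| ≤ a → |x'| ≤ a' → |x - x'| ≤ a + a' := fun h h' =>
    (abs_sub _ _).trans (add_le_add h h')
  have h2 : |(2 : ℝ)| ≤ 2 := by norm_num
  have hNψ : ∀ c a b, |reTr (N c a * ψ b + ψ a * N c b)| ≤ z * y + y * z := fun c a b => by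
    rw [reTr_add]
    exact hadd (abs_reTr_mul_le' (hNz _ _) (hψy _)) (abs_reTr_mul_le' (hψy _) (hNz _ _))
  have hbound : ∀ c k a b, |rest c k a b| ≤
      Λ * (Λ * (y * y) + Λ * (z * y + y * z) + Λ * (z * y + y * z)) +
      2 * (Λ * Λ * (Λ * (2 * (y * y)) + (Λ + 2 * (y * Λ)) * y)) + 2 * (Λ * (Λ * (z * y))) := by
    intro c k a b
    refine hsub (hadd (hmul (hgΛ _ _) (hadd (hadd (hmul (hddg _ _ _ _)
      (abs_reTr_mul_le' (hψy _) (hψy _))) (hmul (hdg _ _ _) (hNψ _ _ _)))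
      (hmul (hdg _ _ _) (hNψ _ _ _)))) (hmul h2 (hmul (hmul (hgΛ _ _) (hgΛ _ _)) (hadd
      (abs_reTr_mul_le' (hF _ _) (norm_commutator_le (hψy _) (hψy _))) (abs_reTr_mul_le'
      ((norm_sub_le _ _).trans (add_le_add (hDF _ _ _) (norm_commutator_le (hψy _) (hF _ _))))
      (hψy _)))))) (hmul h2 (hmul (hgΛ _ _) (hmul (hdg _ _ _) (abs_reTr_mul_le' (hNz _ _) (hψy _)))))
  set bd : ℝ := Λ * (Λ * (y * y) + Λ * (z * y + y * z) + Λ * (z * y + y * z)) +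
      2 * (Λ * Λ * (Λ * (2 * (y * y)) + (Λ + 2 * (y * Λ)) * y)) + 2 * (Λ * (Λ * (z * y))) with hbd
  have hsum : -(n ^ 4 * bd) ≤ ∑ c, ∑ k, ∑ a, ∑ b, rest c k a b := by
    have e : -(n ^ 4 * bd) = ∑ _c : ι, ∑ _k : ι, ∑ _a : ι, ∑ _b : ι, -bd := by
      simp only [Finset.sum_const, Finset.card_univ, nsmul_eq_mul, ← hn]
      ring
    rw [e]
    exact Finset.sum_le_sum fun c _ => Finset.sum_le_sum fun k _ => Finset.sum_le_sum fun a _ =>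
      Finset.sum_le_sum fun b _ => (abs_le.mp (hbound c k a b)).1
  have hsplit : (∑ c, ∑ k, ∑ a, ∑ b, (g c k * (ddg c k a b * reTr (ψ a * ψ b) +
          dg k a b * reTr (N c a * ψ b + ψ a * N c b) +
          dg c a b * reTr (N k a * ψ b + ψ a * N k b)) +
        g c k * g a b * (reTr (N k a * N c b) + reTr (N c a * N k b)) +
        2 * (g c k * g a b * (reTr (F c a * (ψ k * ψ b - ψ b * ψ k)) -
          reTr ((ψ c * ψ a - ψ a * ψ c) * (ψ k * ψ b - ψ b * ψ k)) +
          reTr ((DF c k a - (ψ c * F k a - F k a * ψ c)) * ψ b))) -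
        2 * (g a b * (dg a c k * reTr (N c k * ψ b))))) =
      (∑ c, ∑ k, ∑ a, ∑ b, rest c k a b) +
      (∑ c, ∑ k, ∑ a, ∑ b, g c k * g a b * reTr (N k a * N c b)) +
      (∑ c, ∑ k, ∑ a, ∑ b, g c k * g a b * reTr (N c a * N k b)) -
      2 * ∑ c, ∑ k, ∑ a, ∑ b, g c k * g a b *
        reTr ((ψ c * ψ a - ψ a * ψ c) * (ψ k * ψ b - ψ b * ψ k)) := by
    simp only [Finset.mul_sum, ← Finset.sum_add_distrib, ← Finset.sum_sub_distrib]
    refine Finset.sum_congr rfl fun c _ => Finset.sum_congr rfl fun k _ =>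
      Finset.sum_congr rfl fun a _ => Finset.sum_congr rfl fun b _ => ?_
    simp only [hrest]
    ring
  rw [hsplit]
  -- Young's inequality: the two gradient terms together supply `2 m ^ 4 z ^ 2`, which absorbs the
  -- mixed term.
  have hyoung : q * (z * y) ≤ 2 * m ^ 4 * z ^ 2 + q ^ 2 / (8 * m ^ 4) * y ^ 2 := by
    have e : 2 * m ^ 4 * z ^ 2 + q ^ 2 / (8 * m ^ 4) * y ^ 2 - q * (z * y) =
        (4 * m ^ 4 * z - q * y) ^ 2 / (8 * m ^ 4) := by
      field_simp
      ring
    have : 0 ≤ (4 * m ^ 4 * z - q * y) ^ 2 / (8 * m ^ 4) := by positivity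
    linarith
  have hlin : n ^ 4 * bd ≤ q * (z * y) + s * (1 + y ^ 2) := by
    have e : q * (z * y) + s * (1 + y ^ 2) - n ^ 4 * bd =
        n ^ 4 * (Λ ^ 2 + Λ ^ 3 * (9 + (1 - y) ^ 2 + y ^ 2)) := by
      rw [hbd, hq, hs]
      ring
    have : 0 ≤ n ^ 4 * (Λ ^ 2 + Λ ^ 3 * (9 + (1 - y) ^ 2 + y ^ 2)) := by positivity
    linarith
  have hq8 : 0 ≤ q ^ 2 / (8 * m ^ 4) := by positivity
  generalize q ^ 2 / (8 * m ^ 4) = Q at *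
  linarith

/-- The heat operator applied to the trace of `κ H` is bounded below by a multiple of `|ψ|^2`. -/
theorem exists_trace_bound (ι : Type*) [Fintype ι] [DecidableEq ι] (r : ℕ) {m Λ : ℝ} (hm : 0 < m)
    (hΛ : 0 ≤ Λ) : ∃ C : ℝ, 0 ≤ C ∧ ∀ (g : Matrix ι ι ℝ) (H κ : Matrix (Fin r) (Fin r) ℂ)
      (ψ A dκ dH : ι → Matrix (Fin r) (Fin r) ℂ) (dA ddκ : ι → ι → Matrix (Fin r) (Fin r) ℂ),
      (g - m • 1).PosSemidef → (∀ a b, |g a b| ≤ Λ) → ‖H‖ ≤ Λ → ‖κ‖ ≤ Λ →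
      (H - m • 1).PosSemidef → (κ - m • 1).PosSemidef → (∀ a, IsSaFor H (ψ a)) →
      (∀ a, ‖A a‖ ≤ Λ) → (∀ c a, ‖dA c a‖ ≤ Λ) → (∀ a, ‖dκ a‖ ≤ Λ) → (∀ c a, ‖ddκ c a‖ ≤ Λ) →
      (∀ a, dH a = star (A a) * H + H * A a - 2 * (H * ψ a)) →
      2 * m ^ 3 * ‖ψ‖ ^ 2 - C ≤
        ∑ c, ∑ k, g c k * (reTr (ddκ c k * H + dκ k * dH c + dκ c * dH k) +
        reTr (κ * (star (dA c k) * H + star (A k) * dH c + dH c * A k + H * dA c k -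
          2 * ((star (A c) * H + H * A c) * ψ k) + 2 * (H * (A c * ψ k - ψ k * A c)))) +
        4 * reTr (κ * (H * (ψ c * ψ k)))) := by
  set n : ℝ := (Fintype.card ι : ℝ) with hn
  have hn0 : 0 ≤ n := Nat.cast_nonneg _
  -- `B₀` and `B₁` are the constant and the linear coefficient in `y` of the bound on the
  -- lower-order terms, summed over the `n ^ 2` index pairs.
  set B₀ : ℝ := n ^ 2 * (Λ * (Λ ^ 2 + 4 * Λ ^ 3 + Λ * (2 * Λ ^ 2 + 4 * Λ ^ 3))) with hB₀
  set B₁ : ℝ := n ^ 2 * (Λ * (4 * Λ ^ 2 + Λ * (12 * Λ ^ 2))) with hB₁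
  refine ⟨B₀ + B₁ ^ 2 / (8 * m ^ 3), by positivity, ?_⟩
  intro g H κ ψ A dκ dH dA ddκ hg hgΛ hHΛ hκΛ hH hκ hψ hA hdA hdκ hddκ hdH
  set y := ‖ψ‖ with hy
  have hy0 : 0 ≤ y := norm_nonneg _
  have hψy : ∀ a, ‖ψ a‖ ≤ y := fun a => norm_le_pi_norm ψ a
  have htwo : ∀ {X : Matrix (Fin r) (Fin r) ℂ} {a : ℝ}, ‖X‖ ≤ a → ‖2 * X‖ ≤ 2 * a := fun {X a} h => by
    rw [two_mul, two_mul]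
    exact (norm_add_le _ _).trans (add_le_add h h)
  have hadd : ∀ {x x' : Matrix (Fin r) (Fin r) ℂ} {a a' : ℝ}, ‖x‖ ≤ a → ‖x'‖ ≤ a' →
    ‖x + x'‖ ≤ a + a' := fun h h' => (norm_add_le _ _).trans (add_le_add h h')
  have hsub : ∀ {x x' : Matrix (Fin r) (Fin r) ℂ} {a a' : ℝ}, ‖x‖ ≤ a → ‖x'‖ ≤ a' →
    ‖x - x'‖ ≤ a + a' := fun h h' => (norm_sub_le _ _).trans (add_le_add h h')
  have hst : ∀ {x : Matrix (Fin r) (Fin r) ℂ} {a : ℝ}, ‖x‖ ≤ a → ‖star x‖ ≤ a := fun h => by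
    rwa [norm_star]
  have hdHy : ∀ a, ‖dH a‖ ≤ Λ * Λ + Λ * Λ + 2 * (Λ * y) := fun a => by
    rw [hdH]
    exact hsub (hadd (norm_mul_le_of (hst (hA a)) hHΛ) (norm_mul_le_of hHΛ (hA a)))
      (htwo (norm_mul_le_of hHΛ (hψy a)))
  set h : ℝ := Λ * Λ + Λ * Λ + 2 * (Λ * y) with hh
  set bd : ℝ := Λ * ((Λ * Λ + Λ * h + Λ * h) + Λ * (Λ * Λ + Λ * h + h * Λ + Λ * Λ +
      2 * ((Λ * Λ + Λ * Λ) * y) + 2 * (Λ * (2 * (Λ * y))))) with hbd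
  have hrest : ∀ c k, |g c k * (reTr (ddκ c k * H + dκ k * dH c + dκ c * dH k) +
        reTr (κ * (star (dA c k) * H + star (A k) * dH c + dH c * A k + H * dA c k -
          2 * ((star (A c) * H + H * A c) * ψ k) + 2 * (H * (A c * ψ k - ψ k * A c)))))| ≤ bd := by
    intro c k
    rw [abs_mul]
    refine mul_le_mul (hgΛ _ _) ((abs_add_le _ _).trans (add_le_add ?_ ?_)) (abs_nonneg _) hΛ
    · rw [reTr_add, reTr_add]
      exact (abs_add_le _ _).trans (add_le_add ((abs_add_le _ _).trans (add_le_add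
        (abs_reTr_mul_le' (hddκ _ _) hHΛ) (abs_reTr_mul_le' (hdκ _) (hdHy _))))
        (abs_reTr_mul_le' (hdκ _) (hdHy _)))
    · exact abs_reTr_mul_le' hκΛ (hadd (hsub (hadd (hadd (hadd
        (norm_mul_le_of (hst (hdA _ _)) hHΛ) (norm_mul_le_of (hst (hA _)) (hdHy _)))
        (norm_mul_le_of (hdHy _) (hA _))) (norm_mul_le_of hHΛ (hdA _ _)))
        (htwo (norm_mul_le_of (hadd (norm_mul_le_of (hst (hA _)) hHΛ) (norm_mul_le_of hHΛ (hA _)))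
          (hψy _)))) (htwo (norm_mul_le_of hHΛ (norm_commutator_le (hA _) (hψy _)))))
  have hmain : m ^ 3 * y ^ 2 ≤ ∑ c, ∑ k, g c k * reTr (κ * (H * (ψ c * ψ k))) := by
    have h0 := traceForm_self_nonneg (hκ.add (Matrix.PosSemidef.one.smul hm.le))
      (hH.add (Matrix.PosSemidef.one.smul hm.le))
    simp only [sub_add_cancel] at h0
    have h1 := gramForm_self_ge hg h0 ψ
    have e : gramForm g (traceForm κ H) ψ ψ =
        ∑ c, ∑ k, g c k * reTr (κ * (H * (ψ c * ψ k))) := by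
      simp only [gramForm_apply, traceForm_apply]
      refine Finset.sum_congr rfl fun c _ => Finset.sum_congr rfl fun k _ => ?_
      have := hψ c
      rw [IsSaFor] at this
      rw [← mul_assoc (star (ψ c)), this, mul_assoc]
    rw [← e]
    refine le_trans ?_ h1
    have h2 := mul_le_mul_of_nonneg_left (pi_norm_sq_le_sum ψ) (by positivity : 0 ≤ m ^ 3)
    refine h2.trans ?_
    rw [pow_succ' m 2, mul_assoc, Finset.mul_sum]
    exact mul_le_mul_of_nonneg_left
      (Finset.sum_le_sum fun a _ => traceForm_self_ge hm.le hκ hH _) hm.le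
  have hsum : -(n ^ 2 * bd) ≤ ∑ c, ∑ k, g c k * (reTr (ddκ c k * H + dκ k * dH c + dκ c * dH k) +
        reTr (κ * (star (dA c k) * H + star (A k) * dH c + dH c * A k + H * dA c k -
          2 * ((star (A c) * H + H * A c) * ψ k) + 2 * (H * (A c * ψ k - ψ k * A c))))) := by
    have e : -(n ^ 2 * bd) = ∑ _c : ι, ∑ _k : ι, -bd := by
      simp only [Finset.sum_const, Finset.card_univ, nsmul_eq_mul, ← hn]
      ring
    rw [e]
    exact Finset.sum_le_sum fun c _ => Finset.sum_le_sum fun k _ => (abs_le.mp (hrest c k)).1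
  have hbd' : n ^ 2 * bd = B₀ + B₁ * y := by
    rw [hbd, hB₀, hB₁, hh]
    ring
  -- The good term is at least `4 m ^ 3 y ^ 2`; half of it absorbs the linear term.
  have hyoung : B₁ * y ≤ 2 * m ^ 3 * y ^ 2 + B₁ ^ 2 / (8 * m ^ 3) := by
    have e : 2 * m ^ 3 * y ^ 2 + B₁ ^ 2 / (8 * m ^ 3) - B₁ * y =
        (4 * m ^ 3 * y - B₁) ^ 2 / (8 * m ^ 3) := by
      field_simp
      ring
    have : 0 ≤ (4 * m ^ 3 * y - B₁) ^ 2 / (8 * m ^ 3) := by positivity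
    linarith
  have hsplit : ∀ R S : ι → ι → ℝ, ∑ c, ∑ k, g c k * (R c k + 4 * S c k) =
      ∑ c, ∑ k, g c k * R c k + 4 * ∑ c, ∑ k, g c k * S c k := fun R S => by
    simp only [Finset.mul_sum, ← Finset.sum_add_distrib]
    exact Finset.sum_congr rfl fun c _ => Finset.sum_congr rfl fun k _ => by ring
  rw [hsplit]
  linarith

end PointEstimates

/-! ### The ring of smooth functions on an open set -/

section SmoothRing

variable {E M : Type*} [NormedAddCommGroup E] [NormedSpace ℝ E] [NormedRing M] [NormedAlgebra ℝ M]
  [StarRing M] [NormedStarGroup M] [StarModule ℝ M]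

/-- Extension by zero of a function defined on a subset. -/
def extendZero {F : Type*} [Zero F] (W : Set E) (f : W → F) (p : E) : F :=
  open Classical in if h : p ∈ W then f ⟨p, h⟩ else 0

theorem extendZero_apply {F : Type*} [Zero F] {W : Set E} (f : W → F) {p : E} (h : p ∈ W) :
    extendZero W f p = f ⟨p, h⟩ := by
  simp [extendZero, h]

theorem extendZero_eqOn {F : Type*} [Zero F] {W : Set E} (f : E → F) :
    Set.EqOn (extendZero W (fun p => f p)) f W := fun _ hp => extendZero_apply _ hp

/-- The algebra of smooth functions on `W`. -/
def smoothAlg (M : Type*) [NormedRing M] [NormedAlgebra ℝ M]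
    [StarRing M] [NormedStarGroup M] [StarModule ℝ M] (W : Set E) : StarSubalgebra ℝ (W → M) where
  carrier := {f | ContDiffOn ℝ ∞ (extendZero W f) W}
  mul_mem' {f g} hf hg := by
    refine (hf.mul hg).congr fun p hp => ?_
    simp [extendZero_apply _ hp]
  add_mem' {f g} hf hg := by
    refine (hf.add hg).congr fun p hp => ?_
    simp [extendZero_apply _ hp]
  algebraMap_mem' c := by
    refine (contDiffOn_const (c := algebraMap ℝ M c)).congr fun p hp => ?_
    simp [extendZero_apply _ hp]
  star_mem' {f} hf := by
    refine (((starL' ℝ : M ≃L[ℝ] M).contDiff).comp_contDiffOn hf).congr fun p hp => ?_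
    simp [extendZero_apply _ hp]

variable {W : Set E}

/-- The element of `smoothAlg` given by a smooth function. -/
def smoothAlg.mk (f : E → M) (hf : ContDiffOn ℝ ∞ f W) : smoothAlg M W :=
  ⟨fun p => f p, hf.congr (extendZero_eqOn f)⟩

theorem contDiffOn_smoothAlg (f : smoothAlg M W) : ContDiffOn ℝ ∞ (extendZero W f.1) W := f.2

theorem differentiableAt_smoothAlg (hW : IsOpen W) (f : smoothAlg M W) {p : E} (hp : p ∈ W) :
    DifferentiableAt ℝ (extendZero W f.1) p :=
  ((contDiffOn_smoothAlg f).contDiffAt (hW.mem_nhds hp)).differentiableAt (by simp)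

theorem contDiffOn_fderiv_apply {F : Type*} [NormedAddCommGroup F] [NormedSpace ℝ F]
    (hW : IsOpen W) {f : E → F} (hf : ContDiffOn ℝ ∞ f W) (v : E) :
    ContDiffOn ℝ ∞ (fun p => fderiv ℝ f p v) W :=
  (hf.fderiv_of_isOpen hW (by simp)).clm_apply contDiffOn_const

/-- Differentiation in the direction `v`. -/
def smoothAlg.deriv (hW : IsOpen W) (v : E) : smoothAlg M W →+ smoothAlg M W where
  toFun f := smoothAlg.mk (fun p => fderiv ℝ (extendZero W f.1) p v)
    (contDiffOn_fderiv_apply hW (contDiffOn_smoothAlg f) v)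
  map_zero' := by
    refine Subtype.ext (funext fun p => ?_)
    have h : extendZero W (0 : smoothAlg M W).1 =ᶠ[𝓝 p.1] fun _ => (0 : M) :=
      Filter.eventuallyEq_of_mem (hW.mem_nhds p.2) fun q hq => by simp [extendZero_apply _ hq]
    change fderiv ℝ (extendZero W (0 : smoothAlg M W).1) p v = 0
    rw [h.fderiv_eq]
    simp
  map_add' f g := by
    refine Subtype.ext (funext fun p => ?_)
    have h : extendZero W (f + g).1 =ᶠ[𝓝 p.1] extendZero W f.1 + extendZero W g.1 :=
      Filter.eventuallyEq_of_mem (hW.mem_nhds p.2) fun q hq => by simp [extendZero_apply _ hq]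
    change fderiv ℝ (extendZero W (f + g).1) p v =
      fderiv ℝ (extendZero W f.1) p v + fderiv ℝ (extendZero W g.1) p v
    rw [h.fderiv_eq, fderiv_add (differentiableAt_smoothAlg hW f p.2)
      (differentiableAt_smoothAlg hW g p.2), add_apply]

theorem smoothAlg.mk_apply (f : E → M) (hf : ContDiffOn ℝ ∞ f W) (p : W) :
    (smoothAlg.mk f hf).1 p = f p := rfl

theorem smoothAlg.deriv_apply (hW : IsOpen W) (v : E) (f : smoothAlg M W) (p : W) :
    (smoothAlg.deriv hW v f).1 p = fderiv ℝ (extendZero W f.1) p v := rfl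

theorem smoothAlg.deriv_mk (hW : IsOpen W) (v : E) (f : E → M) (hf : ContDiffOn ℝ ∞ f W) :
    smoothAlg.deriv hW v (smoothAlg.mk f hf) =
      smoothAlg.mk (fun p => fderiv ℝ f p v) (contDiffOn_fderiv_apply hW hf v) := by
  refine Subtype.ext (funext fun p => ?_)
  have h : extendZero W (smoothAlg.mk f hf).1 =ᶠ[𝓝 p.1] f :=
    Filter.eventuallyEq_of_mem (hW.mem_nhds p.2) (extendZero_eqOn f)
  rw [smoothAlg.deriv_apply, h.fderiv_eq, smoothAlg.mk_apply]

theorem smoothAlg.exists_mk (f : smoothAlg M W) : ∃ F hF, f = smoothAlg.mk F hF :=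
  ⟨extendZero W f.1, f.2, Subtype.ext (funext fun p => (extendZero_apply _ p.2).symm)⟩

theorem smoothAlg.deriv_mul (hW : IsOpen W) (v : E) (f g : smoothAlg M W) :
    smoothAlg.deriv hW v (f * g) = smoothAlg.deriv hW v f * g + f * smoothAlg.deriv hW v g := by
  refine Subtype.ext (funext fun p => ?_)
  have h : extendZero W (f * g).1 =ᶠ[𝓝 p.1] extendZero W f.1 * extendZero W g.1 :=
    Filter.eventuallyEq_of_mem (hW.mem_nhds p.2) fun q hq => by simp [extendZero_apply _ hq]
  have e := fderiv_mul' (differentiableAt_smoothAlg hW f p.2) (differentiableAt_smoothAlg hW g p.2)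
  rw [smoothAlg.deriv_apply, h.fderiv_eq, e]
  simp only [add_apply, smul_apply, smul_eq_mul]
  simp [smoothAlg.deriv_apply, extendZero_apply _ p.2, add_comm]

theorem smoothAlg.deriv_star (hW : IsOpen W) (v : E) (f : smoothAlg M W) :
    smoothAlg.deriv hW v (star f) = star (smoothAlg.deriv hW v f) := by
  refine Subtype.ext (funext fun p => ?_)
  have h : extendZero W (star f).1 =ᶠ[𝓝 p.1] fun q => star (extendZero W f.1 q) :=
    Filter.eventuallyEq_of_mem (hW.mem_nhds p.2) fun q hq => by simp [extendZero_apply _ hq]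
  rw [smoothAlg.deriv_apply, h.fderiv_eq, fderiv_star]
  simp [smoothAlg.deriv_apply]

/-- Symmetry of the second derivative. On space-time it supplies both commutation axioms of
`FlowData`. -/
theorem smoothAlg.deriv_comm (hW : IsOpen W) (v w : E) (f : smoothAlg M W) :
    smoothAlg.deriv hW v (smoothAlg.deriv hW w f) =
      smoothAlg.deriv hW w (smoothAlg.deriv hW v f) := by
  refine Subtype.ext (funext fun p => ?_)
  obtain ⟨F, hF, rfl⟩ := smoothAlg.exists_mk f
  simp only [smoothAlg.deriv_mk, smoothAlg.mk_apply]
  have hf : ContDiffAt ℝ ∞ F p := hF.contDiffAt (hW.mem_nhds p.2)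
  have hd : DifferentiableAt ℝ (fderiv ℝ F) p :=
    (hf.fderiv_right (m := 1) (by norm_cast)).differentiableAt (by simp)
  have hs : IsSymmSndFDerivAt ℝ F p.1 := hf.isSymmSndFDerivAt (by
    rw [minSmoothness_of_isRCLikeNormedField]
    exact WithTop.coe_le_coe.mpr le_top)
  have e : ∀ v w, fderiv ℝ (fun q => fderiv ℝ F q w) p.1 v = fderiv ℝ (fderiv ℝ F) p v w :=
    fun v w => by
      rw [fderiv_clm_apply hd (differentiableAt_const w)]
      simp
  rw [e, e]
  exact hs v w

/-- Evaluation at a point of `W`. -/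
def smoothAlg.ev (p : W) : smoothAlg M W →+* M :=
  (Pi.evalRingHom (fun _ : W => M) p).comp (smoothAlg M W).toSubring.subtype

theorem smoothAlg.ev_mk (p : W) (f : E → M) (hf : ContDiffOn ℝ ∞ f W) :
    smoothAlg.ev p (smoothAlg.mk f hf) = f p := rfl

theorem smoothAlg.ev_star (p : W) (f : smoothAlg M W) :
    smoothAlg.ev p (star f) = star (smoothAlg.ev p f) := rfl

theorem smoothAlg.ext_ev {f g : smoothAlg M W} (h : ∀ p, smoothAlg.ev p f = smoothAlg.ev p g) :
    f = g :=
  Subtype.ext (funext h)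

end SmoothRing

/-! ### The heat flow in local coordinates -/

section LocalFlow

open scoped Matrix ComplexOrder

attribute [local instance] Matrix.frobeniusNormedRing Matrix.frobeniusNormedAlgebra
  normedStarGroup_matrix

variable {E : Type*} [NormedAddCommGroup E] [NormedSpace ℝ E] {ι : Type*} {r : ℕ}

/-- The real part of the trace as an additive homomorphism. -/
def reTrHom (r : ℕ) : Matrix (Fin r) (Fin r) ℂ →+ ℝ where
  toFun := reTr
  map_zero' := by simp [reTr]
  map_add' := reTr_add

theorem reTrHom_apply (X : Matrix (Fin r) (Fin r) ℂ) : reTrHom r X = reTr X := rfl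

/-- The self-adjoint part `ψ` in a local frame with Gram matrix `H` and connection form `A`. -/
def localPsi (v : ι → E) (H : ℝ × E → Matrix (Fin r) (Fin r) ℂ)
    (A : ι → E → Matrix (Fin r) (Fin r) ℂ) (a : ι) (p : ℝ × E) : Matrix (Fin r) (Fin r) ℂ :=
  (-1 / 2 : ℝ) • ((H p)⁻¹ * (fderiv ℝ H p (0, v a) - star (A a p.2) * H p - H p * A a p.2))

/-- The covariant derivative `∇_c ψ_a`, for the unitary part of the connection. -/
def localNabla (v : ι → E) (H : ℝ × E → Matrix (Fin r) (Fin r) ℂ)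
    (A : ι → E → Matrix (Fin r) (Fin r) ℂ) (c a : ι) (p : ℝ × E) : Matrix (Fin r) (Fin r) ℂ :=
  fderiv ℝ (localPsi v H A a) p (0, v c) +
    ((A c p.2 - localPsi v H A c p) * localPsi v H A a p -
      localPsi v H A a p * (A c p.2 - localPsi v H A c p))

/-- The heat operator `g^{ck} ∂_c ∂_k - ∂_t`. -/
def heatOp [Fintype ι] (v : ι → E) (g : ι → ι → E → ℝ) (f : ℝ × E → ℝ) (p : ℝ × E) : ℝ :=
  ∑ c, ∑ k, g c k p.2 * fderiv ℝ (fun q => fderiv ℝ f q (0, v k)) p (0, v c) -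
    fderiv ℝ f p (1, 0)

/-- The energy density `g^{ab} tr (ψ_a ψ_b)`. -/
def localEnergy [Fintype ι] (v : ι → E) (g : ι → ι → E → ℝ)
    (H : ℝ × E → Matrix (Fin r) (Fin r) ℂ) (A : ι → E → Matrix (Fin r) (Fin r) ℂ)
    (p : ℝ × E) : ℝ :=
  ∑ a, ∑ b, g a b p.2 * reTr (localPsi v H A a p * localPsi v H A b p)

/-- The heat flow of Gram matrices in local coordinates, on `I × U`. -/
structure LocalFlow [Fintype ι] (v : ι → E) (g : ι → ι → E → ℝ) (I : Set ℝ) (U : Set E)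
    (H : ℝ × E → Matrix (Fin r) (Fin r) ℂ) (A : ι → E → Matrix (Fin r) (Fin r) ℂ) : Prop where
  open_I : IsOpen I
  open_U : IsOpen U
  smooth_H : ContDiffOn ℝ ∞ H (I ×ˢ U)
  smooth_A : ∀ a, ContDiffOn ℝ ∞ (A a) U
  smooth_g : ∀ a b, ContDiffOn ℝ ∞ (g a b) U
  symm_g : ∀ x ∈ U, ∀ a b, g a b x = g b a x
  herm : ∀ p ∈ I ×ˢ U, star (H p) = H p
  unit : ∀ p ∈ I ×ˢ U, IsUnit (H p).det
  flow : ∀ p ∈ I ×ˢ U, fderiv ℝ H p (1, 0) =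
    H p * (-2 * ∑ c, ∑ k, g c k p.2 • localNabla v H A c k p)

theorem contDiffOn_matrix_inv {W : Set E} {H : E → Matrix (Fin r) (Fin r) ℂ}
    (hH : ContDiffOn ℝ ∞ H W) (hu : ∀ p ∈ W, IsUnit (H p).det) :
    ContDiffOn ℝ ∞ (fun p => (H p)⁻¹) W := by
  intro p hp
  have h : IsUnit (H p) := (Matrix.isUnit_iff_isUnit_det _).mpr (hu p hp)
  have h1 : ContDiffAt ℝ ∞ Ring.inverse (H p) := contDiffAt_ringInverse ℝ h.unit
  simpa only [Matrix.nonsing_inv_eq_ringInverse] using! h1.comp_contDiffWithinAt p (hH p hp)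

theorem contDiffOn_localPsi {v : ι → E} {I : Set ℝ} {U : Set E}
    {H : ℝ × E → Matrix (Fin r) (Fin r) ℂ} {A : ι → E → Matrix (Fin r) (Fin r) ℂ}
    (ho : IsOpen (I ×ˢ U)) (hH : ContDiffOn ℝ ∞ H (I ×ˢ U))
    (hu : ∀ p ∈ I ×ˢ U, IsUnit (H p).det) {a : ι} (hA : ContDiffOn ℝ ∞ (A a) U) :
    ContDiffOn ℝ ∞ (localPsi v H A a) (I ×ˢ U) := by
  have hA' : ContDiffOn ℝ ∞ (fun p : ℝ × E => A a p.2) (I ×ˢ U) :=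
    hA.comp contDiff_snd.contDiffOn fun _ hp => hp.2
  refine ContDiffOn.const_smul _ ((contDiffOn_matrix_inv hH hu).mul
    (((contDiffOn_fderiv_apply ho hH _).sub (ContDiffOn.mul ?_ hH)).sub (hH.mul hA')))
  exact ((starL' ℝ : Matrix (Fin r) (Fin r) ℂ ≃L[ℝ] _).contDiff).comp_contDiffOn hA'

namespace LocalFlow

variable [Fintype ι] {v : ι → E} {g : ι → ι → E → ℝ} {I : Set ℝ} {U : Set E}
  {H : ℝ × E → Matrix (Fin r) (Fin r) ℂ} {A : ι → E → Matrix (Fin r) (Fin r) ℂ}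

theorem open_prod (h : LocalFlow v g I U H A) : IsOpen (I ×ˢ U) := h.open_I.prod h.open_U

theorem comp_snd {F : Type*} [NormedAddCommGroup F] [NormedSpace ℝ F] {f : E → F}
    (hf : ContDiffOn ℝ ∞ f U) : ContDiffOn ℝ ∞ (fun p : ℝ × E => f p.2) (I ×ˢ U) :=
  hf.comp contDiff_snd.contDiffOn fun _ hp => hp.2

theorem smooth_psi (h : LocalFlow v g I U H A) (a : ι) :
    ContDiffOn ℝ ∞ (localPsi v H A a) (I ×ˢ U) :=
  contDiffOn_localPsi h.open_prod h.smooth_H h.unit (h.smooth_A a)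

theorem psi_mul (h : LocalFlow v g I U H A) (a : ι) {p : ℝ × E} (hp : p ∈ I ×ˢ U) :
    fderiv ℝ H p (0, v a) = star (A a p.2) * H p + H p * A a p.2 -
      2 * (H p * localPsi v H A a p) := by
  rw [localPsi, mul_smul_comm, ← mul_assoc, Matrix.mul_nonsing_inv _ (h.unit p hp), one_mul,
    mul_smul_comm, two_mul]
  module

theorem fderiv_star_H (h : LocalFlow v g I U H A) {p : ℝ × E} (hp : p ∈ I ×ˢ U) (w : ℝ × E) :
    star (fderiv ℝ H p w) = fderiv ℝ H p w := by
  have e : (fun q => star (H q)) =ᶠ[𝓝 p] H :=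
    Filter.eventuallyEq_of_mem (h.open_prod.mem_nhds hp) fun q hq => h.herm q hq
  have h1 := (starL' ℝ : Matrix (Fin r) (Fin r) ℂ ≃L[ℝ] _).comp_fderiv (f := H) (x := p)
  have h2 : fderiv ℝ (fun q => star (H q)) p w = star (fderiv ℝ H p w) := DFunLike.congr_fun h1 w
  rw [← h2, e.fderiv_eq]

/-- Take adjoints in `psi_mul`: the derivative of `H` and the sum `A^* H + H A` are Hermitian, hence
so is `H ψ`. -/
theorem psi_sa (h : LocalFlow v g I U H A) (a : ι) {p : ℝ × E} (hp : p ∈ I ×ˢ U) :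
    IsSaFor (H p) (localPsi v H A a p) := by
  have h1 := h.psi_mul a hp
  have h2 := congrArg star h1
  rw [h.fderiv_star_H hp] at h2
  simp only [star_sub, star_add, star_mul, star_star, h.herm p hp] at h2
  have h3 : (2 : Matrix (Fin r) (Fin r) ℂ) * (star (localPsi v H A a p) * H p) =
      2 * (H p * localPsi v H A a p) := by
    rw [h1] at h2
    have hst2 : star (2 : Matrix (Fin r) (Fin r) ℂ) = 2 := star_ofNat 2
    rw [hst2] at h2
    have h4 : star (localPsi v H A a p) * H p * 2 = 2 * (star (localPsi v H A a p) * H p) := by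
      rw [mul_two, two_mul]
    rw [h4] at h2
    have := sub_eq_zero.mpr h2
    rw [← sub_eq_zero, ← this]
    noncomm_ring
  rw [two_mul, two_mul, ← two_smul ℝ, ← two_smul ℝ] at h3
  exact smul_right_injective _ two_ne_zero h3

/-- A function on `U`, regarded as a time-independent element of the ring of smooth functions. -/
def pull {f : E → Matrix (Fin r) (Fin r) ℂ} (hf : ContDiffOn ℝ ∞ f U) :
    smoothAlg (Matrix (Fin r) (Fin r) ℂ) (I ×ˢ U) :=
  smoothAlg.mk (fun p => f p.2) (comp_snd hf)

theorem fderiv_comp_snd {F : Type*} [NormedAddCommGroup F] [NormedSpace ℝ F] {f : E → F}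
    {p : ℝ × E} (hf : DifferentiableAt ℝ f p.2) (w : ℝ × E) :
    fderiv ℝ (fun p : ℝ × E => f p.2) p w = fderiv ℝ f p.2 w.2 := by
  have h := (hf.hasFDerivAt.comp p hasFDerivAt_snd).fderiv
  exact DFunLike.congr_fun h w

theorem differentiableAt_of_mem {F : Type*} [NormedAddCommGroup F] [NormedSpace ℝ F] {f : E → F}
    (hU : IsOpen U) (hf : ContDiffOn ℝ ∞ f U) {x : E} (hx : x ∈ U) : DifferentiableAt ℝ f x :=
  (hf.contDiffAt (hU.mem_nhds hx)).differentiableAt (by simp)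

theorem deriv_pull (hI : IsOpen I) (hU : IsOpen U) {f : E → Matrix (Fin r) (Fin r) ℂ}
    (hf : ContDiffOn ℝ ∞ f U) (w : E) :
    smoothAlg.deriv (hI.prod hU) ((0 : ℝ), w) (pull hf) =
      pull (I := I) (contDiffOn_fderiv_apply hU hf w) := by
  refine smoothAlg.ext_ev fun p => ?_
  rw [pull, smoothAlg.deriv_mk, smoothAlg.ev_mk, pull, smoothAlg.ev_mk,
    fderiv_comp_snd (differentiableAt_of_mem hU hf p.2.2)]

theorem deriv_time_pull (hI : IsOpen I) (hU : IsOpen U) {f : E → Matrix (Fin r) (Fin r) ℂ}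
    (hf : ContDiffOn ℝ ∞ f U) :
    smoothAlg.deriv (hI.prod hU) ((1 : ℝ), (0 : E)) (pull hf) = 0 := by
  refine smoothAlg.ext_ev fun p => ?_
  rw [pull, smoothAlg.deriv_mk, smoothAlg.ev_mk,
    fderiv_comp_snd (differentiableAt_of_mem hU hf p.2.2), map_zero, map_zero]

theorem smooth_scalar {s : E → ℝ} (hs : ContDiffOn ℝ ∞ s U) :
    ContDiffOn ℝ ∞ (fun x => s x • (1 : Matrix (Fin r) (Fin r) ℂ)) U :=
  hs.smul contDiffOn_const

/-- A real function on `U`, regarded as a central element of the ring of smooth functions. -/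
def scalar (I : Set ℝ) (r : ℕ) {s : E → ℝ} (hs : ContDiffOn ℝ ∞ s U) :
    smoothAlg (Matrix (Fin r) (Fin r) ℂ) (I ×ˢ U) :=
  pull (smooth_scalar hs)

theorem ev_scalar {s : E → ℝ} (hs : ContDiffOn ℝ ∞ s U) (p : (I ×ˢ U : Set (ℝ × E))) :
    smoothAlg.ev p (scalar I r hs) = s p.1.2 • (1 : Matrix (Fin r) (Fin r) ℂ) := rfl

theorem deriv_scalar (hI : IsOpen I) (hU : IsOpen U) {s : E → ℝ} (hs : ContDiffOn ℝ ∞ s U)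
    (w : E) : smoothAlg.deriv (hI.prod hU) ((0 : ℝ), w) (scalar I r hs) =
      scalar I r (contDiffOn_fderiv_apply hU hs w) := by
  rw [scalar, deriv_pull hI hU]
  refine smoothAlg.ext_ev fun p => ?_
  rw [ev_scalar, pull, smoothAlg.ev_mk,
    fderiv_smul_const (differentiableAt_of_mem hU hs p.2.2)]
  rfl

theorem ev_pull {f : E → Matrix (Fin r) (Fin r) ℂ} (hf : ContDiffOn ℝ ∞ f U)
    (p : (I ×ˢ U : Set (ℝ × E))) : smoothAlg.ev p (pull hf) = f p.1.2 := rfl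

theorem ev_nabla (h : LocalFlow v g I U H A) (p : (I ×ˢ U : Set (ℝ × E))) (c a : ι) :
    smoothAlg.ev p (twist
      (fun a => smoothAlg.deriv (M := Matrix (Fin r) (Fin r) ℂ) h.open_prod ((0 : ℝ), v a))
      ((fun a => pull (h.smooth_A a)) - fun a => smoothAlg.mk _ (h.smooth_psi a)) c
      (smoothAlg.mk _ (h.smooth_psi a))) = localNabla v H A c a p := by
  simp only [twist, localNabla, map_add, map_sub, map_mul, Pi.sub_apply, smoothAlg.deriv_mk,
    smoothAlg.ev_mk, ev_pull]
  rfl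

/-- The elements of the ring of smooth functions given by a local flow. -/
theorem flowData (h : LocalFlow v g I U H A) (p : (I ×ˢ U : Set (ℝ × E))) :
    FlowData (fun a => smoothAlg.deriv (M := Matrix (Fin r) (Fin r) ℂ) h.open_prod ((0 : ℝ), v a))
      (smoothAlg.deriv h.open_prod ((1 : ℝ), (0 : E)))
      (AddMonoidHom.comp (reTrHom r) (smoothAlg.ev p).toAddMonoidHom)
      (smoothAlg.mk H h.smooth_H) (smoothAlg.mk _ (contDiffOn_matrix_inv h.smooth_H h.unit))
      (fun a => pull (h.smooth_A a)) (fun a => smoothAlg.mk _ (h.smooth_psi a))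
      (fun a b => scalar I r (h.smooth_g a b))
      (fun a b => g a b p.1.2) (fun c a b => fderiv ℝ (g a b) p.1.2 (v c))
      (fun c k a b => fderiv ℝ (fun x => fderiv ℝ (g a b) x (v k)) p.1.2 (v c)) where
  leib a x y := smoothAlg.deriv_mul _ _ x y
  leib_t x y := smoothAlg.deriv_mul _ _ x y
  comm a b x := smoothAlg.deriv_comm _ _ _ x
  comm_t a x := smoothAlg.deriv_comm _ _ _ x
  star_d a x := smoothAlg.deriv_star _ _ x
  trace_comm x y := by
    simp only [AddMonoidHom.comp_apply, RingHom.toAddMonoidHom_eq_coe, AddMonoidHom.coe_coe,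
      map_mul]
    exact reTr_mul_comm _ _
  trace_star x := reTr_star _
  mul_inv := smoothAlg.ext_ev fun q => by
    rw [map_mul, smoothAlg.ev_mk, smoothAlg.ev_mk, Matrix.mul_nonsing_inv _ (h.unit q q.2), map_one]
  inv_mul := smoothAlg.ext_ev fun q => by
    rw [map_mul, smoothAlg.ev_mk, smoothAlg.ev_mk, Matrix.nonsing_inv_mul _ (h.unit q q.2), map_one]
  central a b x := smoothAlg.ext_ev fun q => by
    rw [map_mul, map_mul, ev_scalar, smul_one_mul, mul_smul_one]
  trace_G a b x := by
    simp only [AddMonoidHom.comp_apply, RingHom.toAddMonoidHom_eq_coe, AddMonoidHom.coe_coe,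
      map_mul, ev_scalar, smul_one_mul]
    exact reTr_smul _ _
  trace_dG c a b x := by
    simp only [AddMonoidHom.comp_apply, RingHom.toAddMonoidHom_eq_coe, AddMonoidHom.coe_coe,
      deriv_scalar h.open_I h.open_U, map_mul, ev_scalar, smul_one_mul]
    exact reTr_smul _ _
  trace_ddG c k a b x := by
    simp only [AddMonoidHom.comp_apply, RingHom.toAddMonoidHom_eq_coe, AddMonoidHom.coe_coe,
      deriv_scalar h.open_I h.open_U, map_mul, ev_scalar, smul_one_mul]
    exact reTr_smul _ _
  symm_g a b := h.symm_g _ p.2.2 a b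
  A_t a := deriv_time_pull h.open_I h.open_U _
  star_A_t a := by rw [smoothAlg.deriv_star, deriv_time_pull h.open_I h.open_U, star_zero]
  G_t a b := deriv_time_pull h.open_I h.open_U _
  psi_sa a := smoothAlg.ext_ev fun q => h.psi_sa a q.2
  d_H a := smoothAlg.ext_ev fun q => by
    rw [smoothAlg.deriv_mk]
    exact h.psi_mul a q.2
  dt_H := smoothAlg.ext_ev fun q => by
    rw [smoothAlg.deriv_mk, smoothAlg.ev_mk]
    refine (h.flow q q.2).trans ?_
    simp only [map_mul, map_neg, map_sum, map_ofNat, ev_scalar, smul_one_mul, h.ev_nabla,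
      smoothAlg.ev_mk]

end LocalFlow

/-- The curvature `∂_a A_b - ∂_b A_a + [A_a, A_b]` of a local connection form. -/
def localCurv (v : ι → E) (A : ι → E → Matrix (Fin r) (Fin r) ℂ) (a b : ι) (x : E) :
    Matrix (Fin r) (Fin r) ℂ :=
  fderiv ℝ (A b) x (v a) - fderiv ℝ (A a) x (v b) + (A a x * A b x - A b x * A a x)

/-- The covariant derivative of the curvature. -/
def localDCurv (v : ι → E) (A : ι → E → Matrix (Fin r) (Fin r) ℂ) (c a b : ι) (x : E) :
    Matrix (Fin r) (Fin r) ℂ :=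
  fderiv ℝ (localCurv v A a b) x (v c) + (A c x * localCurv v A a b x - localCurv v A a b x * A c x)

theorem contDiffOn_localCurv {v : ι → E} {U : Set E} (hU : IsOpen U)
    {A : ι → E → Matrix (Fin r) (Fin r) ℂ} (hA : ∀ a, ContDiffOn ℝ ∞ (A a) U) (a b : ι) :
    ContDiffOn ℝ ∞ (localCurv v A a b) U :=
  ((contDiffOn_fderiv_apply hU (hA b) _).sub (contDiffOn_fderiv_apply hU (hA a) _)).add
    (((hA a).mul (hA b)).sub ((hA b).mul (hA a)))

theorem contDiffOn_localDCurv {v : ι → E} {U : Set E} (hU : IsOpen U)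
    {A : ι → E → Matrix (Fin r) (Fin r) ℂ} (hA : ∀ a, ContDiffOn ℝ ∞ (A a) U) (c a b : ι) :
    ContDiffOn ℝ ∞ (localDCurv v A c a b) U :=
  (contDiffOn_fderiv_apply hU (contDiffOn_localCurv hU hA a b) _).add
    (((hA c).mul (contDiffOn_localCurv hU hA a b)).sub
      ((contDiffOn_localCurv hU hA a b).mul (hA c)))

/-- The real part of the trace as a continuous linear map. -/
def reTrL (r : ℕ) : Matrix (Fin r) (Fin r) ℂ →L[ℝ] ℝ :=
  LinearMap.toContinuousLinearMap
    { toFun := reTr, map_add' := reTr_add, map_smul' := fun c X => by simp [reTr_smul] }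

theorem reTrL_apply (X : Matrix (Fin r) (Fin r) ℂ) : reTrL r X = reTr X := rfl

theorem fderiv_reTr {E' : Type*} [NormedAddCommGroup E'] [NormedSpace ℝ E']
    {F : E' → Matrix (Fin r) (Fin r) ℂ} {p : E'}
    (hF : DifferentiableAt ℝ F p) (w : E') :
    fderiv ℝ (fun q => reTr (F q)) p w = reTr (fderiv ℝ F p w) := by
  have h := ((reTrL r).hasFDerivAt.comp p hF.hasFDerivAt).fderiv
  exact DFunLike.congr_fun h w

/-- A bound on the geometry at the point `x`. -/
structure GeomBound [Fintype ι] [DecidableEq ι] (v : ι → E) (g : ι → ι → E → ℝ)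
    (A : ι → E → Matrix (Fin r) (Fin r) ℂ) (m Λ : ℝ) (x : E) : Prop where
  pos : (Matrix.of (fun a b => g a b x) - m • 1).PosSemidef
  g_le : ∀ a b, |g a b x| ≤ Λ
  dg_le : ∀ c a b, |fderiv ℝ (g a b) x (v c)| ≤ Λ
  ddg_le : ∀ c k a b, |fderiv ℝ (fun y => fderiv ℝ (g a b) y (v k)) x (v c)| ≤ Λ
  A_le : ∀ a, ‖A a x‖ ≤ Λ
  dA_le : ∀ c a, ‖fderiv ℝ (A a) x (v c)‖ ≤ Λ
  curv_le : ∀ a b, ‖localCurv v A a b x‖ ≤ Λ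
  dcurv_le : ∀ c a b, ‖localDCurv v A c a b x‖ ≤ Λ

namespace LocalFlow

variable [Fintype ι] {v : ι → E} {g : ι → ι → E → ℝ} {I : Set ℝ} {U : Set E}
  {H : ℝ × E → Matrix (Fin r) (Fin r) ℂ} {A : ι → E → Matrix (Fin r) (Fin r) ℂ}

/-- The trace is linear and continuous, so it commutes with derivatives. This carries identities in
the ring of smooth functions over to `heatOp`. -/
theorem heatOp_eq (h : LocalFlow v g I U H A) {f : ℝ × E → ℝ}
    {X : smoothAlg (Matrix (Fin r) (Fin r) ℂ) (I ×ˢ U)}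
    (hf : ∀ q : (I ×ˢ U : Set (ℝ × E)), f q = reTr (smoothAlg.ev q X))
    (p : (I ×ˢ U : Set (ℝ × E))) :
    heatOp v g f p = ∑ c, ∑ k, g c k p.1.2 * reTr (smoothAlg.ev p
        (smoothAlg.deriv h.open_prod ((0 : ℝ), v c) (smoothAlg.deriv h.open_prod ((0 : ℝ), v k) X))) -
      reTr (smoothAlg.ev p (smoothAlg.deriv h.open_prod ((1 : ℝ), (0 : E)) X)) := by
  obtain ⟨F, hF, rfl⟩ := smoothAlg.exists_mk X
  have hd : ∀ {F : ℝ × E → Matrix (Fin r) (Fin r) ℂ}, ContDiffOn ℝ ∞ F (I ×ˢ U) →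
      ∀ q ∈ I ×ˢ U, DifferentiableAt ℝ F q := fun hF q hq =>
    (hF.contDiffAt (h.open_prod.mem_nhds hq)).differentiableAt (by simp)
  have h1 : ∀ q ∈ I ×ˢ U, ∀ w, fderiv ℝ f q w = reTr (fderiv ℝ F q w) := fun q hq w => by
    have e : f =ᶠ[𝓝 q] fun q => reTr (F q) :=
      Filter.eventuallyEq_of_mem (h.open_prod.mem_nhds hq) fun q' hq' => hf ⟨q', hq'⟩
    rw [e.fderiv_eq, fderiv_reTr (hd hF q hq)]
  have h2 : ∀ w w', fderiv ℝ (fun q => fderiv ℝ f q w) p w' =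
      reTr (fderiv ℝ (fun q => fderiv ℝ F q w) p w') := fun w w' => by
    have e : (fun q => fderiv ℝ f q w) =ᶠ[𝓝 p.1] fun q => reTr (fderiv ℝ F q w) :=
      Filter.eventuallyEq_of_mem (h.open_prod.mem_nhds p.2) fun q' hq' => h1 q' hq' w
    rw [e.fderiv_eq]
    exact fderiv_reTr (hd (contDiffOn_fderiv_apply h.open_prod hF w) p p.2) w'
  simp only [smoothAlg.deriv_mk, smoothAlg.ev_mk, heatOp, h2, h1 p p.2]
  rfl

theorem ev_curv (h : LocalFlow v g I U H A) (p : (I ×ˢ U : Set (ℝ × E))) (a b : ι) :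
    smoothAlg.ev p (curvForm
      (fun a => smoothAlg.deriv (M := Matrix (Fin r) (Fin r) ℂ) h.open_prod ((0 : ℝ), v a))
      (fun a => pull (h.smooth_A a)) a b) = localCurv v A a b p.1.2 := by
  simp only [curvForm, localCurv, map_add, map_sub, map_mul, deriv_pull h.open_I h.open_U, ev_pull]
  rfl

theorem ev_dcurv (h : LocalFlow v g I U H A) (p : (I ×ˢ U : Set (ℝ × E))) (c a b : ι) :
    smoothAlg.ev p (twist
      (fun a => smoothAlg.deriv (M := Matrix (Fin r) (Fin r) ℂ) h.open_prod ((0 : ℝ), v a))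
      (fun a => pull (h.smooth_A a)) c (curvForm
      (fun a => smoothAlg.deriv (M := Matrix (Fin r) (Fin r) ℂ) h.open_prod ((0 : ℝ), v a))
      (fun a => pull (h.smooth_A a)) a b)) = localDCurv v A c a b p.1.2 := by
  have e : curvForm
      (fun a => smoothAlg.deriv (M := Matrix (Fin r) (Fin r) ℂ) h.open_prod ((0 : ℝ), v a))
      (fun a => pull (h.smooth_A a)) a b = pull (contDiffOn_localCurv (v := v) h.open_U h.smooth_A a b) :=
    smoothAlg.ext_ev fun q => by rw [h.ev_curv, ev_pull]
  rw [e]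
  simp only [twist, localDCurv, map_add, map_sub, map_mul, deriv_pull h.open_I h.open_U, ev_pull]
  rfl

end LocalFlow

/-- The identity `FlowData.bochner` at the point `p`, estimated by `exists_bochner_bound`. The
constant is chosen before the flow, the frame and the point; apart from the dimensions it depends
only on `m` and `Λ`. -/
theorem exists_heatOp_energy_bound (E : Type*) [NormedAddCommGroup E] [NormedSpace ℝ E]
    (ι : Type*) [Fintype ι] [DecidableEq ι] (r : ℕ) {m Λ : ℝ} (hm : 0 < m) (hΛ : 0 ≤ Λ) :
    ∃ C : ℝ, 0 ≤ C ∧ ∀ (v : ι → E) (g : ι → ι → E → ℝ) (I : Set ℝ) (U : Set E)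
      (H : ℝ × E → Matrix (Fin r) (Fin r) ℂ) (A : ι → E → Matrix (Fin r) (Fin r) ℂ),
      LocalFlow v g I U H A → ∀ p ∈ I ×ˢ U, GeomBound v g A m Λ p.2 →
      (H p - m • 1).PosSemidef → ((H p)⁻¹ - m • 1).PosSemidef →
      -(C * (1 + ‖fun a => localPsi v H A a p‖ ^ 2)) ≤ heatOp v g (localEnergy v g H A) p := by
  obtain ⟨C, hC, hb⟩ := exists_bochner_bound ι r hm hΛ
  refine ⟨C, hC, fun v g I U H A h p hp hG hH hHi => ?_⟩
  have hfd := h.flowData ⟨p, hp⟩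
  have hboch := hfd.bochner
  rw [h.heatOp_eq (X := ∑ a, ∑ b, LocalFlow.scalar I r (h.smooth_g a b) *
    (smoothAlg.mk _ (h.smooth_psi a) * smoothAlg.mk _ (h.smooth_psi b))) _ ⟨p, hp⟩]
  swap
  · intro q
    simp only [map_sum, map_mul, LocalFlow.ev_scalar, smul_one_mul, smoothAlg.ev_mk, localEnergy]
    rw [← reTrL_apply, map_sum]
    refine Finset.sum_congr rfl fun a _ => ?_
    rw [map_sum]
    exact Finset.sum_congr rfl fun b _ => (reTr_smul _ _).symm
  refine (hb (Matrix.of fun a b => g a b p.2) (fun c a b => fderiv ℝ (g a b) p.2 (v c))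
    (fun c k a b => fderiv ℝ (fun x => fderiv ℝ (g a b) x (v k)) p.2 (v c)) (H p) (H p)⁻¹
    (fun a => localPsi v H A a p) (fun c a => localNabla v H A c a p)
    (fun a b => localCurv v A a b p.2) (fun c a b => localDCurv v A c a b p.2) hG.pos hG.g_le
    hG.dg_le hG.ddg_le (Matrix.nonsing_inv_mul _ (h.unit p hp)) hH hHi
    (fun a => h.psi_sa a hp) ?_ (fun a b => hG.curv_le a b)
    (fun c a b => hG.dcurv_le c a b)).trans (le_of_eq ?_)
  · intro c a
    have := IsSaFor.twist hfd.leib hfd.star_d hfd.d_H' (hfd.psi_sa a) c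
    have h1 := congrArg (smoothAlg.ev ⟨p, hp⟩) this
    rwa [map_mul, map_mul, smoothAlg.ev_star, h.ev_nabla] at h1
  · simp only [hfd.trace_G] at hboch
    simp only [AddMonoidHom.comp_apply, RingHom.toAddMonoidHom_eq_coe, AddMonoidHom.coe_coe,
      map_mul, map_add, map_sub, h.ev_nabla, h.ev_curv, h.ev_dcurv, smoothAlg.ev_mk,
      reTrHom_apply] at hboch
    simp only [reTr_add, Matrix.of_apply]
    exact hboch.symm

/-- The same passage from `FlowData.trace_mul_metric` and `exists_trace_bound`. It will be used with
`κ` the inverse Gram matrix of the fixed metric `K`, so that the trace is `tr (K⁻¹ H)`. -/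
theorem exists_heatOp_trace_bound (E : Type*) [NormedAddCommGroup E] [NormedSpace ℝ E]
    (ι : Type*) [Fintype ι] [DecidableEq ι] (r : ℕ) {m Λ : ℝ} (hm : 0 < m) (hΛ : 0 ≤ Λ) :
    ∃ C : ℝ, 0 ≤ C ∧ ∀ (v : ι → E) (g : ι → ι → E → ℝ) (I : Set ℝ) (U : Set E)
      (H : ℝ × E → Matrix (Fin r) (Fin r) ℂ) (A : ι → E → Matrix (Fin r) (Fin r) ℂ)
      (κ : E → Matrix (Fin r) (Fin r) ℂ),
      LocalFlow v g I U H A → ContDiffOn ℝ ∞ κ U → ∀ p ∈ I ×ˢ U, GeomBound v g A m Λ p.2 →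
      (H p - m • 1).PosSemidef → (κ p.2 - m • 1).PosSemidef → ‖H p‖ ≤ Λ → ‖κ p.2‖ ≤ Λ →
      (∀ a, ‖fderiv ℝ κ p.2 (v a)‖ ≤ Λ) →
      (∀ c a, ‖fderiv ℝ (fun x => fderiv ℝ κ x (v a)) p.2 (v c)‖ ≤ Λ) →
      2 * m ^ 3 * ‖fun a => localPsi v H A a p‖ ^ 2 - C ≤
        heatOp v g (fun q => reTr (κ q.2 * H q)) p := by
  obtain ⟨C, hC, hb⟩ := exists_trace_bound ι r hm hΛ
  refine ⟨C, hC, fun v g I U H A κ h hκs p hp hG hH hκ hHΛ hκΛ hdκ hddκ => ?_⟩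
  have hfd := h.flowData ⟨p, hp⟩
  have htr := hfd.trace_mul_metric (κ := LocalFlow.pull hκs)
    (LocalFlow.deriv_time_pull h.open_I h.open_U hκs)
  rw [h.heatOp_eq (X := LocalFlow.pull hκs * smoothAlg.mk H h.smooth_H) (fun q => rfl) ⟨p, hp⟩]
  refine (hb (Matrix.of fun a b => g a b p.2) (H p) (κ p.2)
    (fun a => localPsi v H A a p) (fun a => A a p.2) (fun a => fderiv ℝ κ p.2 (v a))
    (fun a => fderiv ℝ H p (0, v a)) (fun c a => fderiv ℝ (A a) p.2 (v c))
    (fun c a => fderiv ℝ (fun x => fderiv ℝ κ x (v a)) p.2 (v c)) hG.pos hG.g_le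
    hHΛ hκΛ hH hκ (fun a => h.psi_sa a hp) hG.A_le hG.dA_le hdκ hddκ
    (fun a => h.psi_mul a hp)).trans (le_of_eq ?_)
  simp only [hfd.trace_G] at htr
  simp only [AddMonoidHom.comp_apply, RingHom.toAddMonoidHom_eq_coe, AddMonoidHom.coe_coe,
    map_mul, map_add, map_sub, map_ofNat, smoothAlg.ev_star, smoothAlg.deriv_mk,
    LocalFlow.deriv_pull h.open_I h.open_U, LocalFlow.ev_pull, smoothAlg.ev_mk,
    reTrHom_apply] at htr
  simp only [reTr_add, reTr_sub, mul_add, mul_sub, Matrix.of_apply] at htr ⊢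
  exact htr.symm

end LocalFlow

/-! ### Holomorphic charts as real charts -/

section Chart

set_option linter.unusedSectionVars false

variable {n : ℕ} {X : Type*} [TopologicalSpace X] [ChartedSpace (Cn n) X]
  [IsManifold 𝓘(ℂ, Cn n) ω X] {φ : OpenPartialHomeomorph X (Cn n)}

/-- Restriction of scalars turns holomorphic transition maps into smooth real ones. -/
theorem mem_real_maximalAtlas (hφ : φ ∈ IsManifold.maximalAtlas 𝓘(ℂ, Cn n) ω X) :
    φ ∈ IsManifold.maximalAtlas 𝓘(ℝ, Cn n) ∞ X := by
  have key : ∀ e : OpenPartialHomeomorph (Cn n) (Cn n), e ∈ contDiffGroupoid ω 𝓘(ℂ, Cn n) →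
      e ∈ contDiffGroupoid ∞ 𝓘(ℝ, Cn n) := fun e h => by
    rw [contDiffGroupoid, mem_groupoid_of_pregroupoid] at h ⊢
    have h1 : ContDiffOn ℂ ω e e.source := by simpa [contDiffPregroupoid] using h.1
    have h2 : ContDiffOn ℂ ω e.symm e.target := by simpa [contDiffPregroupoid] using h.2
    exact ⟨by simpa [contDiffPregroupoid] using (h1.restrict_scalars ℝ).of_le (by simp),
      by simpa [contDiffPregroupoid] using (h2.restrict_scalars ℝ).of_le (by simp)⟩
  rw [IsManifold.maximalAtlas, mem_maximalAtlas_iff] at hφ ⊢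
  exact fun e he => ⟨key _ (hφ e he).1, key _ (hφ e he).2⟩

theorem chart_mdifferentiable (hφ : φ ∈ IsManifold.maximalAtlas 𝓘(ℂ, Cn n) ω X) :
    φ.MDifferentiable 𝓘(ℝ, Cn n) 𝓘(ℝ, Cn n) :=
  ⟨(contMDiffOn_of_mem_maximalAtlas (mem_real_maximalAtlas hφ)).mdifferentiableOn (by simp),
    (contMDiffOn_symm_of_mem_maximalAtlas (mem_real_maximalAtlas hφ)).mdifferentiableOn (by simp)⟩

/-- Differentiating `φ.symm ∘ φ` and `φ ∘ φ.symm` shows that the inverse in the definition is the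
derivative of `φ.symm`, to which the chain rule applies. -/
theorem coordField_eq (hφ : φ ∈ IsManifold.maximalAtlas 𝓘(ℂ, Cn n) ω X) {x : X}
    (hx : x ∈ φ.source) (v : Cn n) :
    coordField φ v x = mfderiv 𝓘(ℝ, Cn n) 𝓘(ℝ, Cn n) φ.symm (φ x) v := by
  have h := chart_mdifferentiable hφ
  have hx' : φ.symm (φ x) = x := φ.left_inv hx
  have h1 := h.symm_comp_deriv hx
  have h2 := h.comp_symm_deriv (φ.map_source hx)
  rw [coordField]
  have h3 : (mfderiv 𝓘(ℝ, Cn n) 𝓘(ℝ, Cn n) φ x).comp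
      (mfderiv 𝓘(ℝ, Cn n) 𝓘(ℝ, Cn n) φ.symm (φ x)) = ContinuousLinearMap.id ℝ (Cn n) := by
    rw [hx'] at h2; exact h2
  have h4 : (mfderiv 𝓘(ℝ, Cn n) 𝓘(ℝ, Cn n) φ x).inverse =
      (mfderiv 𝓘(ℝ, Cn n) 𝓘(ℝ, Cn n) φ.symm (φ x) : Cn n →L[ℝ] Cn n) :=
    ContinuousLinearMap.inverse_eq h3 h1
  rw [h4]
  rfl

theorem coordField_add (φ : OpenPartialHomeomorph X (Cn n)) (v w : Cn n) (x : X) :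
    coordField φ (v + w) x = coordField φ v x + coordField φ w x := by
  simp [coordField]

theorem coordField_smul (φ : OpenPartialHomeomorph X (Cn n)) (c : ℝ) (v : Cn n) (x : X) :
    coordField φ (c • v) x = c • coordField φ v x := by
  simp [coordField]

theorem coordField_eq_zero (hφ : φ ∈ IsManifold.maximalAtlas 𝓘(ℂ, Cn n) ω X) {x : X}
    (hx : x ∈ φ.source) {v : Cn n} (h : coordField φ v x = 0) : v = 0 := by
  have h2 := (chart_mdifferentiable hφ).comp_symm_deriv (φ.map_source hx)
  have h3 := DFunLike.congr_fun h2 v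
  rw [coordField_eq hφ hx] at h
  refine Eq.trans h3.symm ?_
  exact (congrArg (mfderiv 𝓘(ℝ, Cn n) 𝓘(ℝ, Cn n) φ (φ.symm (φ x))) h).trans (map_zero _)

/-- The inverse of a holomorphic chart has a complex linear derivative, so it intertwines the two
multiplications by `i`. This is how the complex structure enters the coordinate computations. -/
theorem coordField_I (hφ : φ ∈ IsManifold.maximalAtlas 𝓘(ℂ, Cn n) ω X) {x : X}
    (hx : x ∈ φ.source) (v : Cn n) :
    coordField φ (Complex.I • v) x = tangentJ x (coordField φ v x) := by
  have h1 : MDifferentiableAt 𝓘(ℂ, Cn n) 𝓘(ℂ, Cn n) φ.symm (φ x) :=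
    ((contMDiffOn_symm_of_mem_maximalAtlas hφ).contMDiffAt
      (φ.open_target.mem_nhds (φ.map_source hx))).mdifferentiableAt (by simp)
  have h2 := h1.hasMFDerivAt
  have h3 : HasMFDerivAt 𝓘(ℝ, Cn n) 𝓘(ℝ, Cn n) φ.symm (φ x)
      ((show Cn n →L[ℂ] Cn n from mfderiv 𝓘(ℂ, Cn n) 𝓘(ℂ, Cn n) φ.symm (φ x)).restrictScalars ℝ) :=
    ⟨h2.1, h2.2.restrictScalars ℝ⟩
  rw [coordField_eq hφ hx, coordField_eq hφ hx, h3.mfderiv]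
  exact (show Cn n →L[ℂ] Cn n from mfderiv 𝓘(ℂ, Cn n) 𝓘(ℂ, Cn n) φ.symm (φ x)).map_smul Complex.I v

theorem contMDiffOn_coordField (hφ : φ ∈ IsManifold.maximalAtlas 𝓘(ℂ, Cn n) ω X) (v : Cn n) :
    ContMDiffOn 𝓘(ℝ, Cn n) 𝓘(ℝ, Cn n).tangent ∞
      (fun y => (⟨y, coordField φ v y⟩ : TangentBundle 𝓘(ℝ, Cn n) X)) φ.source := by
  intro x hx
  have hi : (mfderiv 𝓘(ℝ, Cn n) 𝓘(ℝ, Cn n) φ x).IsInvertible :=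
    ⟨(chart_mdifferentiable hφ).mfderiv hx, rfl⟩
  have h := ContMDiffAt.mpullback_vectorField_preimage (I := 𝓘(ℝ, Cn n)) (I' := 𝓘(ℝ, Cn n))
    (m := ∞) (n := ∞) (f := φ) (x₀ := x)
    (V := fun y => (NormedSpace.fromTangentSpace y).symm v) ?_
    ((contMDiffOn_of_mem_maximalAtlas (mem_real_maximalAtlas hφ)).contMDiffAt
      (φ.open_source.mem_nhds hx)) hi (by simp)
  · exact h.contMDiffWithinAt
  · rw [contMDiffAt_section]
    simpa using! contMDiffAt_const

theorem dirDeriv_coordField {M : Type*} [NormedAddCommGroup M] [NormedSpace ℝ M]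
    (hφ : φ ∈ IsManifold.maximalAtlas 𝓘(ℂ, Cn n) ω X) {x : X} (hx : x ∈ φ.source)
    {f : X → M} (hf : MDifferentiableAt 𝓘(ℝ, Cn n) 𝓘(ℝ, M) f x) (v : Cn n) :
    dirDeriv f x (coordField φ v x) = fderiv ℝ (f ∘ φ.symm) (φ x) v := by
  have hx' : φ.symm (φ x) = x := φ.left_inv hx
  have h1 : MDifferentiableAt 𝓘(ℝ, Cn n) 𝓘(ℝ, Cn n) φ.symm (φ x) :=
    (chart_mdifferentiable hφ).mdifferentiableAt_symm (φ.map_source hx)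
  have h2 : mfderiv 𝓘(ℝ, Cn n) 𝓘(ℝ, M) (f ∘ φ.symm) (φ x) v =
      mfderiv 𝓘(ℝ, Cn n) 𝓘(ℝ, M) f x (mfderiv 𝓘(ℝ, Cn n) 𝓘(ℝ, Cn n) φ.symm (φ x) v) := by
    rw [mfderiv_comp (φ x) (by rw [hx']; exact hf) h1, hx']
    rfl
  rw [coordField_eq hφ hx, ← mfderiv_eq_fderiv]
  exact h2.symm

theorem contDiffOn_comp_symm {M : Type*} [NormedAddCommGroup M] [NormedSpace ℝ M]
    (hφ : φ ∈ IsManifold.maximalAtlas 𝓘(ℂ, Cn n) ω X) {W : Set X}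
    {f : X → M} (hf : ContMDiffOn 𝓘(ℝ, Cn n) 𝓘(ℝ, M) ∞ f W) :
    ContDiffOn ℝ ∞ (f ∘ φ.symm) (φ.target ∩ φ.symm ⁻¹' W) := by
  rw [← contMDiffOn_iff_contDiffOn]
  exact hf.comp ((contMDiffOn_symm_of_mem_maximalAtlas (mem_real_maximalAtlas hφ)).mono
    Set.inter_subset_left) fun y hy => hy.2

end Chart

/-! ### Contraction with the inverse of a Gram matrix -/

section GramContraction

set_option linter.unusedSectionVars false

variable {ι : Type*} [Fintype ι] [DecidableEq ι] {M : Type*} [AddCommGroup M] [Module ℝ M]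
  {V : Type*} [AddCommGroup V] [Module ℝ V]

/-- A change of basis turns the Gram matrix into `P G Pᵀ`, and `G⁻¹ = Pᵀ (P G Pᵀ)⁻¹ P` compensates
the two factors of `P` in the tensor. -/
theorem sum_inv_congruence (G P : Matrix ι ι ℝ) (hP : IsUnit P.det) (T : ι → ι → M) :
    ∑ i, ∑ j, (P * G * P.transpose)⁻¹ i j • ∑ k, ∑ l, (P i k * P j l) • T k l =
      ∑ k, ∑ l, G⁻¹ k l • T k l := by
  have h : G⁻¹ = P.transpose * (P * G * P.transpose)⁻¹ * P := by
    have hPt : IsUnit P.transpose.det := by rwa [Matrix.det_transpose]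
    rw [Matrix.mul_inv_rev, Matrix.mul_inv_rev, ← Matrix.mul_assoc, Matrix.mul_nonsing_inv _ hPt,
      Matrix.one_mul, Matrix.mul_assoc, Matrix.nonsing_inv_mul _ hP, Matrix.mul_one]
  conv_rhs => rw [h]
  simp only [Matrix.mul_apply (M := P.transpose * _), Matrix.mul_apply (M := P.transpose),
    Matrix.transpose_apply, Finset.sum_smul, Finset.smul_sum, Finset.sum_mul]
  have e1 : ∀ (f : ι → ι → ι → ι → M), ∑ i, ∑ j, ∑ k, ∑ l, f i j k l =
      ∑ k, ∑ l, ∑ j, ∑ i, f i j k l := fun f => by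
    rw [Finset.sum_comm]
    conv_lhs => enter [2, j]; rw [Finset.sum_comm]
    rw [Finset.sum_comm]
    refine Finset.sum_congr rfl fun k _ => ?_
    conv_lhs => enter [2, j]; rw [Finset.sum_comm]
    rw [Finset.sum_comm]
  rw [e1]
  refine Finset.sum_congr rfl fun k _ => Finset.sum_congr rfl fun l _ => Finset.sum_congr rfl
    fun j _ => Finset.sum_congr rfl fun i _ => ?_
  rw [smul_smul]
  congr 1
  ring

/-- The contraction of a bilinear map with the inverse Gram matrix does not depend on the basis. -/
theorem gram_contraction_eq (B : V → V →ₗ[ℝ] ℝ) (hB : ∀ u w, B u w = B w u)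
    (T : V →ₗ[ℝ] V →ₗ[ℝ] M) (b b' : Module.Basis ι ℝ V) :
    ∑ i, ∑ j, (Matrix.of fun i j => B (b' i) (b' j))⁻¹ i j • T (b' i) (b' j) =
      ∑ i, ∑ j, (Matrix.of fun i j => B (b i) (b j))⁻¹ i j • T (b i) (b j) := by
  set P : Matrix ι ι ℝ := Matrix.of fun i k => b.repr (b' i) k with hPdef
  have hP : IsUnit P.det := by
    have h1 : P = (b.toMatrix b').transpose := by
      ext i k
      simp [hPdef, Module.Basis.toMatrix_apply]
    have : Invertible (b.toMatrix b') := b.invertibleToMatrix b'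
    rw [h1, Matrix.det_transpose]
    exact Matrix.isUnit_det_of_invertible _
  have hb : ∀ i, b' i = ∑ k, P i k • b k := fun i => (b.sum_repr (b' i)).symm
  rw [← sum_inv_congruence (Matrix.of fun i j => B (b i) (b j)) P hP]
  refine Finset.sum_congr rfl fun i _ => Finset.sum_congr rfl fun j _ => ?_
  congr 1
  · suffices hG : Matrix.of (fun i j => B (b' i) (b' j)) =
        P * Matrix.of (fun i j => B (b i) (b j)) * P.transpose by rw [hG]
    refine Matrix.ext fun i j => ?_
    rw [Matrix.of_apply, hb j, map_sum, Matrix.mul_apply]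
    refine Finset.sum_congr rfl fun k _ => ?_
    rw [map_smul, hB, hb i, map_sum, Matrix.mul_apply, smul_eq_mul, mul_comm]
    congr 1
    refine Finset.sum_congr rfl fun l _ => ?_
    rw [map_smul, smul_eq_mul, hB, Matrix.of_apply]
  · rw [hb i, hb j]
    simp only [map_sum, map_smul, LinearMap.sum_apply, LinearMap.smul_apply, Finset.smul_sum,
      smul_smul]
    rw [Finset.sum_comm]
    refine Finset.sum_congr rfl fun k _ => Finset.sum_congr rfl fun l _ => ?_
    rw [mul_comm]

end GramContraction

/-! ### Smoothness and derivatives of matrix-valued functions, entry by entry. -/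

section MatrixSmooth

set_option linter.unusedSectionVars false

attribute [local instance] Matrix.frobeniusNormedRing Matrix.frobeniusNormedAlgebra

variable {𝕂 : Type*} [RCLike 𝕂] {m : Type*} [Fintype m] [DecidableEq m]
  {E : Type*} [NormedAddCommGroup E] [NormedSpace ℝ E] {f : E → Matrix m m 𝕂} {s : Set E}

/-- The entries of a matrix as continuous linear maps. -/
def entryL (𝕂 : Type*) [RCLike 𝕂] {m : Type*} [Fintype m] [DecidableEq m] (i j : m) :
    Matrix m m 𝕂 →L[ℝ] 𝕂 :=
  LinearMap.toContinuousLinearMap (Matrix.entryLinearMap ℝ 𝕂 i j)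

theorem ContDiffOn.matrix_apply (hf : ContDiffOn ℝ ∞ f s) (i j : m) :
    ContDiffOn ℝ ∞ (fun x => f x i j) s :=
  (entryL 𝕂 i j).contDiff.comp_contDiffOn hf

/-- The elementary matrices as continuous linear maps. -/
def singleL (𝕂 : Type*) [RCLike 𝕂] {m : Type*} [Fintype m] [DecidableEq m] (i j : m) :
    𝕂 →L[ℝ] Matrix m m 𝕂 :=
  LinearMap.toContinuousLinearMap (Matrix.singleLinearMap ℝ i j)

theorem sum_singleL (A : Matrix m m 𝕂) : A = ∑ i, ∑ j, singleL 𝕂 i j (A i j) :=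
  A.matrix_eq_sum_single

theorem contDiffOn_matrix (hf : ∀ i j, ContDiffOn ℝ ∞ (fun x => f x i j) s) :
    ContDiffOn ℝ ∞ f s := by
  have h : f = fun x => ∑ i, ∑ j, singleL 𝕂 i j (f x i j) := funext fun x => sum_singleL (f x)
  rw [h]
  exact ContDiffOn.sum fun i _ => ContDiffOn.sum fun j _ =>
    (singleL 𝕂 i j).contDiff.comp_contDiffOn (hf i j)

theorem fderiv_matrix_apply {x : E} (hf : DifferentiableAt ℝ f x) (v : E) (i j : m) :
    fderiv ℝ f x v i j = fderiv ℝ (fun y => f y i j) x v := by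
  have h := ((entryL 𝕂 i j).hasFDerivAt.comp x hf.hasFDerivAt).fderiv
  exact (DFunLike.congr_fun h v).symm

end MatrixSmooth

/-! ### The Kähler metric in a holomorphic chart -/

section KahlerChart

attribute [local instance] Matrix.frobeniusNormedRing Matrix.frobeniusNormedAlgebra

set_option linter.unusedSectionVars false

variable {n : ℕ} {X : Type*} [TopologicalSpace X] [ChartedSpace (Cn n) X]
  [IsManifold 𝓘(ℂ, Cn n) ω X] {φ : OpenPartialHomeomorph X (Cn n)}

/-- The coordinate vector fields of a chart at a point, as a linear equivalence. -/
def coordEquiv (hφ : φ ∈ IsManifold.maximalAtlas 𝓘(ℂ, Cn n) ω X) {x : X} (hx : x ∈ φ.source) :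
    Cn n ≃ₗ[ℝ] TangentSpace 𝓘(ℝ, Cn n) x :=
  haveI : FiniteDimensional ℝ (Cn n) := Module.Finite.of_basis (realBasis n)
  LinearEquiv.ofInjectiveEndo (V := Cn n)
    { toFun := fun v => coordField φ v x
      map_add' := fun v w => coordField_add φ v w x
      map_smul' := fun c v => coordField_smul φ c v x }
    ((injective_iff_map_eq_zero _).mpr fun _ h => coordField_eq_zero hφ hx h)

theorem coordEquiv_apply (hφ : φ ∈ IsManifold.maximalAtlas 𝓘(ℂ, Cn n) ω X) {x : X}
    (hx : x ∈ φ.source) (v : Cn n) : coordEquiv hφ hx v = coordField φ v x := by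
  have : FiniteDimensional ℝ (Cn n) := Module.Finite.of_basis (realBasis n)
  rfl

namespace KahlerMetric

variable (κ : KahlerMetric n X)

/-- The metric at `x` in the coordinates of the chart `φ`. -/
def coordForm (φ : OpenPartialHomeomorph X (Cn n)) (x : X) (v : Cn n) : Cn n →ₗ[ℝ] ℝ where
  toFun w := κ.g.inner x (coordField φ v x) (coordField φ w x)
  map_add' w w' := by rw [coordField_add, map_add]
  map_smul' c w := by rw [coordField_smul, map_smul]; rfl

theorem coordForm_symm (φ : OpenPartialHomeomorph X (Cn n)) (x : X) (v w : Cn n) :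
    κ.coordForm φ x v w = κ.coordForm φ x w v := κ.g.symm x _ _

theorem coordForm_I (hφ : φ ∈ IsManifold.maximalAtlas 𝓘(ℂ, Cn n) ω X) {x : X}
    (hx : x ∈ φ.source) (v w : Cn n) :
    κ.coordForm φ x (Complex.I • v) (Complex.I • w) = κ.coordForm φ x v w := by
  change κ.g.inner x (coordField φ _ x) (coordField φ _ x) = _
  rw [coordField_I hφ hx, coordField_I hφ hx, κ.invariant]
  rfl

theorem coordForm_pos (hφ : φ ∈ IsManifold.maximalAtlas 𝓘(ℂ, Cn n) ω X) {x : X}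
    (hx : x ∈ φ.source) {v : Cn n} (hv : v ≠ 0) : 0 < κ.coordForm φ x v v :=
  κ.g.pos x _ fun h => hv (coordField_eq_zero hφ hx h)

/-- The Gram matrix `g_{ab}` of the metric in the real coordinates of the chart `φ`. -/
def gram (φ : OpenPartialHomeomorph X (Cn n)) (x : X) :
    Matrix (Fin 2 × Fin n) (Fin 2 × Fin n) ℝ :=
  Matrix.of fun a b => κ.coordForm φ x (realBasis n a) (realBasis n b)

theorem gram_posDef (hφ : φ ∈ IsManifold.maximalAtlas 𝓘(ℂ, Cn n) ω X) {x : X}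
    (hx : x ∈ φ.source) : (κ.gram φ x).PosDef := by
  refine Matrix.PosDef.of_dotProduct_mulVec_pos ?_ fun c hc => ?_
  · ext a b
    simp only [gram, Matrix.conjTranspose_apply, Matrix.of_apply, star_trivial]
    exact κ.coordForm_symm φ x _ _
  · have hv : ∑ a, c a • realBasis n a ≠ 0 := fun h =>
      hc (funext fun a => Fintype.linearIndependent_iff.mp (realBasis n).linearIndependent c h a)
    refine (κ.coordForm_pos hφ hx hv).trans_eq ?_
    rw [map_sum]
    simp only [dotProduct, Matrix.mulVec, star_trivial, gram, Matrix.of_apply, Finset.mul_sum]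
    rw [Finset.sum_comm]
    refine Finset.sum_congr rfl fun a _ => ?_
    rw [map_smul, coordForm_symm, map_sum, smul_eq_mul, Finset.mul_sum]
    refine Finset.sum_congr rfl fun b _ => ?_
    rw [map_smul, coordForm_symm, smul_eq_mul]
    ring

theorem inv_posDef (hφ : φ ∈ IsManifold.maximalAtlas 𝓘(ℂ, Cn n) ω X) {x : X}
    (hx : x ∈ φ.source) : (κ.inv φ x).PosDef := (κ.gram_posDef hφ hx).inv

theorem inv_symm (hφ : φ ∈ IsManifold.maximalAtlas 𝓘(ℂ, Cn n) ω X) {x : X}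
    (hx : x ∈ φ.source) (a b : Fin 2 × Fin n) : κ.inv φ x a b = κ.inv φ x b a := by
  have := (κ.inv_posDef hφ hx).1.apply b a
  simpa using this

theorem contMDiffOn_coordForm (hφ : φ ∈ IsManifold.maximalAtlas 𝓘(ℂ, Cn n) ω X) (v w : Cn n) :
    ContMDiffOn 𝓘(ℝ, Cn n) 𝓘(ℝ, ℝ) ∞ (fun x => κ.coordForm φ x v w) φ.source := by
  have h := ContMDiffOn.clm_bundle_apply₂ (s := φ.source) κ.g.contMDiff.contMDiffOn
    (contMDiffOn_coordField hφ v) (contMDiffOn_coordField hφ w)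
  exact fun x hx => (contMDiffWithinAt_section (E := fun _ : X => ℝ)).mp (h x hx)

theorem contDiffOn_inv (hφ : φ ∈ IsManifold.maximalAtlas 𝓘(ℂ, Cn n) ω X) (a b : Fin 2 × Fin n) :
    ContDiffOn ℝ ∞ (fun y => κ.inv φ (φ.symm y) a b) φ.target := by
  have h1 : ContDiffOn ℝ ∞ (fun y => κ.gram φ (φ.symm y)) φ.target := by
    refine contDiffOn_matrix fun a b => ?_
    have := contDiffOn_comp_symm hφ (κ.contMDiffOn_coordForm hφ (realBasis n a) (realBasis n b))
    exact this.mono fun y hy => ⟨hy, φ.map_target hy⟩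
  have h2 : ContDiffOn ℝ ∞ (fun y => (κ.gram φ (φ.symm y))⁻¹) φ.target := by
    intro y hy
    have h : IsUnit (κ.gram φ (φ.symm y)) := (κ.gram_posDef hφ (φ.map_target hy)).isUnit
    have h1' : ContDiffAt ℝ ∞ Ring.inverse (κ.gram φ (φ.symm y)) := contDiffAt_ringInverse ℝ h.unit
    simpa only [Matrix.nonsing_inv_eq_ringInverse] using! h1'.comp_contDiffWithinAt y (h1 y hy)
  exact h2.matrix_apply a b

variable {M : Type*} [AddCommGroup M] [Module ℝ M]

/-- The contraction `g^{ab} T_{ab}` is invariant under the complex structure. -/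
theorem sum_inv_I (hφ : φ ∈ IsManifold.maximalAtlas 𝓘(ℂ, Cn n) ω X) {x : X}
    (hx : x ∈ φ.source) (T : Cn n →ₗ[ℝ] Cn n →ₗ[ℝ] M) :
    ∑ a, ∑ b, κ.inv φ x a b • T (Complex.I • realBasis n a) (Complex.I • realBasis n b) =
      ∑ a, ∑ b, κ.inv φ x a b • T (realBasis n a) (realBasis n b) := by
  let J : Cn n ≃ₗ[ℝ] Cn n :=
    (LinearEquiv.smulOfNeZero ℂ (Cn n) Complex.I Complex.I_ne_zero).restrictScalars ℝ
  -- Multiplication by `i` is an isometry of the metric, so the basis `i e_a` has the same Gram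
  -- matrix as `e_a`.
  have h := gram_contraction_eq (κ.coordForm φ x) (κ.coordForm_symm φ x) T (realBasis n)
    ((realBasis n).map J)
  have hJ : ∀ a, (realBasis n).map J a = Complex.I • realBasis n a := fun a => rfl
  simp only [hJ, κ.coordForm_I hφ hx] at h
  exact h

/-- The contraction `g^{ab} T(∂_a, ∂_b)` does not depend on the chart. -/
theorem sum_inv_chart (hφ : φ ∈ IsManifold.maximalAtlas 𝓘(ℂ, Cn n) ω X) {x : X}
    (hx : x ∈ φ.source) {φ' : OpenPartialHomeomorph X (Cn n)}
    (hφ' : φ' ∈ IsManifold.maximalAtlas 𝓘(ℂ, Cn n) ω X) (hx' : x ∈ φ'.source)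
    (T : TangentSpace 𝓘(ℝ, Cn n) x →ₗ[ℝ] TangentSpace 𝓘(ℝ, Cn n) x →ₗ[ℝ] M) :
    ∑ a, ∑ b, κ.inv φ' x a b •
        T (coordField φ' (realBasis n a) x) (coordField φ' (realBasis n b) x) =
      ∑ a, ∑ b, κ.inv φ x a b •
        T (coordField φ (realBasis n a) x) (coordField φ (realBasis n b) x) := by
  have h := gram_contraction_eq (fun u => (κ.g.inner x u).toLinearMap) (fun u w => κ.g.symm x u w) T
    ((realBasis n).map (coordEquiv hφ hx)) ((realBasis n).map (coordEquiv hφ' hx'))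
  simp only [Module.Basis.map_apply, coordEquiv_apply] at h
  exact h

end KahlerMetric

end KahlerChart

/-! ### Connections in local frames -/

section Frame

set_option linter.unusedSectionVars false

open scoped Matrix

attribute [local instance] Matrix.frobeniusNormedRing Matrix.frobeniusNormedAlgebra
  normedStarGroup_matrix

variable {n r : ℕ} {X : Type*} [TopologicalSpace X] [ChartedSpace (Cn n) X]
  [IsManifold 𝓘(ℂ, Cn n) ω X]
  {V : X → Type*} [TopologicalSpace (TotalSpace (Fin r → ℂ) V)]
  [∀ x, AddCommGroup (V x)] [∀ x, Module ℂ (V x)] [∀ x, TopologicalSpace (V x)]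
  [∀ x, IsTopologicalAddGroup (V x)] [∀ x, ContinuousSMul ℝ (V x)]
  [FiberBundle (Fin r → ℂ) V] [VectorBundle ℝ (Fin r → ℂ) V] [VectorBundle ℂ (Fin r → ℂ) V]
  [ContMDiffVectorBundle ∞ (Fin r → ℂ) V 𝓘(ℝ, Cn n)]

/-- Global smooth sections `σ j` which form the frame of the trivialization `e` on the open
subset `W` of the domain of the holomorphic chart `φ`. -/
structure IsFrameOn (φ : OpenPartialHomeomorph X (Cn n))
    (e : Trivialization (Fin r → ℂ) (π (Fin r → ℂ) V)) (σ : Fin r → Π x, V x) (W : Set X) :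
    Prop where
  mem : φ ∈ IsManifold.maximalAtlas 𝓘(ℂ, Cn n) ω X
  open_W : IsOpen W
  sub_source : W ⊆ φ.source
  sub_base : W ⊆ e.baseSet
  smooth : ∀ j, ContMDiff 𝓘(ℝ, Cn n) (𝓘(ℝ, Cn n).prod 𝓘(ℝ, Fin r → ℂ)) ∞
    (fun y => TotalSpace.mk' (Fin r → ℂ) y (σ j y))
  eq : ∀ x ∈ W, ∀ j, σ j x = e.symm x (Pi.single j 1)

variable (n) in
theorem contMDiffOn_symm_const (e : Trivialization (Fin r → ℂ) (π (Fin r → ℂ) V))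
    [MemTrivializationAtlas e] (c : Fin r → ℂ) :
    ContMDiffOn 𝓘(ℝ, Cn n) (𝓘(ℝ, Cn n).prod 𝓘(ℝ, Fin r → ℂ)) ∞
      (fun y => TotalSpace.mk' (Fin r → ℂ) y (e.symm y c)) e.baseSet := by
  rw [Bundle.Trivialization.contMDiffOn_section_baseSet_iff]
  refine (contMDiffOn_const (c := c)).congr fun y hy => ?_
  rw [e.apply_mk_symm hy]

/-- Connections act on global sections, so the frame of the trivialization is multiplied by a bump
function. On the smaller set `W`, where the bump function equals `1`, the frame is unchanged. -/
theorem exists_isFrameOn [T2Space X] (x₀ : X) : ∃ (σ : Fin r → Π x, V x) (W : Set X), x₀ ∈ W ∧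
    IsFrameOn (chartAt (Cn n) x₀) (trivializationAt (Fin r → ℂ) V x₀) σ W := by
  have : FiniteDimensional ℝ (Cn n) := Module.Finite.of_basis (realBasis n)
  set e := trivializationAt (Fin r → ℂ) V x₀
  have hx₀ : x₀ ∈ e.baseSet := FiberBundle.mem_baseSet_trivializationAt' x₀
  obtain ⟨f, -, hf⟩ := (SmoothBumpFunction.nhds_basis_tsupport (I := 𝓘(ℝ, Cn n)) x₀).mem_iff.mp
    (e.open_baseSet.mem_nhds hx₀)
  obtain ⟨W', hW', hW'o, hx'⟩ := mem_nhds_iff.mp f.eventuallyEq_one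
  refine ⟨fun j => (f : X → ℝ) • fun y => e.symm y (Pi.single j 1),
    W' ∩ ((chartAt (Cn n) x₀).source ∩ e.baseSet), ⟨hx', mem_chart_source _ _, hx₀⟩, ?_⟩
  refine ⟨IsManifold.chart_mem_maximalAtlas x₀, hW'o.inter ((chartAt (Cn n) x₀).open_source.inter
    e.open_baseSet), fun x hx => hx.2.1, fun x hx => hx.2.2, fun j => ?_, fun x hx j => ?_⟩
  · exact ContMDiffOn.smul_section_of_tsupport f.contMDiff.contMDiffOn e.open_baseSet hf
      (contMDiffOn_symm_const n e _)
  · have : f x = 1 := hW' hx.1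
    simp [this]

/-- The section with components `s`, in the frame of `e` and the coordinates of `φ`. -/
def frameSection (φ : OpenPartialHomeomorph X (Cn n))
    (e : Trivialization (Fin r → ℂ) (π (Fin r → ℂ) V)) (s : Cn n → Fin r → ℂ) (x : X) : V x :=
  e.symm x (s (φ x))

/-- The connection form in the direction `v` at the point with coordinates `y`. -/
def connForm (D : ComplexConnection n r V) (φ : OpenPartialHomeomorph X (Cn n))
    (e : Trivialization (Fin r → ℂ) (π (Fin r → ℂ) V)) (σ : Fin r → Π x, V x) (v : Cn n)
    (y : Cn n) : Matrix (Fin r) (Fin r) ℂ :=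
  Matrix.of fun i j =>
    (e ⟨φ.symm y, D.toFun (σ j) (φ.symm y) (coordField φ v (φ.symm y))⟩).2 i

theorem connForm_smul (D : ComplexConnection n r V) (φ : OpenPartialHomeomorph X (Cn n))
    (e : Trivialization (Fin r → ℂ) (π (Fin r → ℂ) V)) [MemTrivializationAtlas e]
    (σ : Fin r → Π x, V x) (c : ℝ) (v y : Cn n) (hy : φ.symm y ∈ e.baseSet) :
    connForm D φ e σ (c • v) y = c • connForm D φ e σ v y := by
  ext i j
  simp only [connForm, Matrix.of_apply, Matrix.smul_apply, coordField_smul, map_smul]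
  rw [(e.linear ℝ hy).map_smul]
  rfl

theorem connForm_add (D : ComplexConnection n r V) (φ : OpenPartialHomeomorph X (Cn n))
    (e : Trivialization (Fin r → ℂ) (π (Fin r → ℂ) V)) [MemTrivializationAtlas e]
    (σ : Fin r → Π x, V x) (v w y : Cn n) (hy : φ.symm y ∈ e.baseSet) :
    connForm D φ e σ (v + w) y = connForm D φ e σ v y + connForm D φ e σ w y := by
  ext i j
  simp only [connForm, Matrix.of_apply, Matrix.add_apply, coordField_add, map_add]
  rw [(e.linear ℝ hy).map_add]
  rfl

namespace ComplexConnection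

theorem cov_sum (D : ComplexConnection n r V) {ι : Type*} (t : Finset ι) (τ : ι → Π x, V x) {x : X}
    (hτ : ∀ i ∈ t, DiffSectionAt n r (τ i) x) :
    D.toFun (∑ i ∈ t, τ i) x = ∑ i ∈ t, D.toFun (τ i) x := by
  have : ContMDiffVectorBundle 1 (Fin r → ℂ) V 𝓘(ℝ, Cn n) :=
    ContMDiffVectorBundle.of_le (n := ∞) (by simp)
  classical
  induction t using Finset.induction_on with
  | empty => simp [D.isCovariantDerivativeOnUniv.zero]
  | insert a t ha ih =>
    rw [Finset.sum_insert ha, Finset.sum_insert ha]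
    have h2 : DiffSectionAt n r (∑ i ∈ t, τ i) x := by
      have := MDifferentiableAt.sum_section (s := t) (I := 𝓘(ℝ, Cn n)) (F := Fin r → ℂ) (t := τ)
        (x₀ := x) fun i hi => hτ i (Finset.mem_insert_of_mem hi)
      have e1 : (fun y => ∑ i ∈ t, τ i y) = ∑ i ∈ t, τ i := by
        funext y
        rw [Finset.sum_apply]
      exact e1 ▸ this
    rw [D.isCovariantDerivativeOnUniv.add (hτ a (Finset.mem_insert_self a t)) h2,
      ih fun i hi => hτ i (Finset.mem_insert_of_mem hi)]

/-- The Leibniz rule for complex functions. -/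
theorem diff_smul {f : X → ℂ} {σ : Π x, V x} {x : X}
    (hf : MDifferentiableAt 𝓘(ℝ, Cn n) 𝓘(ℝ, ℂ) f x) (hσ : DiffSectionAt n r σ x) :
    DiffSectionAt n r (fun y => f y • σ y) x ∧ ∀ (D : ComplexConnection n r V)
      (v : TangentSpace 𝓘(ℝ, Cn n) x),
      D.toFun (fun y => f y • σ y) x v = f x • D.toFun σ x v + dirDeriv f x v • σ x := by
  have : ContMDiffVectorBundle 1 (Fin r → ℂ) V 𝓘(ℝ, Cn n) :=
    ContMDiffVectorBundle.of_le (n := ∞) (by simp)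
  have hc : ∀ L : ℂ →L[ℝ] ℝ, MDifferentiableAt 𝓘(ℝ, Cn n) 𝓘(ℝ, ℝ) (fun y => L (f y)) x ∧
      ∀ v, mvfderiv 𝓘(ℝ, Cn n) (fun y => L (f y)) x v = L (dirDeriv f x v) := fun L =>
    ⟨(L.hasMFDerivAt (x := f x)).mdifferentiableAt.comp x hf, fun v => by
      have h := ((L.hasMFDerivAt (x := f x)).comp x hf.hasMFDerivAt).mfderiv
      exact DFunLike.congr_fun h v⟩
  have hre := hc Complex.reCLM
  have him := hc Complex.imCLM
  have hI := diffSectionAt_I_smul hσ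
  have e1 : (fun y => f y • σ y) = ((fun y => Complex.reCLM (f y)) • σ) +
      ((fun y => Complex.imCLM (f y)) • fun y => Complex.I • σ y) := by
    funext y
    simp only [Pi.add_apply, Pi.smul_apply', Complex.reCLM_apply, Complex.imCLM_apply]
    conv_lhs => rw [← Complex.re_add_im (f y)]
    rw [add_smul, mul_smul, Complex.coe_smul, Complex.coe_smul]
  have d1 : DiffSectionAt n r ((fun y => Complex.reCLM (f y)) • σ) x :=
    MDifferentiableAt.smul_section hre.1 hσ
  have d2 : DiffSectionAt n r ((fun y => Complex.imCLM (f y)) • fun y => Complex.I • σ y) x :=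
    MDifferentiableAt.smul_section him.1 hI
  refine ⟨?_, fun D v => ?_⟩
  · rw [e1]
    exact mdifferentiableAt_add_section d1 d2
  · rw [e1, D.isCovariantDerivativeOnUniv.add d1 d2,
      D.isCovariantDerivativeOnUniv.leibniz hσ hre.1,
      D.isCovariantDerivativeOnUniv.leibniz hI him.1]
    simp only [add_apply, smul_apply, ContinuousLinearMap.smulRight_apply, hre.2, him.2,
      D.map_I_smul σ x hσ]
    conv_rhs => rw [← Complex.re_add_im (f x), ← Complex.re_add_im (dirDeriv f x v)]
    simp only [add_smul, mul_smul, Complex.coe_smul, Complex.reCLM_apply, Complex.imCLM_apply]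
    module

end ComplexConnection

namespace IsFrameOn

variable {φ : OpenPartialHomeomorph X (Cn n)} {e : Trivialization (Fin r → ℂ) (π (Fin r → ℂ) V)}
  [MemTrivializationAtlas e] {σ : Fin r → Π x, V x} {W : Set X}

theorem open_image (h : IsFrameOn φ e σ W) : IsOpen (φ.target ∩ φ.symm ⁻¹' W) :=
  φ.isOpen_inter_preimage_symm h.open_W

theorem map_mem (h : IsFrameOn φ e σ W) {x : X} (hx : x ∈ W) : φ x ∈ φ.target ∩ φ.symm ⁻¹' W :=
  ⟨φ.map_source (h.sub_source hx), by
    rw [Set.mem_preimage, φ.left_inv (h.sub_source hx)]; exact hx⟩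

theorem diff (h : IsFrameOn φ e σ W) (j : Fin r) (x : X) : DiffSectionAt n r (σ j) x :=
  ((h.smooth j).contMDiffAt (x := x)).mdifferentiableAt (by simp)

theorem smoothAt (h : IsFrameOn φ e σ W) (j : Fin r) (x : X) : SmoothSectionAt n r (σ j) x :=
  (h.smooth j).contMDiffAt

theorem mdifferentiableAt_comp {M : Type*} [NormedAddCommGroup M] [NormedSpace ℝ M]
    (h : IsFrameOn φ e σ W) {f : Cn n → M} {x : X} (hx : x ∈ W) (hf : DifferentiableAt ℝ f (φ x)) :
    MDifferentiableAt 𝓘(ℝ, Cn n) 𝓘(ℝ, M) (fun y => f (φ y)) x :=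
  hf.mdifferentiableAt.comp x ((chart_mdifferentiable h.mem).mdifferentiableAt (h.sub_source hx))

theorem dirDeriv_comp {M : Type*} [NormedAddCommGroup M] [NormedSpace ℝ M]
    (h : IsFrameOn φ e σ W) {f : Cn n → M} {x : X} (hx : x ∈ W) (hf : DifferentiableAt ℝ f (φ x))
    (v : Cn n) : dirDeriv (fun y => f (φ y)) x (coordField φ v x) = fderiv ℝ f (φ x) v := by
  rw [dirDeriv_coordField h.mem (h.sub_source hx) (h.mdifferentiableAt_comp hx hf)]
  have : (fun y => f (φ y)) ∘ φ.symm =ᶠ[𝓝 (φ x)] f :=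
    Filter.eventuallyEq_of_mem (φ.open_target.mem_nhds (φ.map_source (h.sub_source hx)))
      fun y hy => by simp [φ.right_inv hy]
  rw [this.fderiv_eq]

theorem frameSection_eq (h : IsFrameOn φ e σ W) (s : Cn n → Fin r → ℂ) {x : X} (hx : x ∈ W) :
    frameSection φ e s x = ∑ j, s (φ x) j • σ j x := by
  have h1 : s (φ x) = ∑ j, s (φ x) j • Pi.single j (1 : ℂ) := by
    ext i
    simp [Finset.sum_apply, Pi.single_apply]
  rw [frameSection]
  conv_lhs => rw [h1, ← e.symmₗ_apply (R := ℂ) (h.sub_base hx), map_sum]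
  refine Finset.sum_congr rfl fun j _ => ?_
  rw [map_smul, h.eq x hx j, e.symmₗ_apply (R := ℂ) (h.sub_base hx)]

theorem cov_frame (h : IsFrameOn φ e σ W) (D : ComplexConnection n r V) {x : X} (hx : x ∈ W)
    (j : Fin r) (v : Cn n) :
    D.toFun (σ j) x (coordField φ v x) = e.symm x (fun i => connForm D φ e σ v (φ x) i j) := by
  have key : ∀ x', x' = x → D.toFun (σ j) x (coordField φ v x) =
      e.symm x (fun i => (e ⟨x', D.toFun (σ j) x' (coordField φ v x')⟩).2 i) := by
    rintro x' rfl
    exact (e.symm_apply_apply_mk (h.sub_base hx) _).symm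
  exact key _ (φ.left_inv (h.sub_source hx))

/-- The covariant derivative in a local frame. -/
theorem cov (h : IsFrameOn φ e σ W) (D : ComplexConnection n r V) {x : X} (hx : x ∈ W)
    {s : Cn n → Fin r → ℂ} (hs : DifferentiableAt ℝ s (φ x)) {τ : Π x, V x}
    (hτ : ∀ y ∈ W, τ y = frameSection φ e s y) (v : Cn n) :
    DiffSectionAt n r τ x ∧ D.toFun τ x (coordField φ v x) =
      e.symm x (fderiv ℝ s (φ x) v + connForm D φ e σ v (φ x) *ᵥ s (φ x)) := by
  have : ContMDiffVectorBundle 1 (Fin r → ℂ) V 𝓘(ℝ, Cn n) :=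
    ContMDiffVectorBundle.of_le (n := ∞) (by simp)
  have hsj : ∀ j, DifferentiableAt ℝ (fun y => s y j) (φ x) := differentiableAt_pi.mp hs
  have hd := fun j => ComplexConnection.diff_smul (h.mdifferentiableAt_comp hx (hsj j)) (h.diff j x)
  set τ' : Π x, V x := ∑ j, fun y => s (φ y) j • σ j y with hτ'
  have h1 : DiffSectionAt n r τ' x := by
    have := MDifferentiableAt.sum_section (s := Finset.univ) (I := 𝓘(ℝ, Cn n)) (F := Fin r → ℂ)
      (t := fun j y => s (φ y) j • σ j y) (x₀ := x) fun j _ => (hd j).1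
    have e1 : (fun y => ∑ j, s (φ y) j • σ j y) = τ' := by
      funext y
      rw [hτ', Finset.sum_apply]
    exact e1 ▸ this
  have h2 : ∀ y ∈ W, τ y = τ' y := fun y hy => by
    rw [hτ y hy, h.frameSection_eq s hy, hτ', Finset.sum_apply]
  have h2' : ∀ᶠ y in 𝓝 x, τ y = τ' y := Filter.eventually_of_mem (h.open_W.mem_nhds hx) h2
  have h3 : DiffSectionAt n r τ x :=
    MDifferentiableAt.congr_of_eventuallyEq h1 (h2'.mono fun y hy => congrArg (TotalSpace.mk' (Fin r → ℂ) y) hy)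
  refine ⟨h3, ?_⟩
  rw [D.isCovariantDerivativeOnUniv.congr_of_eventuallyEq h3 h1 Filter.univ_mem h2', hτ',
    D.cov_sum _ _ fun j _ => (hd j).1, sum_apply]
  simp only [(hd _).2, h.cov_frame D hx, h.dirDeriv_comp hx (hsj _), h.eq x hx]
  have hL : ∀ c, e.symm x c = e.symmₗ ℂ x c := fun c => (e.symmₗ_apply (R := ℂ) (h.sub_base hx) c).symm
  simp only [hL, ← map_smul, ← map_add, ← map_sum]
  congr 1
  ext i
  rw [Finset.sum_apply]
  simp only [Pi.add_apply, Pi.smul_apply, Pi.single_apply, smul_eq_mul, mul_ite, mul_one, mul_zero,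
    Finset.sum_add_distrib, Finset.sum_ite_eq, Finset.mem_univ, if_true, Matrix.mulVec, dotProduct]
  rw [fderiv_apply hs, add_comm]
  congr 1
  exact Finset.sum_congr rfl fun j _ => mul_comm _ _

theorem contDiffOn_connForm (h : IsFrameOn φ e σ W) (D : ComplexConnection n r V) (v : Cn n) :
    ContDiffOn ℝ ∞ (connForm D φ e σ v) (φ.target ∩ φ.symm ⁻¹' W) := by
  refine contDiffOn_matrix fun i j => ?_
  have h1 := D.smooth.contMDiff.contMDiff (σ := σ j) ((h.smooth j).contMDiffOn.of_le (by simp))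
  have h2 := ContMDiffOn.clm_bundle_apply (h1.mono (Set.subset_univ W))
    ((contMDiffOn_coordField h.mem v).mono h.sub_source)
  have h3 := (e.contMDiffOn_section_iff h.open_W h.sub_base).mp h2
  exact contDiffOn_comp_symm h.mem (contMDiffOn_pi_space.mp h3 i)

end IsFrameOn

end Frame

/-! ### The pseudo-curvature in local coordinates -/

section LocalHiggs

open scoped Matrix

attribute [local instance] Matrix.frobeniusNormedRing Matrix.frobeniusNormedAlgebra
  normedStarGroup_matrix

variable {E : Type*} [NormedAddCommGroup E] [NormedSpace ℝ E] {r : ℕ}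

/-- A metric with Gram matrix `G`, a connection form `A` and the self-adjoint part `ψ`, in a local
frame on `U`. -/
structure LocalMetric (U : Set E) (G : E → Matrix (Fin r) (Fin r) ℂ)
    (A ψ : E → E → Matrix (Fin r) (Fin r) ℂ) : Prop where
  open_U : IsOpen U
  smooth_G : ContDiffOn ℝ ∞ G U
  smooth_A : ∀ v, ContDiffOn ℝ ∞ (A v) U
  smooth_psi : ∀ v, ContDiffOn ℝ ∞ (ψ v) U
  unit : ∀ y ∈ U, IsUnit (G y).det
  sa : ∀ v, ∀ y ∈ U, IsSaFor (G y) (ψ v y)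
  dG : ∀ v, ∀ y ∈ U, fderiv ℝ G y v = star (A v y) * G y + G y * A v y - 2 * (G y * ψ v y)
  A_add : ∀ v w, ∀ y ∈ U, A (v + w) y = A v y + A w y
  A_smul : ∀ (c : ℝ) v, ∀ y ∈ U, A (c • v) y = c • A v y
  psi_add : ∀ v w, ∀ y ∈ U, ψ (v + w) y = ψ v y + ψ w y
  psi_smul : ∀ (c : ℝ) v, ∀ y ∈ U, ψ (c • v) y = c • ψ v y

/-- The covariant derivative `∇_v ψ_w` for the connection form `A - ψ`. -/
def nablaPsi (A ψ : E → E → Matrix (Fin r) (Fin r) ℂ) (v w y : E) : Matrix (Fin r) (Fin r) ℂ :=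
  fderiv ℝ (ψ w) y v + ((A v y - ψ v y) * ψ w y - ψ w y * (A v y - ψ v y))

namespace LocalMetric

variable {U : Set E} {G : E → Matrix (Fin r) (Fin r) ℂ} {A ψ : E → E → Matrix (Fin r) (Fin r) ℂ}

theorem differentiableAt_psi (h : LocalMetric U G A ψ) (v : E) {y : E} (hy : y ∈ U) :
    DifferentiableAt ℝ (ψ v) y :=
  ((h.smooth_psi v).contDiffAt (h.open_U.mem_nhds hy)).differentiableAt (by simp)

theorem differentiableAt_A (h : LocalMetric U G A ψ) (v : E) {y : E} (hy : y ∈ U) :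
    DifferentiableAt ℝ (A v) y :=
  ((h.smooth_A v).contDiffAt (h.open_U.mem_nhds hy)).differentiableAt (by simp)

theorem d_G (h : LocalMetric U G A ψ) (v : E) :
    smoothAlg.deriv h.open_U v (smoothAlg.mk G h.smooth_G) =
      star ((fun v => smoothAlg.mk (A v) (h.smooth_A v)) v - smoothAlg.mk (ψ v) (h.smooth_psi v)) *
        smoothAlg.mk G h.smooth_G + smoothAlg.mk G h.smooth_G *
        (smoothAlg.mk (A v) (h.smooth_A v) - smoothAlg.mk (ψ v) (h.smooth_psi v)) := by
  refine smoothAlg.ext_ev fun q => ?_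
  simp only [smoothAlg.deriv_mk, map_add, map_sub, map_mul, smoothAlg.ev_star, smoothAlg.ev_mk,
    star_sub, sub_mul, mul_sub]
  have h1 := h.sa v q q.2
  rw [IsSaFor] at h1
  refine (h.dG v q q.2).trans ?_
  rw [h1]
  noncomm_ring

/-- `A - ψ` is unitary by `d_G`, and unitary derivatives preserve self-adjointness: apply
`IsSaFor.twist` in the ring of smooth functions on `U` and evaluate at `y`. -/
theorem nablaPsi_sa (h : LocalMetric U G A ψ) (v w : E) {y : E} (hy : y ∈ U) :
    IsSaFor (G y) (nablaPsi A ψ v w y) := by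
  have h1 := IsSaFor.twist (R := smoothAlg (Matrix (Fin r) (Fin r) ℂ) U)
    (d := fun v => smoothAlg.deriv h.open_U v)
    (B := (fun v => smoothAlg.mk (A v) (h.smooth_A v)) - fun v => smoothAlg.mk (ψ v) (h.smooth_psi v))
    (H := smoothAlg.mk G h.smooth_G) (fun a x y => smoothAlg.deriv_mul _ _ x y)
    (fun a x => smoothAlg.deriv_star _ _ x) (fun v => h.d_G v)
    (x := smoothAlg.mk (ψ w) (h.smooth_psi w)) (smoothAlg.ext_ev fun q => h.sa w q q.2) v
  have h2 := congrArg (smoothAlg.ev ⟨y, hy⟩) h1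
  simp only [twist, map_add, map_sub, map_mul, smoothAlg.ev_star, smoothAlg.deriv_mk,
    smoothAlg.ev_mk, Pi.sub_apply] at h2
  exact h2

/-- The curvature is the sum of a skew-adjoint part and of `dψ`. -/
theorem curv_sub_skew (h : LocalMetric U G A ψ) (v w : E) {y : E} (hy : y ∈ U) :
    IsSkewFor (G y)
      (localCurv id A v w y - (nablaPsi A ψ v w y - nablaPsi A ψ w v y)) := by
  have h1 := isSkewFor_curvForm (R := smoothAlg (Matrix (Fin r) (Fin r) ℂ) U)
    (d := fun v => smoothAlg.deriv h.open_U v)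
    (B := (fun v => smoothAlg.mk (A v) (h.smooth_A v)) - fun v => smoothAlg.mk (ψ v) (h.smooth_psi v))
    (H := smoothAlg.mk G h.smooth_G) (fun a x y => smoothAlg.deriv_mul _ _ x y)
    (fun a b x => smoothAlg.deriv_comm _ _ _ x)
    (fun a x => smoothAlg.deriv_star _ _ x) (fun v => h.d_G v) v w
  have h2 := IsSkewFor.add h1 (IsSaFor.commutator
    (x := smoothAlg.mk (ψ v) (h.smooth_psi v)) (y := smoothAlg.mk (ψ w) (h.smooth_psi w))
    (smoothAlg.ext_ev fun q => h.sa v q q.2) (smoothAlg.ext_ev fun q => h.sa w q q.2))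
  have h3 := curvForm_sub_form (R := smoothAlg (Matrix (Fin r) (Fin r) ℂ) U)
    (d := fun v => smoothAlg.deriv h.open_U v) (fun v => smoothAlg.mk (A v) (h.smooth_A v))
    (fun v => smoothAlg.mk (ψ v) (h.smooth_psi v)) v w
  have h4 : ∀ {R : Type _} [Ring R] {a b c d : R}, a = b + c + d → b + d = a - c := by
    rintro R _ a b c d rfl
    abel
  rw [h4 h3] at h2
  have h5 := congrArg (smoothAlg.ev ⟨y, hy⟩) h2
  simp only [twist, curvForm, map_add, map_sub, map_mul, map_neg, smoothAlg.ev_star,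
    smoothAlg.deriv_mk, smoothAlg.ev_mk, Pi.sub_apply] at h5
  exact h5

end LocalMetric

variable {n : ℕ}

/-- The zeroth order part of `D''` in the direction `w`. -/
def higgsForm (A ψ : Cn n → Cn n → Matrix (Fin r) (Fin r) ℂ) (w y : Cn n) :
    Matrix (Fin r) (Fin r) ℂ :=
  (1 / 2 : ℂ) • (A w y + Complex.I • A (Complex.I • w) y) - Complex.I • ψ (Complex.I • w) y

/-- The operator `∂̄_v`. -/
def dbar (v : Cn n) (f : Cn n → Matrix (Fin r) (Fin r) ℂ) (y : Cn n) : Matrix (Fin r) (Fin r) ℂ :=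
  (1 / 2 : ℂ) • (fderiv ℝ f y v + Complex.I • fderiv ℝ f y (Complex.I • v))

/-- The pseudo-curvature in a local frame. -/
def localPseudo (A ψ : Cn n → Cn n → Matrix (Fin r) (Fin r) ℂ) (v w y : Cn n) :
    Matrix (Fin r) (Fin r) ℂ :=
  dbar v (higgsForm A ψ w) y - dbar w (higgsForm A ψ v) y +
    (higgsForm A ψ v y * higgsForm A ψ w y - higgsForm A ψ w y * higgsForm A ψ v y)

namespace LocalMetric

variable {U : Set (Cn n)} {G : Cn n → Matrix (Fin r) (Fin r) ℂ}
  {A ψ : Cn n → Cn n → Matrix (Fin r) (Fin r) ℂ}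

theorem contDiffOn_higgsForm (h : LocalMetric U G A ψ) (w : Cn n) :
    ContDiffOn ℝ ∞ (higgsForm A ψ w) U := by
  have hI : ∀ (c : ℂ) (f : Cn n → Matrix (Fin r) (Fin r) ℂ), ContDiffOn ℝ ∞ f U →
      ContDiffOn ℝ ∞ (fun y => c • f y) U := fun c f hf =>
    contDiffOn_matrix fun i j => contDiffOn_const.mul (hf.matrix_apply i j)
  exact (hI _ _ ((h.smooth_A w).add (hI _ _ (h.smooth_A _)))).sub (hI _ _ (h.smooth_psi _))

theorem fderiv_complex_smul {f : Cn n → Matrix (Fin r) (Fin r) ℂ} {y : Cn n}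
    (hf : DifferentiableAt ℝ f y) (c : ℂ) :
    DifferentiableAt ℝ (fun y => c • f y) y ∧
    ∀ v, fderiv ℝ (fun y => c • f y) y v = c • fderiv ℝ f y v := by
  have e : (fun y => c • f y) = fun y => (c • (1 : Matrix (Fin r) (Fin r) ℂ)) * f y := by
    funext y
    rw [smul_mul_assoc, one_mul]
  rw [e]
  refine ⟨hf.const_mul _, fun v => ?_⟩
  have h1 := DFunLike.congr_fun (hf.hasFDerivAt.const_mul (c • (1 : Matrix (Fin r) (Fin r) ℂ))).fderiv v
  refine h1.trans ((smul_mul_assoc _ _ _).trans ?_)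
  rw [one_mul]
  rfl

theorem fderiv_higgsForm (h : LocalMetric U G A ψ) (v w : Cn n) {y : Cn n} (hy : y ∈ U) :
    fderiv ℝ (higgsForm A ψ w) y v =
      (1 / 2 : ℂ) • (fderiv ℝ (A w) y v + Complex.I • fderiv ℝ (A (Complex.I • w)) y v) -
        Complex.I • fderiv ℝ (ψ (Complex.I • w)) y v := by
  have h1 := h.differentiableAt_A w hy
  have h2 := fderiv_complex_smul (h.differentiableAt_A (Complex.I • w) hy) Complex.I
  have h3 := fderiv_complex_smul (h1.add h2.1) (1 / 2)
  have h4 := fderiv_complex_smul (h.differentiableAt_psi (Complex.I • w) hy) Complex.I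
  have e := DFunLike.congr_fun (h3.1.hasFDerivAt.sub h4.1.hasFDerivAt).fderiv v
  refine e.trans ((congrArg₂ (· - ·) (h3.2 v) (h4.2 v)).trans ?_)
  have e2 := DFunLike.congr_fun (h1.hasFDerivAt.add h2.1.hasFDerivAt).fderiv v
  have e3 : fderiv ℝ (A w + fun y => Complex.I • A (Complex.I • w) y) y v =
      fderiv ℝ (A w) y v + Complex.I • fderiv ℝ (A (Complex.I • w)) y v := by
    refine e2.trans ?_
    exact congrArg (fderiv ℝ (A w) y v + ·) (h2.2 v)
  exact congrArg (fun x => (1 / 2 : ℂ) • x - _) e3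

/-- The `ψ`-terms of `∂̄_H` and of `ψ^{1,0}` add up to `-i ψ(i w)`, so `D''` is `½ (D_w + i D_{iw})
- i ψ(i w)`. Expanding its square gives curvature of `D`, first derivatives of `ψ` and commutators
of `ψ`. -/
theorem localPseudo_eq (h : LocalMetric U G A ψ) (v w : Cn n) {y : Cn n} (hy : y ∈ U) :
    localPseudo A ψ v w y =
      (1 / 4 : ℂ) • (localCurv id A v w y + Complex.I • localCurv id A (Complex.I • v) w y +
        Complex.I • localCurv id A v (Complex.I • w) y -
        localCurv id A (Complex.I • v) (Complex.I • w) y) -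
      (Complex.I / 2) • (nablaPsi A ψ v (Complex.I • w) y - nablaPsi A ψ w (Complex.I • v) y +
        Complex.I • (nablaPsi A ψ (Complex.I • v) (Complex.I • w) y -
          nablaPsi A ψ (Complex.I • w) (Complex.I • v) y) +
        (ψ v y * ψ (Complex.I • w) y - ψ (Complex.I • w) y * ψ v y) -
        (ψ w y * ψ (Complex.I • v) y - ψ (Complex.I • v) y * ψ w y)) := by
  simp only [localPseudo, dbar, h.fderiv_higgsForm _ _ hy, localCurv, nablaPsi, id, higgsForm]
  simp only [mul_add, add_mul, mul_sub, sub_mul, smul_mul_assoc, mul_smul_comm]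
  match_scalars <;> (apply Complex.ext <;> norm_num)

/-- The directions are constant in the coordinates and are never differentiated, so `∇_v ψ_w` is
bilinear in them. Bilinearity is what the invariance of `g` under `i` requires. -/
theorem nablaPsi_bilinear (h : LocalMetric U G A ψ) {y : Cn n} (hy : y ∈ U) :
    ∃ T : Cn n →ₗ[ℝ] Cn n →ₗ[ℝ] Matrix (Fin r) (Fin r) ℂ, ∀ v w, T v w = nablaPsi A ψ v w y := by
  have e1 : ∀ w w', fderiv ℝ (ψ (w + w')) y = fderiv ℝ (ψ w) y + fderiv ℝ (ψ w') y :=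
    fun w w' => by
      have h1 : ψ (w + w') =ᶠ[𝓝 y] ψ w + ψ w' :=
        Filter.eventuallyEq_of_mem (h.open_U.mem_nhds hy) fun z hz => h.psi_add w w' z hz
      rw [h1.fderiv_eq]
      exact fderiv_add (h.differentiableAt_psi w hy) (h.differentiableAt_psi w' hy)
  have e2 : ∀ (c : ℝ) w, fderiv ℝ (ψ (c • w)) y = c • fderiv ℝ (ψ w) y :=
    fun c w => by
      have h1 : ψ (c • w) =ᶠ[𝓝 y] c • ψ w :=
        Filter.eventuallyEq_of_mem (h.open_U.mem_nhds hy) fun z hz => h.psi_smul c w z hz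
      rw [h1.fderiv_eq]
      exact fderiv_const_smul (h.differentiableAt_psi w hy) c
  refine ⟨LinearMap.mk₂ ℝ (fun v w => nablaPsi A ψ v w y) (fun v v' w => ?_) (fun c v w => ?_)
    (fun v w w' => ?_) (fun c v w => ?_), fun v w => rfl⟩
  · simp only [nablaPsi, map_add, h.psi_add _ _ _ hy, h.A_add _ _ _ hy]
    noncomm_ring
  · simp only [nablaPsi, map_smul, h.psi_smul _ _ _ hy, h.A_smul _ _ _ hy, ← smul_sub,
      smul_mul_assoc, mul_smul_comm, ← smul_add]
  · simp only [nablaPsi, e1, h.psi_add _ _ _ hy, add_apply]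
    noncomm_ring
  · simp only [nablaPsi, e2, h.psi_smul _ _ _ hy, smul_apply, smul_mul_assoc, mul_smul_comm,
      ← smul_sub, ← smul_add]

theorem localCurv_bilinear (h : LocalMetric U G A ψ) {y : Cn n} (hy : y ∈ U) :
    ∃ T : Cn n →ₗ[ℝ] Cn n →ₗ[ℝ] Matrix (Fin r) (Fin r) ℂ, ∀ v w, T v w = localCurv id A v w y := by
  have e1 : ∀ w w', fderiv ℝ (A (w + w')) y = fderiv ℝ (A w) y + fderiv ℝ (A w') y :=
    fun w w' => by
      have h1 : A (w + w') =ᶠ[𝓝 y] A w + A w' :=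
        Filter.eventuallyEq_of_mem (h.open_U.mem_nhds hy) fun z hz => h.A_add w w' z hz
      rw [h1.fderiv_eq]
      exact fderiv_add (h.differentiableAt_A w hy) (h.differentiableAt_A w' hy)
  have e2 : ∀ (c : ℝ) w, fderiv ℝ (A (c • w)) y = c • fderiv ℝ (A w) y :=
    fun c w => by
      have h1 : A (c • w) =ᶠ[𝓝 y] c • A w :=
        Filter.eventuallyEq_of_mem (h.open_U.mem_nhds hy) fun z hz => h.A_smul c w z hz
      rw [h1.fderiv_eq]
      exact fderiv_const_smul (h.differentiableAt_A w hy) c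
  refine ⟨LinearMap.mk₂ ℝ (fun v w => localCurv id A v w y) (fun v v' w => ?_) (fun c v w => ?_)
    (fun v w w' => ?_) (fun c v w => ?_), fun v w => rfl⟩
  · simp only [localCurv, id, map_add, e1, h.A_add _ _ _ hy, add_apply]
    noncomm_ring
  · simp only [localCurv, id, map_smul, e2, h.A_smul _ _ _ hy, ← smul_sub, smul_apply,
      smul_mul_assoc, mul_smul_comm, ← smul_add]
  · simp only [localCurv, id, map_add, e1, h.A_add _ _ _ hy, add_apply]
    noncomm_ring
  · simp only [localCurv, id, map_smul, e2, h.A_smul _ _ _ hy, ← smul_sub, smul_apply,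
      smul_mul_assoc, mul_smul_comm, ← smul_add]

/-- Contraction with a real matrix `g`. -/
def gSum {ι : Type*} [Fintype ι] (g : Matrix ι ι ℝ) :
    (ι → ι → Matrix (Fin r) (Fin r) ℂ) →ₗ[ℂ] Matrix (Fin r) (Fin r) ℂ where
  toFun t := ∑ a, ∑ b, g a b • t a b
  map_add' t t' := by simp only [Pi.add_apply, smul_add, Finset.sum_add_distrib]
  map_smul' c t := by
    simp only [Pi.smul_apply, RingHom.id_apply, Finset.smul_sum]
    exact Finset.sum_congr rfl fun a _ => Finset.sum_congr rfl fun b _ => smul_comm _ _ _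

theorem gSum_apply {ι : Type*} [Fintype ι] (g : Matrix ι ι ℝ)
    (t : ι → ι → Matrix (Fin r) (Fin r) ℂ) : gSum g t = ∑ a, ∑ b, g a b • t a b := rfl

theorem gSum_swap {ι : Type*} [Fintype ι] {g : Matrix ι ι ℝ} (hg : ∀ a b, g a b = g b a)
    (t : ι → ι → Matrix (Fin r) (Fin r) ℂ) : gSum g (fun a b => t b a) = gSum g t := by
  rw [gSum_apply, gSum_apply, Finset.sum_comm]
  exact Finset.sum_congr rfl fun a _ => Finset.sum_congr rfl fun b _ => by rw [hg]

theorem gSum_antisymm {ι : Type*} [Fintype ι] {g : Matrix ι ι ℝ} (hg : ∀ a b, g a b = g b a)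
    {t : ι → ι → Matrix (Fin r) (Fin r) ℂ} (ht : ∀ a b, t b a = -t a b) : gSum g t = 0 := by
  have h1 := gSum_swap hg t
  have h2 : (fun a b => t b a) = -t := funext fun a => funext fun b => ht a b
  rw [h2, map_neg] at h1
  have h3 : (2 : ℂ) • gSum g t = 0 := by
    rw [two_smul]
    nth_rewrite 1 [← h1]
    exact neg_add_cancel _
  exact (smul_eq_zero.mp h3).resolve_left two_ne_zero

theorem gSum_isSkewFor {ι : Type*} [Fintype ι] (g : Matrix ι ι ℝ) {G : Matrix (Fin r) (Fin r) ℂ}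
    {t : ι → ι → Matrix (Fin r) (Fin r) ℂ} (ht : ∀ a b, IsSkewFor G (t a b)) :
    IsSkewFor G (gSum g t) := by
  simp only [IsSkewFor, gSum_apply, star_sum, star_smul, star_trivial, Finset.sum_mul,
    Finset.mul_sum, ← Finset.sum_neg_distrib, smul_mul_assoc, mul_smul_comm] at *
  exact Finset.sum_congr rfl fun a _ => Finset.sum_congr rfl fun b _ => by rw [ht, smul_neg]

theorem gSum_isSaFor {ι : Type*} [Fintype ι] (g : Matrix ι ι ℝ) {G : Matrix (Fin r) (Fin r) ℂ}
    {t : ι → ι → Matrix (Fin r) (Fin r) ℂ} (ht : ∀ a b, IsSaFor G (t a b)) :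
    IsSaFor G (gSum g t) := by
  simp only [IsSaFor, gSum_apply, star_sum, star_smul, star_trivial, Finset.sum_mul,
    Finset.mul_sum, smul_mul_assoc, mul_smul_comm] at *
  exact Finset.sum_congr rfl fun a _ => Finset.sum_congr rfl fun b _ => by rw [ht]

/-- The contraction of the pseudo-curvature of a Yang-Mills connection is `-2 g^{ab} ∇_a ψ_b`. -/
theorem gSum_localPseudo (h : LocalMetric U G A ψ) {y : Cn n} (hy : y ∈ U) {ι : Type*} [Fintype ι]
    {g : Matrix ι ι ℝ} (hg : ∀ a b, g a b = g b a) (u : ι → Cn n)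
    (hJ : ∀ T : Cn n →ₗ[ℝ] Cn n →ₗ[ℝ] Matrix (Fin r) (Fin r) ℂ,
      ∑ a, ∑ b, g a b • T (Complex.I • u a) (Complex.I • u b) = ∑ a, ∑ b, g a b • T (u a) (u b))
    {lam : ℝ} (hF : Complex.I • (1 / 2 : ℝ) •
      ∑ a, ∑ b, g a b • localCurv id A (u a) (Complex.I • u b) y = (lam : ℂ) • 1) :
    (4 * Complex.I) • (1 / 2 : ℝ) • ∑ a, ∑ b, g a b • localPseudo A ψ (u a) (Complex.I • u b) y =
      -2 * ∑ a, ∑ b, g a b • nablaPsi A ψ (u a) (u b) y := by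
  obtain ⟨N, hN⟩ := h.nablaPsi_bilinear hy
  obtain ⟨F, hFe⟩ := h.localCurv_bilinear hy
  let J : Cn n →ₗ[ℝ] Cn n := (Complex.I • LinearMap.id : Cn n →ₗ[ℂ] Cn n).restrictScalars ℝ
  have hJa : ∀ v, J v = Complex.I • v := fun v => rfl
  have hII : ∀ v : Cn n, Complex.I • Complex.I • v = -v := fun v => by
    rw [smul_smul, Complex.I_mul_I, neg_one_smul]
  have hJ1 : ∀ T : Cn n →ₗ[ℝ] Cn n →ₗ[ℝ] Matrix (Fin r) (Fin r) ℂ,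
      gSum g (fun a b => T (Complex.I • u a) (Complex.I • u b)) =
        gSum g (fun a b => T (u a) (u b)) := hJ
  -- Apply the invariance to `T (·, i ·)` and use `i² = -1`.
  have hJ2 : ∀ T : Cn n →ₗ[ℝ] Cn n →ₗ[ℝ] Matrix (Fin r) (Fin r) ℂ,
      gSum g (fun a b => T (Complex.I • u a) (u b)) =
        -gSum g (fun a b => T (u a) (Complex.I • u b)) := fun T => by
    have := hJ1 (T.compl₂ J)
    simp only [LinearMap.compl₂_apply, hJa, hII, map_neg] at this
    rw [← this, ← map_neg]
    congr 1
    funext a b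
    simp
  have hFanti : ∀ v w, F v w = -F w v := fun v w => by
    rw [hFe, hFe, localCurv, localCurv]
    noncomm_ring
  have hpt : (fun a b => localPseudo A ψ (u a) (Complex.I • u b) y) =
      (1 / 4 : ℂ) • ((fun a b => F (u a) (Complex.I • u b)) +
        Complex.I • (fun a b => F (Complex.I • u a) (Complex.I • u b)) -
        Complex.I • (fun a b => F (u a) (u b)) + fun a b => F (Complex.I • u a) (u b)) -
      (Complex.I / 2) • (-(fun a b => N (u a) (u b)) -
        (fun a b => N (Complex.I • u b) (Complex.I • u a)) -
        Complex.I • ((fun a b => N (Complex.I • u a) (u b)) - fun a b => N (u b) (Complex.I • u a))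
        - (fun a b => ψ (u a) y * ψ (u b) y - ψ (u b) y * ψ (u a) y) -
        fun a b => ψ (Complex.I • u b) y * ψ (Complex.I • u a) y -
          ψ (Complex.I • u a) y * ψ (Complex.I • u b) y) := by
    funext a b
    rw [h.localPseudo_eq _ _ hy]
    have hψ : ψ (-u b) y = -ψ (u b) y := by
      rw [← neg_one_smul ℝ, h.psi_smul _ _ _ hy, neg_one_smul]
    simp only [← hN, ← hFe, hII, map_neg, LinearMap.neg_apply, Pi.sub_apply, Pi.add_apply,
      Pi.smul_apply, Pi.neg_apply, hψ, mul_neg, neg_mul]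
    module
  -- Antisymmetric expressions vanish against the symmetric `g`.
  have z1 : gSum g (fun a b => F (u a) (u b)) = 0 := gSum_antisymm hg fun a b => hFanti _ _
  have z2 : gSum g (fun a b => ψ (u a) y * ψ (u b) y - ψ (u b) y * ψ (u a) y) = 0 :=
    gSum_antisymm hg fun a b => (neg_sub _ _).symm
  have z3 : gSum g (fun a b => ψ (Complex.I • u b) y * ψ (Complex.I • u a) y -
      ψ (Complex.I • u a) y * ψ (Complex.I • u b) y) = 0 :=
    gSum_antisymm hg fun a b => (neg_sub _ _).symm
  have n1 : gSum g (fun a b => N (Complex.I • u b) (Complex.I • u a)) =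
      gSum g (fun a b => N (u a) (u b)) :=
    (gSum_swap hg fun a b => N (Complex.I • u a) (Complex.I • u b)).trans (hJ1 N)
  have n2 : gSum g (fun a b => N (u b) (Complex.I • u a)) =
      gSum g (fun a b => N (u a) (Complex.I • u b)) :=
    gSum_swap hg fun a b => N (u a) (Complex.I • u b)
  -- The Yang-Mills equation enters here. It makes the contraction of `F` equal to `-2 i lam` times
  -- the identity, which is skew. The self-adjoint part of that contraction comes from `dψ` and is
  -- twice the sum of `N (u_a, i u_b)`, which must therefore vanish.
  have n3 : gSum g (fun a b => N (u a) (Complex.I • u b)) = 0 := by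
    have hP : gSum g (fun a b => N (u a) (Complex.I • u b) - N (Complex.I • u b) (u a)) =
        (2 : ℂ) • gSum g (fun a b => N (u a) (Complex.I • u b)) := by
      have := map_sub (gSum g) (fun a b => N (u a) (Complex.I • u b))
        (fun a b => N (Complex.I • u b) (u a))
      refine this.trans ?_
      rw [gSum_swap hg fun a b => N (Complex.I • u a) (u b), hJ2, sub_neg_eq_add, two_smul]
    have hsa : IsSaFor (G y)
        (gSum g (fun a b => N (u a) (Complex.I • u b) - N (Complex.I • u b) (u a))) :=
      gSum_isSaFor g fun a b => by
        rw [hN, hN]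
        exact (h.nablaPsi_sa _ _ hy).sub (h.nablaPsi_sa _ _ hy)
    have hFsum : gSum g (fun a b => F (u a) (Complex.I • u b)) = (-2 * Complex.I * lam) • 1 := by
      have h1 : Complex.I • (1 / 2 : ℂ) • gSum g (fun a b => F (u a) (Complex.I • u b)) =
          (lam : ℂ) • 1 := by
        rw [← hF, gSum_apply]
        simp only [hFe]
        congr 1
        rw [← Complex.coe_smul]
        norm_num
      have h2 := congrArg (fun x => (-2 * Complex.I) • x) h1
      simp only [smul_smul] at h2
      rw [← h2, show -2 * Complex.I * (Complex.I * (1 / 2)) = 1 by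
        linear_combination -Complex.I_mul_I, one_smul]
    have hskF : IsSkewFor (G y) (gSum g (fun a b => F (u a) (Complex.I • u b))) := by
      rw [hFsum, IsSkewFor, star_smul, star_one, smul_one_mul, mul_smul_one, ← neg_smul]
      congr 1
      simp
    have hsk : IsSkewFor (G y) (gSum g (fun a b => F (u a) (Complex.I • u b) -
        (N (u a) (Complex.I • u b) - N (Complex.I • u b) (u a)))) :=
      gSum_isSkewFor g fun a b => by
        rw [hN, hN, hFe]
        exact h.curv_sub_skew _ _ hy
    have hsub := map_sub (gSum g) (fun a b => F (u a) (Complex.I • u b))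
      (fun a b => N (u a) (Complex.I • u b) - N (Complex.I • u b) (u a))
    have hsk' : IsSkewFor (G y) (gSum g (fun a b => F (u a) (Complex.I • u b)) -
        gSum g (fun a b => N (u a) (Complex.I • u b) - N (Complex.I • u b) (u a))) := by
      rw [← hsub]
      exact hsk
    rw [hP] at hsk' hsa
    set Q := gSum g (fun a b => N (u a) (Complex.I • u b))
    rw [IsSkewFor] at hskF
    rw [IsSkewFor, star_sub, sub_mul, hskF, hsa, mul_sub] at hsk'
    have h0 : G y * ((2 : ℂ) • Q) = 0 := by
      have h4 : (2 : ℂ) • (G y * ((2 : ℂ) • Q)) = 0 := by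
        rw [two_smul, ← sub_eq_zero.mpr hsk'.symm]
        noncomm_ring
      exact (smul_eq_zero.mp h4).resolve_left two_ne_zero
    have h5 := congrArg ((G y)⁻¹ * ·) h0
    simp only [mul_zero, Matrix.nonsing_inv_mul_cancel_left _ _ (h.unit y hy)] at h5
    exact (smul_eq_zero.mp h5).resolve_left two_ne_zero
  -- The curvature terms cancel by `hJ2` and by antisymmetry, the mixed `N`-terms vanish by `n3`,
  -- and two equal copies of the contraction of `N (u_a, u_b)` remain.
  have key : gSum g (fun a b => localPseudo A ψ (u a) (Complex.I • u b) y) =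
      Complex.I • gSum g (fun a b => N (u a) (u b)) := by
    rw [hpt]
    simp only [map_sub, map_add, map_smul, map_neg, z1, z2, z3, n1, n2, n3, hJ1, hJ2]
    module
  have hNs : ∑ a, ∑ b, g a b • nablaPsi A ψ (u a) (u b) y = gSum g (fun a b => N (u a) (u b)) := by
    simp only [hN, gSum_apply]
  rw [hNs, ← gSum_apply g (fun a b => localPseudo A ψ (u a) (Complex.I • u b) y), key,
    ← Complex.coe_smul, smul_smul, smul_smul]
  have : (4 * Complex.I * ((1 / 2 : ℝ) : ℂ) * Complex.I) = -2 := by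
    push_cast
    linear_combination 2 * Complex.I_mul_I
  rw [this, neg_mul, two_mul, neg_smul, two_smul]

end LocalMetric

end LocalHiggs

/-! ### Hermitian metrics in local frames -/

section FrameMetric

set_option linter.unusedSectionVars false

open scoped Matrix ComplexOrder

attribute [local instance] Matrix.frobeniusNormedRing Matrix.frobeniusNormedAlgebra
  normedStarGroup_matrix

variable {n r : ℕ} {X : Type*} [TopologicalSpace X] [ChartedSpace (Cn n) X]
  [IsManifold 𝓘(ℂ, Cn n) ω X]
  {V : X → Type*} [TopologicalSpace (TotalSpace (Fin r → ℂ) V)]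
  [∀ x, AddCommGroup (V x)] [∀ x, Module ℂ (V x)] [∀ x, TopologicalSpace (V x)]
  [∀ x, IsTopologicalAddGroup (V x)] [∀ x, ContinuousSMul ℝ (V x)]
  [FiberBundle (Fin r → ℂ) V] [VectorBundle ℝ (Fin r → ℂ) V] [VectorBundle ℂ (Fin r → ℂ) V]
  [ContMDiffVectorBundle ∞ (Fin r → ℂ) V 𝓘(ℝ, Cn n)]
  {e : Trivialization (Fin r → ℂ) (π (Fin r → ℂ) V)} [MemTrivializationAtlas e]

/-- The matrix of an endomorphism of a fibre in the frame of `e`. -/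
def endMat (e : Trivialization (Fin r → ℂ) (π (Fin r → ℂ) V)) [MemTrivializationAtlas e] (x : X) :
    Module.End ℂ (V x) →ₗ[ℂ] Matrix (Fin r) (Fin r) ℂ where
  toFun f := LinearMap.toMatrix' (e.linearMapAt ℂ x ∘ₗ f ∘ₗ e.symmₗ ℂ x)
  map_add' f g := by rw [LinearMap.add_comp, LinearMap.comp_add, map_add]
  map_smul' c f := by rw [LinearMap.smul_comp, LinearMap.comp_smul, map_smul]; rfl

theorem symm_eq {x : X} (hx : x ∈ e.baseSet) (c : Fin r → ℂ) : e.symm x c = e.symmₗ ℂ x c :=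
  (e.symmₗ_apply (R := ℂ) hx c).symm

theorem apply_symm {x : X} (hx : x ∈ e.baseSet) (f : Module.End ℂ (V x)) (a : Fin r → ℂ) :
    f (e.symm x a) = e.symm x (endMat e x f *ᵥ a) := by
  have h : endMat e x f *ᵥ a = e.linearMapAt ℂ x (f (e.symmₗ ℂ x a)) := by
    rw [← Matrix.toLin'_apply]
    exact DFunLike.congr_fun
      (Matrix.toLin'_toMatrix' (e.linearMapAt ℂ x ∘ₗ f ∘ₗ e.symmₗ ℂ x)) a
  rw [h, symm_eq hx, symm_eq hx, e.symmₗ_linearMapAt hx]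

theorem symm_injective {x : X} (hx : x ∈ e.baseSet) {a b : Fin r → ℂ}
    (h : e.symm x a = e.symm x b) : a = b := by
  rw [symm_eq hx, symm_eq hx] at h
  rw [← e.linearMapAt_symmₗ (R := ℂ) hx a, h, e.linearMapAt_symmₗ hx]

theorem endMat_mul {x : X} (hx : x ∈ e.baseSet) (f g : Module.End ℂ (V x)) :
    endMat e x (f * g) = endMat e x f * endMat e x g := by
  refine Matrix.ext_of_mulVec_single fun j => symm_injective hx ?_
  rw [← apply_symm hx, Module.End.mul_apply, apply_symm hx, apply_symm hx, Matrix.mulVec_mulVec]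

theorem trace_eq {x : X} (hx : x ∈ e.baseSet) (f : Module.End ℂ (V x)) :
    LinearMap.trace ℂ (V x) f = (endMat e x f).trace := by
  have h : e.linearMapAt ℂ x ∘ₗ f ∘ₗ e.symmₗ ℂ x = (e.linearEquivAt ℂ x hx).conj f := by
    refine LinearMap.ext fun a => ?_
    rw [LinearEquiv.conj_apply]
    simp [hx]
  change _ = (LinearMap.toMatrix' (e.linearMapAt ℂ x ∘ₗ f ∘ₗ e.symmₗ ℂ x)).trace
  rw [h, ← LinearMap.trace_conj' f (e.linearEquivAt ℂ x hx)]
  exact (Matrix.trace_toLin'_eq _).symm.trans (by rw [Matrix.toLin'_toMatrix']) |>.symm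

/-- The Gram matrix of a Hermitian metric in the frame of `e`. -/
def gramAt (H : HermitianMetric n r V) (e : Trivialization (Fin r → ℂ) (π (Fin r → ℂ) V)) (x : X) :
    Matrix (Fin r) (Fin r) ℂ :=
  Matrix.of fun i j => H.inner x (e.symm x (Pi.single i 1)) (e.symm x (Pi.single j 1))

theorem inner_symm (H : HermitianMetric n r V) {x : X} (hx : x ∈ e.baseSet) (a b : Fin r → ℂ) :
    H.inner x (e.symm x a) (e.symm x b) = star a ⬝ᵥ (gramAt H e x *ᵥ b) := by
  have hs : ∀ a : Fin r → ℂ, e.symm x a = ∑ i, a i • e.symm x (Pi.single i 1) := fun a => by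
    have h1 : a = ∑ i, a i • Pi.single i (1 : ℂ) := by
      ext i
      simp [Finset.sum_apply, Pi.single_apply]
    conv_lhs => rw [h1, symm_eq hx, map_sum]
    exact Finset.sum_congr rfl fun i _ => by rw [map_smul, symm_eq hx]
  rw [hs a, hs b]
  simp only [map_sum, LinearMap.sum_apply, LinearMap.map_smulₛₗ, LinearMap.smul_apply, map_smul,
    smul_eq_mul, dotProduct, Matrix.mulVec, gramAt, Matrix.of_apply, Pi.star_apply, Finset.mul_sum]
  rw [Finset.sum_comm]
  refine Finset.sum_congr rfl fun i _ => Finset.sum_congr rfl fun j _ => ?_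
  rw [starRingEnd_apply]
  ring

theorem gramAt_mul (H : HermitianMetric n r V) {x : X} (hx : x ∈ e.baseSet)
    (M : Matrix (Fin r) (Fin r) ℂ) (i j : Fin r) :
    H.inner x (e.symm x (Pi.single i 1)) (e.symm x (M *ᵥ Pi.single j 1)) =
      (gramAt H e x * M) i j := by
  rw [inner_symm H hx, Matrix.mulVec_mulVec]
  simp

theorem star_mul_gramAt (H : HermitianMetric n r V) {x : X} (hx : x ∈ e.baseSet)
    (M : Matrix (Fin r) (Fin r) ℂ) (i j : Fin r) :
    H.inner x (e.symm x (M *ᵥ Pi.single i 1)) (e.symm x (Pi.single j 1)) =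
      (star M * gramAt H e x) i j := by
  rw [inner_symm H hx, Matrix.star_mulVec, Matrix.dotProduct_mulVec, Matrix.vecMul_vecMul]
  simp [Matrix.star_eq_conjTranspose]

theorem gramAt_star (H : HermitianMetric n r V) (x : X) : star (gramAt H e x) = gramAt H e x := by
  ext i j
  rw [Matrix.star_apply]
  exact (H.isInner x).conj_symm _ _

theorem gramAt_posDef (H : HermitianMetric n r V) {x : X} (hx : x ∈ e.baseSet) :
    (gramAt H e x).PosDef := by
  refine Matrix.PosDef.of_dotProduct_mulVec_pos (gramAt_star H x) fun a ha => ?_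
  rw [← inner_symm H hx]
  have hne : e.symm x a ≠ 0 := fun h => ha (symm_injective hx (h.trans (by
    rw [symm_eq hx, map_zero])))
  have h1 := (H.isInner x).pos _ hne
  have h2 := (H.isInner x).conj_symm (e.symm x a) (e.symm x a)
  rw [Complex.pos_iff]
  exact ⟨h1, (Complex.conj_eq_iff_im.mp h2).symm⟩

theorem endMat_selfAdjoint (H : HermitianMetric n r V) {x : X} (hx : x ∈ e.baseSet)
    {f : Module.End ℂ (V x)} (hf : IsSelfAdjointFor (H.inner x) f) :
    IsSaFor (gramAt H e x) (endMat e x f) := by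
  refine Matrix.ext fun i j => ?_
  rw [← star_mul_gramAt H hx, ← gramAt_mul H hx, ← apply_symm hx, ← apply_symm hx]
  exact hf _ _

/-- The matrix of `ψ_H` in the direction `v`. -/
def psiAt (D : ComplexConnection n r V) (H : HermitianMetric n r V)
    (φ : OpenPartialHomeomorph X (Cn n)) (e : Trivialization (Fin r → ℂ) (π (Fin r → ℂ) V))
    [MemTrivializationAtlas e] (v : Cn n) (x : X) : Matrix (Fin r) (Fin r) ℂ :=
  endMat e x (psi D H x (coordField φ v x))

theorem fderiv_column {f : Cn n → Matrix (Fin r) (Fin r) ℂ} {y : Cn n}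
    (hf : DifferentiableAt ℝ f y) (j : Fin r) :
    DifferentiableAt ℝ (fun y => f y *ᵥ Pi.single j 1) y ∧
      ∀ v, fderiv ℝ (fun y => f y *ᵥ Pi.single j 1) y v = fderiv ℝ f y v *ᵥ Pi.single j 1 := by
  have h1 : ∀ i, DifferentiableAt ℝ (fun y => (f y *ᵥ Pi.single j 1) i) y := fun i => by
    simp only [Matrix.mulVec_single_one, Matrix.col_apply]
    exact (entryL ℂ i j).differentiableAt.comp y hf
  have h2 : DifferentiableAt ℝ (fun y => f y *ᵥ Pi.single j 1) y := differentiableAt_pi.mpr h1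
  refine ⟨h2, fun v => funext fun i => ?_⟩
  refine (DFunLike.congr_fun (fderiv_apply h2 i) v).symm.trans ?_
  simp only [Matrix.mulVec_single_one, Matrix.col_apply]
  exact (fderiv_matrix_apply hf v i j).symm

namespace IsFrameOn

variable {φ : OpenPartialHomeomorph X (Cn n)} {σ : Fin r → Π x, V x} {W : Set X}

theorem contDiffOn_gramAt (h : IsFrameOn φ e σ W) (H : HermitianMetric n r V) :
    ContDiffOn ℝ ∞ (fun y => gramAt H e (φ.symm y)) (φ.target ∩ φ.symm ⁻¹' W) :=
  contDiffOn_matrix fun i j => contDiffOn_comp_symm h.mem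
    ((H.smooth e (Pi.single i 1) (Pi.single j 1)).mono h.sub_base)

/-- Unitarity of `D - ψ`, tested on the frame sections and written with matrices; self-adjointness
merges the two `ψ`-terms into one. -/
theorem fderiv_gramAt (h : IsFrameOn φ e σ W) (D : ComplexConnection n r V)
    (H : HermitianMetric n r V) {x : X} (hx : x ∈ W) (v : Cn n) :
    fderiv ℝ (fun y => gramAt H e (φ.symm y)) (φ x) v =
      star (connForm D φ e σ v (φ x)) * gramAt H e x + gramAt H e x * connForm D φ e σ v (φ x) -
        2 * (gramAt H e x * psiAt D H φ e v x) := by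
  have hxb := h.sub_base hx
  have hd : DifferentiableAt ℝ (fun y => gramAt H e (φ.symm y)) (φ x) :=
    ((h.contDiffOn_gramAt H).contDiffAt (h.open_image.mem_nhds (h.map_mem hx))).differentiableAt
      (by simp)
  refine Matrix.ext fun i j => ?_
  rw [fderiv_matrix_apply hd]
  have h1 := (psi_spec D H x).unitary _ _ (h.diff i x) (h.diff j x) (coordField φ v x)
  have h2 : dirDeriv (fun y => H.inner y (σ i y) (σ j y)) x (coordField φ v x) =
      fderiv ℝ (fun y => gramAt H e (φ.symm y) i j) (φ x) v := by
    rw [dirDeriv_coordField h.mem (h.sub_source hx)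
      (H.mdifferentiableAt (h.diff i x) (h.diff j x))]
    have : (fun y => H.inner y (σ i y) (σ j y)) ∘ φ.symm =ᶠ[𝓝 (φ x)]
        fun y => gramAt H e (φ.symm y) i j :=
      Filter.eventuallyEq_of_mem (h.open_image.mem_nhds (h.map_mem hx)) fun y hy => by
        rw [Function.comp_apply, h.eq _ hy.2, h.eq _ hy.2]
        rfl
    rw [this.fderiv_eq]
  have h3 : ∀ k, D.toFun (σ k) x (coordField φ v x) - psi D H x (coordField φ v x) (σ k x) =
      e.symm x ((connForm D φ e σ v (φ x) - psiAt D H φ e v x) *ᵥ Pi.single k 1) := fun k => by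
    have := h.cov_frame D hx k v
    rw [this, h.eq x hx, apply_symm hxb, Matrix.sub_mulVec, symm_eq hxb, symm_eq hxb, ← map_sub,
      ← symm_eq hxb, Matrix.mulVec_single_one (connForm D φ e σ v (φ x))]
    rfl
  rw [← h2, h1, h3, h3, h.eq x hx, h.eq x hx, star_mul_gramAt H hxb, gramAt_mul H hxb,
    ← Matrix.add_apply]
  refine congrFun (congrFun ?_ i) j
  have hsa := endMat_selfAdjoint H hxb ((psi_spec D H x).selfAdjoint (coordField φ v x))
  rw [IsSaFor] at hsa
  change star (psiAt D H φ e v x) * _ = _ * psiAt D H φ e v x at hsa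
  rw [star_sub, sub_mul, hsa, mul_sub]
  noncomm_ring

theorem isUnit_gramAt (h : IsFrameOn φ e σ W) (H : HermitianMetric n r V) {x : X} (hx : x ∈ W) :
    IsUnit (gramAt H e x).det :=
  (Matrix.isUnit_iff_isUnit_det _).mp (gramAt_posDef H (h.sub_base hx)).isUnit

/-- Solve `fderiv_gramAt` for `ψ`. The formula involves only the Gram matrix, its spatial derivative
and the connection form, so it gives smoothness of `ψ` in space and its continuity up to the initial
time. -/
theorem psiAt_eq (h : IsFrameOn φ e σ W) (D : ComplexConnection n r V)
    (H : HermitianMetric n r V) {x : X} (hx : x ∈ W) (v : Cn n) :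
    psiAt D H φ e v x = (-1 / 2 : ℝ) • ((gramAt H e x)⁻¹ *
      (fderiv ℝ (fun y => gramAt H e (φ.symm y)) (φ x) v -
        star (connForm D φ e σ v (φ x)) * gramAt H e x -
        gramAt H e x * connForm D φ e σ v (φ x))) := by
  have e1 : star (connForm D φ e σ v (φ x)) * gramAt H e x +
      gramAt H e x * connForm D φ e σ v (φ x) - 2 * (gramAt H e x * psiAt D H φ e v x) -
      star (connForm D φ e σ v (φ x)) * gramAt H e x -
        gramAt H e x * connForm D φ e σ v (φ x) =
      gramAt H e x * ((-2 : ℝ) • psiAt D H φ e v x) := by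
    rw [mul_smul_comm, two_mul]
    module
  rw [h.fderiv_gramAt D H hx, e1, Matrix.nonsing_inv_mul_cancel_left _ _ (h.isUnit_gramAt H hx),
    smul_smul]
  norm_num

/-- A Hermitian metric on a bundle with connection gives a local metric. -/
theorem localMetric (h : IsFrameOn φ e σ W) (D : ComplexConnection n r V)
    (H : HermitianMetric n r V) :
    LocalMetric (φ.target ∩ φ.symm ⁻¹' W) (fun y => gramAt H e (φ.symm y)) (connForm D φ e σ)
      (fun v y => psiAt D H φ e v (φ.symm y)) where
  open_U := h.open_image
  smooth_G := h.contDiffOn_gramAt H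
  smooth_A := h.contDiffOn_connForm D
  smooth_psi v := by
    have hG := h.contDiffOn_gramAt H
    have hA := h.contDiffOn_connForm D v
    have h1 : ContDiffOn ℝ ∞ (fun y => (-1 / 2 : ℝ) • ((gramAt H e (φ.symm y))⁻¹ *
      (fderiv ℝ (fun y => gramAt H e (φ.symm y)) y v -
        star (connForm D φ e σ v y) * gramAt H e (φ.symm y) -
        gramAt H e (φ.symm y) * connForm D φ e σ v y))) (φ.target ∩ φ.symm ⁻¹' W) :=
      ContDiffOn.const_smul _ ((contDiffOn_matrix_inv hG fun y hy => h.isUnit_gramAt H hy.2).mul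
        (((contDiffOn_fderiv_apply h.open_image hG v).sub
          (((starL' ℝ : Matrix (Fin r) (Fin r) ℂ ≃L[ℝ] _).contDiff.comp_contDiffOn hA).mul hG)).sub
          (hG.mul hA)))
    refine h1.congr fun y hy => ?_
    have := h.psiAt_eq D H hy.2 v
    rw [φ.right_inv hy.1] at this
    exact this
  unit y hy := h.isUnit_gramAt H hy.2
  sa v y hy := endMat_selfAdjoint H (h.sub_base hy.2) ((psi_spec D H _).selfAdjoint _)
  dG v y hy := by
    have := h.fderiv_gramAt D H hy.2 v
    rw [φ.right_inv hy.1] at this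
    exact this
  A_add v w y hy := connForm_add D φ e σ v w y (h.sub_base hy.2)
  A_smul c v y hy := connForm_smul D φ e σ c v y (h.sub_base hy.2)
  psi_add v w y _ := by simp only [psiAt, coordField_add, map_add]
  psi_smul c v y _ := by
    simp only [psiAt, coordField_smul, map_smul]
    rw [← Complex.coe_smul, map_smul, Complex.coe_smul]

theorem curvature_eq (h : IsFrameOn φ e σ W) (D : ComplexConnection n r V) {x : X} (hx : x ∈ W)
    (v w : Cn n) (j : Fin r) :
    curvature D φ v w (σ j) x =
      e.symm x (localCurv id (connForm D φ e σ) v w (φ x) *ᵥ Pi.single j 1) := by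
  have hA := fun v => ((h.contDiffOn_connForm D v).contDiffAt
    (h.open_image.mem_nhds (h.map_mem hx))).differentiableAt (by simp)
  have h1 : ∀ w, ∀ y ∈ W, D.toFun (σ j) y (coordField φ w y) =
      frameSection φ e (fun y => connForm D φ e σ w y *ᵥ Pi.single j 1) y := fun w y hy => by
    rw [h.cov_frame D hy, frameSection, Matrix.mulVec_single_one]
    rfl
  have h2 := fun v w => (h.cov D hx (fderiv_column (hA w) j).1 (h1 w) v).2
  rw [curvature, h2, h2, (fderiv_column (hA w) j).2, (fderiv_column (hA v) j).2]
  have hL := fun c => symm_eq (e := e) (h.sub_base hx) c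
  rw [hL, hL, hL, ← map_sub]
  congr 1
  simp only [Matrix.mulVec_mulVec, ← Matrix.add_mulVec, ← Matrix.sub_mulVec, localCurv, id]
  congr 1
  noncomm_ring

theorem dbarHiggs_eq (h : IsFrameOn φ e σ W) (D : ComplexConnection n r V)
    (H : HermitianMetric n r V) {x : X} (hx : x ∈ W)
    {s : Cn n → Fin r → ℂ} (hs : DifferentiableAt ℝ s (φ x)) {τ : Π x, V x}
    (hτ : ∀ y ∈ W, τ y = frameSection φ e s y) (w : Cn n) :
    dbarHiggs D H φ w τ x = e.symm x
      ((1 / 2 : ℂ) • (fderiv ℝ s (φ x) w + Complex.I • fderiv ℝ s (φ x) (Complex.I • w)) +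
        higgsForm (connForm D φ e σ) (fun v y => psiAt D H φ e v (φ.symm y)) w (φ x) *ᵥ
          s (φ x)) := by
  have hxb := h.sub_base hx
  have h1 := fun v => (h.cov D hx hs hτ v).2
  have hp : ∀ v, psi D H x (coordField φ v x) (τ x) = e.symm x (psiAt D H φ e v x *ᵥ s (φ x)) :=
    fun v => by rw [hτ x hx, frameSection, apply_symm hxb, psiAt]
  simp only [dbarHiggs, unitaryPart, h1, hp, higgsForm, φ.left_inv (h.sub_source hx)]
  simp only [symm_eq hxb, ← map_sub, ← map_add, ← map_smul]
  congr 1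
  simp only [Matrix.sub_mulVec, Matrix.add_mulVec, Matrix.smul_mulVec]
  module

theorem pseudoCurvature_eq (h : IsFrameOn φ e σ W) (D : ComplexConnection n r V)
    (H : HermitianMetric n r V) {x : X} (hx : x ∈ W) (v w : Cn n) (j : Fin r) :
    pseudoCurvature D H φ v w (σ j) x = e.symm x
      (localPseudo (connForm D φ e σ) (fun v y => psiAt D H φ e v (φ.symm y)) v w (φ x) *ᵥ
        Pi.single j 1) := by
  have hxb := h.sub_base hx
  have hQ := fun w => (((h.localMetric D H).contDiffOn_higgsForm w).contDiffAt
    (h.open_image.mem_nhds (h.map_mem hx))).differentiableAt (by simp)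
  have hσ : ∀ y ∈ W, σ j y = frameSection φ e (fun _ => Pi.single j 1) y := fun y hy => by
    rw [h.eq y hy]
    rfl
  have h1 : ∀ w, ∀ y ∈ W, dbarHiggs D H φ w (σ j) y = frameSection φ e (fun y =>
      higgsForm (connForm D φ e σ) (fun v y => psiAt D H φ e v (φ.symm y)) w y *ᵥ
        Pi.single j 1) y := fun w y hy => by
    rw [h.dbarHiggs_eq D H hy (differentiableAt_const _) hσ, frameSection]
    simp
  have h2 := fun v w => h.dbarHiggs_eq D H hx (fderiv_column (hQ w) j).1 (h1 w) v
  rw [pseudoCurvature, h2, h2]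
  simp only [(fderiv_column (hQ _) j).2, symm_eq hxb, ← map_sub]
  congr 1
  simp only [localPseudo, dbar, Matrix.sub_mulVec, Matrix.add_mulVec, Matrix.smul_mulVec,
    Matrix.mulVec_mulVec]
  module

theorem contract_eq (h : IsFrameOn φ e σ W) (κ : KahlerMetric n X) {x : X} (hx : x ∈ W)
    (B : Cn n → Cn n → Matrix (Fin r) (Fin r) ℂ) (a : Fin r → ℂ) :
    κ.contract φ x (fun v w => e.symm x (B v w *ᵥ a)) =
      e.symm x (((1 / 2 : ℝ) • ∑ a, ∑ b, κ.inv φ x a b •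
        B (realBasis n a) (Complex.I • realBasis n b)) *ᵥ a) := by
  simp only [KahlerMetric.contract, symm_eq (h.sub_base hx), ← Complex.coe_smul, ← map_smul,
    ← map_sum]
  congr 1
  simp only [← Matrix.smul_mulVec, ← Matrix.sum_mulVec]

theorem gSum_curvature (h : IsFrameOn φ e σ W) {κ : KahlerMetric n X} {D : ComplexConnection n r V}
    (hD : IsNHYM κ D) {x : X} (hx : x ∈ W) : ∃ lam : ℝ,
    Complex.I • (1 / 2 : ℝ) • ∑ a, ∑ b, κ.inv φ x a b •
      localCurv id (connForm D φ e σ) (realBasis n a) (Complex.I • realBasis n b) (φ x) =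
        (lam : ℂ) • 1 := by
  obtain ⟨lam, hl⟩ := hD
  refine ⟨lam, Matrix.ext_of_mulVec_single fun j => symm_injective (h.sub_base hx) ?_⟩
  have h1 := (hl φ h.mem x (h.sub_source hx) (σ j) (h.smoothAt j x)).2
  simp only [h.curvature_eq D hx] at h1
  rw [h.contract_eq κ hx, h.eq x hx, symm_eq (h.sub_base hx), symm_eq (h.sub_base hx), ← map_smul,
    ← map_smul] at h1
  rw [symm_eq (h.sub_base hx), symm_eq (h.sub_base hx)]
  simp only [Matrix.smul_mulVec, Matrix.one_mulVec] at h1 ⊢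
  exact h1

/-- The heat flow in a local frame. -/
theorem flow_gramAt (h : IsFrameOn φ e σ W) {κ : KahlerMetric n X} {D : ComplexConnection n r V}
    (hD : IsNHYM κ D) {T : EReal} {H : ℝ → HermitianMetric n r V} (hH : IsHeatFlow κ D T H)
    {t : ℝ} (ht : t ∈ timeInterval T) {x : X} (hx : x ∈ W) :
    HasDerivWithinAt (fun s => gramAt (H s) e x) (gramAt (H t) e x *
      (-2 * ∑ a, ∑ b, κ.inv φ x a b • nablaPsi (connForm D φ e σ)
        (fun v y => psiAt D (H t) φ e v (φ.symm y)) (realBasis n a) (realBasis n b) (φ x)))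
      (timeInterval T) t := by
  obtain ⟨lam, hl⟩ := h.gSum_curvature hD hx
  -- Return from `-2 g^{ab} ∇_a ψ_b` to the contracted pseudo-curvature, the form in which the flow
  -- equation is given.
  rw [← (h.localMetric D (H t)).gSum_localPseudo (h.map_mem hx)
    (κ.inv_symm h.mem (h.sub_source hx)) (realBasis n)
    (fun T => κ.sum_inv_I h.mem (h.sub_source hx) T) hl]
  have key : ∀ i j, HasDerivWithinAt (fun s => gramAt (H s) e x i j) ((gramAt (H t) e x *
      ((4 * Complex.I) • (1 / 2 : ℝ) • ∑ a, ∑ b, κ.inv φ x a b • localPseudo (connForm D φ e σ)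
        (fun v y => psiAt D (H t) φ e v (φ.symm y)) (realBasis n a)
          (Complex.I • realBasis n b) (φ x))) i j) (timeInterval T) t := fun i j => by
    have h1 := hH.flow t ht φ h.mem x (h.sub_source hx) (e.symm x (Pi.single i 1)) (σ j)
      (h.smoothAt j x)
    simp only [h.pseudoCurvature_eq D _ hx] at h1
    rw [h.contract_eq κ hx, h.eq x hx, symm_eq (h.sub_base hx) (_ *ᵥ _), ← map_smul,
      ← symm_eq (h.sub_base hx), ← Matrix.smul_mulVec, gramAt_mul _ (h.sub_base hx)] at h1
    exact h1
  have hs : (fun s => gramAt (H s) e x) =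
      fun s => ∑ i, ∑ j, singleL ℂ i j (gramAt (H s) e x i j) :=
    funext fun s => sum_singleL _
  rw [hs, sum_singleL (gramAt (H t) e x * _)]
  exact HasDerivWithinAt.fun_sum fun i _ => HasDerivWithinAt.fun_sum fun j _ =>
    (singleL ℂ i j).hasFDerivAt.comp_hasDerivWithinAt t (key i j)

end IsFrameOn

end FrameMetric

/-! ### The heat flow in a local frame -/

section FrameFlow

set_option linter.unusedSectionVars false

open scoped Matrix ComplexOrder

attribute [local instance] Matrix.frobeniusNormedRing Matrix.frobeniusNormedAlgebra
  normedStarGroup_matrix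

theorem convex_timeInterval (T : EReal) : Convex ℝ (timeInterval T) := by
  refine Set.OrdConnected.convex ⟨fun a ha b hb c hc => ⟨ha.1.trans hc.1, ?_⟩⟩
  exact lt_of_le_of_lt (EReal.coe_le_coe_iff.mpr hc.2) hb.2

/-- The open time interval `(0, T)`. -/
def openTime (T : EReal) : Set ℝ := {t | 0 < t ∧ (t : EReal) < T}

theorem isOpen_openTime (T : EReal) : IsOpen (openTime T) :=
  (isOpen_lt continuous_const continuous_id).inter
    (isOpen_lt continuous_coe_real_ereal continuous_const)

theorem openTime_subset (T : EReal) : openTime T ⊆ timeInterval T := fun _ ht => ⟨ht.1.le, ht.2⟩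

/-- The interval is convex with nonempty interior. Derivatives within it are therefore determined
also at `t = 0`, where continuity is needed. -/
theorem uniqueDiffOn_timeInterval {T : EReal} (hT : 0 < T) : UniqueDiffOn ℝ (timeInterval T) := by
  refine uniqueDiffOn_convex (convex_timeInterval T) ?_
  obtain ⟨t, h0, ht⟩ := EReal.lt_iff_exists_real_btwn.mp hT
  exact ⟨t, interior_maximal (openTime_subset T) (isOpen_openTime T) ⟨by exact_mod_cast h0, ht⟩⟩

variable {n r : ℕ} {X : Type*} [TopologicalSpace X] [ChartedSpace (Cn n) X]
  [IsManifold 𝓘(ℂ, Cn n) ω X]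
  {V : X → Type*} [TopologicalSpace (TotalSpace (Fin r → ℂ) V)]
  [∀ x, AddCommGroup (V x)] [∀ x, Module ℂ (V x)] [∀ x, TopologicalSpace (V x)]
  [∀ x, IsTopologicalAddGroup (V x)] [∀ x, ContinuousSMul ℝ (V x)]
  [FiberBundle (Fin r → ℂ) V] [VectorBundle ℝ (Fin r → ℂ) V] [VectorBundle ℂ (Fin r → ℂ) V]
  [ContMDiffVectorBundle ∞ (Fin r → ℂ) V 𝓘(ℝ, Cn n)]

variable (n) in
/-- A family of Hermitian metrics which is jointly smooth on `[0, T) × X`. -/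
def SmoothFamily (T : EReal) (H : ℝ → HermitianMetric n r V) : Prop :=
  ∀ (e : Trivialization (Fin r → ℂ) (π (Fin r → ℂ) V)) [MemTrivializationAtlas e]
    (a b : Fin r → ℂ), ContMDiffOn (𝓘(ℝ, ℝ).prod 𝓘(ℝ, Cn n)) 𝓘(ℝ, ℂ) ∞
      (fun p : ℝ × X => (H p.1).inner p.2 (e.symm p.2 a) (e.symm p.2 b))
      (timeInterval T ×ˢ e.baseSet)

theorem smoothFamily_const (T : EReal) (K : HermitianMetric n r V) :
    SmoothFamily n T fun _ => K := fun e _ a b =>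
  (K.smooth e a b).comp contMDiffOn_snd fun _ hp => hp.2

/-- The Gram matrices of a family of metrics, in a chart and a trivialization. -/
def gramFlow (H : ℝ → HermitianMetric n r V) (φ : OpenPartialHomeomorph X (Cn n))
    (e : Trivialization (Fin r → ℂ) (π (Fin r → ℂ) V)) (p : ℝ × Cn n) :
    Matrix (Fin r) (Fin r) ℂ :=
  gramAt (H p.1) e (φ.symm p.2)

namespace IsFrameOn

variable {e : Trivialization (Fin r → ℂ) (π (Fin r → ℂ) V)} [MemTrivializationAtlas e]
  {φ : OpenPartialHomeomorph X (Cn n)} {σ : Fin r → Π x, V x} {W : Set X}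

theorem contDiffOn_gramFlow (h : IsFrameOn φ e σ W) {T : EReal} {H : ℝ → HermitianMetric n r V}
    (hH : SmoothFamily n T H) :
    ContDiffOn ℝ ∞ (gramFlow H φ e) (timeInterval T ×ˢ (φ.target ∩ φ.symm ⁻¹' W)) := by
  refine contDiffOn_matrix fun i j => ?_
  rw [← contMDiffOn_iff_contDiffOn]
  have h1 : ContMDiffOn 𝓘(ℝ, ℝ × Cn n) (𝓘(ℝ, ℝ).prod 𝓘(ℝ, Cn n)) ∞
      (fun p : ℝ × Cn n => (p.1, φ.symm p.2))
      (timeInterval T ×ˢ (φ.target ∩ φ.symm ⁻¹' W)) := by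
    refine ContMDiffOn.prodMk (contMDiffOn_iff_contDiffOn.mpr contDiff_fst.contDiffOn) ?_
    exact (contMDiffOn_symm_of_mem_maximalAtlas (mem_real_maximalAtlas h.mem)).comp
      (contMDiffOn_iff_contDiffOn.mpr contDiff_snd.contDiffOn) fun p hp => hp.2.1
  exact (hH e (Pi.single i 1) (Pi.single j 1)).comp h1 fun p hp => ⟨hp.1, h.sub_base hp.2.2⟩

/-- The spatial derivative of the Gram matrices, up to the initial time. -/
theorem fderivWithin_gramFlow (h : IsFrameOn φ e σ W) {T : EReal}
    {H : ℝ → HermitianMetric n r V} (hH : SmoothFamily n T H) {p : ℝ × Cn n}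
    (hp : p ∈ timeInterval T ×ˢ (φ.target ∩ φ.symm ⁻¹' W)) (v : Cn n) :
    fderiv ℝ (fun y => gramAt (H p.1) e (φ.symm y)) p.2 v =
      fderivWithin ℝ (gramFlow H φ e) (timeInterval T ×ˢ (φ.target ∩ φ.symm ⁻¹' W)) p (0, v) := by
  have h1 := (((h.contDiffOn_gramFlow hH) p hp).differentiableWithinAt
    (by simp)).hasFDerivWithinAt
  have h2 : HasFDerivWithinAt (fun y : Cn n => (p.1, y)) (ContinuousLinearMap.inr ℝ ℝ (Cn n))
      (φ.target ∩ φ.symm ⁻¹' W) p.2 := (hasFDerivAt_prodMk_right p.1 p.2).hasFDerivWithinAt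
  have h3 := (HasFDerivWithinAt.comp p.2 (f := fun y : Cn n => (p.1, y)) h1 h2
    fun y hy => ⟨hp.1, hy⟩).hasFDerivAt (h.open_image.mem_nhds hp.2)
  exact DFunLike.congr_fun h3.fderiv v

theorem fderiv_gramFlow (h : IsFrameOn φ e σ W) {T : EReal}
    {H : ℝ → HermitianMetric n r V} (hH : SmoothFamily n T H) {p : ℝ × Cn n}
    (hp : p ∈ openTime T ×ˢ (φ.target ∩ φ.symm ⁻¹' W)) (v : Cn n) :
    fderiv ℝ (gramFlow H φ e) p (0, v) = fderiv ℝ (fun y => gramAt (H p.1) e (φ.symm y)) p.2 v := by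
  rw [h.fderivWithin_gramFlow hH ⟨openTime_subset T hp.1, hp.2⟩,
    fderivWithin_of_mem_nhds (Filter.mem_of_superset
      (((isOpen_openTime T).prod h.open_image).mem_nhds hp)
      (Set.prod_mono (openTime_subset T) subset_rfl))]

/-- The connection form in the real coordinates. -/
def _root_.realConn (D : ComplexConnection n r V) (φ : OpenPartialHomeomorph X (Cn n))
    (e : Trivialization (Fin r → ℂ) (π (Fin r → ℂ) V)) (σ : Fin r → Π x, V x)
    (a : Fin 2 × Fin n) (y : Cn n) : Matrix (Fin r) (Fin r) ℂ :=
  connForm D φ e σ (realBasis n a) y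

/-- `localPsi` uses the full space-time derivative of the Gram matrices, which is available at
positive times; its spatial directions agree there with the derivative of the single metric `H p.1`.
-/
theorem localPsi_eq (h : IsFrameOn φ e σ W) (D : ComplexConnection n r V) {T : EReal}
    {H : ℝ → HermitianMetric n r V} (hH : SmoothFamily n T H) {p : ℝ × Cn n}
    (hp : p ∈ openTime T ×ˢ (φ.target ∩ φ.symm ⁻¹' W)) (a : Fin 2 × Fin n) :
    localPsi (realBasis n) (gramFlow H φ e) (realConn D φ e σ) a p =
      psiAt D (H p.1) φ e (realBasis n a) (φ.symm p.2) := by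
  rw [h.psiAt_eq D (H p.1) hp.2.2, φ.right_inv hp.2.1, localPsi, h.fderiv_gramFlow hH hp]
  rfl

theorem isUnit_gramFlow (h : IsFrameOn φ e σ W) (H : ℝ → HermitianMetric n r V) {S : Set ℝ} :
    ∀ p ∈ S ×ˢ (φ.target ∩ φ.symm ⁻¹' W), IsUnit (gramFlow H φ e p).det :=
  fun p hp => h.isUnit_gramAt (H p.1) hp.2.2

theorem contDiffOn_gramFlow_open (h : IsFrameOn φ e σ W) {T : EReal}
    {H : ℝ → HermitianMetric n r V} (hH : SmoothFamily n T H) :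
    ContDiffOn ℝ ∞ (gramFlow H φ e) (openTime T ×ˢ (φ.target ∩ φ.symm ⁻¹' W)) :=
  (h.contDiffOn_gramFlow hH).mono (Set.prod_mono (openTime_subset T) subset_rfl)

theorem localNabla_eq (h : IsFrameOn φ e σ W) (D : ComplexConnection n r V) {T : EReal}
    {H : ℝ → HermitianMetric n r V} (hH : SmoothFamily n T H) {p : ℝ × Cn n}
    (hp : p ∈ openTime T ×ˢ (φ.target ∩ φ.symm ⁻¹' W)) (c a : Fin 2 × Fin n) :
    localNabla (realBasis n) (gramFlow H φ e) (realConn D φ e σ) c a p =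
      nablaPsi (connForm D φ e σ) (fun v y => psiAt D (H p.1) φ e v (φ.symm y)) (realBasis n c)
        (realBasis n a) p.2 := by
  have ho := (isOpen_openTime T).prod h.open_image
  have hs := contDiffOn_localPsi (v := realBasis n) (a := a) (A := realConn D φ e σ) ho
    (h.contDiffOn_gramFlow_open hH) (h.isUnit_gramFlow H) (h.contDiffOn_connForm D _)
  have hd := ((hs.contDiffAt (ho.mem_nhds hp)).differentiableAt (by simp)).hasFDerivAt
  have h3 := (hd.comp p.2 (f := fun y : Cn n => (p.1, y))
    (hasFDerivAt_prodMk_right p.1 p.2)).fderiv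
  have h4 : (localPsi (realBasis n) (gramFlow H φ e) (realConn D φ e σ) a ∘ fun y => (p.1, y))
      =ᶠ[𝓝 p.2] fun y => psiAt D (H p.1) φ e (realBasis n a) (φ.symm y) :=
    Filter.eventuallyEq_of_mem (h.open_image.mem_nhds hp.2) fun y hy =>
      h.localPsi_eq D hH (p := (p.1, y)) ⟨hp.1, hy⟩ a
  have h5 := DFunLike.congr_fun (h4.fderiv_eq.symm.trans h3) (realBasis n c)
  rw [localNabla, nablaPsi, h.localPsi_eq D hH hp, h.localPsi_eq D hH hp, h5]
  rfl

/-- The heat flow gives a local flow of Gram matrices. -/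
theorem localFlow (h : IsFrameOn φ e σ W) {κ : KahlerMetric n X} {D : ComplexConnection n r V}
    (hD : IsNHYM κ D) {T : EReal} {H : ℝ → HermitianMetric n r V} (hH : IsHeatFlow κ D T H) :
    LocalFlow (realBasis n) (fun a b y => κ.inv φ (φ.symm y) a b) (openTime T)
      (φ.target ∩ φ.symm ⁻¹' W) (gramFlow H φ e) (realConn D φ e σ) where
  open_I := isOpen_openTime T
  open_U := h.open_image
  smooth_H := h.contDiffOn_gramFlow_open hH.smooth
  smooth_A a := h.contDiffOn_connForm D _
  smooth_g a b := (κ.contDiffOn_inv h.mem a b).mono Set.inter_subset_left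
  symm_g y hy a b := κ.inv_symm h.mem (φ.map_target hy.1) a b
  herm p _ := gramAt_star _ _
  unit := h.isUnit_gramFlow H
  flow p hp := by
    have ht : p.1 ∈ timeInterval T := openTime_subset T hp.1
    -- At a positive time the derivative within `[0, T)` is an ordinary derivative.
    have h1 := (h.flow_gramAt hD hH ht hp.2.2).hasDerivAt
      (Filter.mem_of_superset ((isOpen_openTime T).mem_nhds hp.1) (openTime_subset T))
    have hd := (((h.contDiffOn_gramFlow_open hH.smooth).contDiffAt
      (((isOpen_openTime T).prod h.open_image).mem_nhds hp)).differentiableAt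
        (by simp)).hasFDerivAt
    have h2 := hd.comp_hasDerivAt p.1 ((hasDerivAt_id p.1).prodMk (hasDerivAt_const p.1 p.2))
    have h3 := h2.unique h1
    refine h3.trans ?_
    simp only [h.localNabla_eq D hH.smooth hp, φ.right_inv hp.2.1]
    rfl

theorem continuousOn_fderivWithin_gramFlow (h : IsFrameOn φ e σ W) {T : EReal} (hT : 0 < T)
    {H : ℝ → HermitianMetric n r V} (hH : SmoothFamily n T H) (v : Cn n) :
    ContinuousOn (fun p : ℝ × Cn n => fderiv ℝ (fun y => gramAt (H p.1) e (φ.symm y)) p.2 v)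
      (timeInterval T ×ˢ (φ.target ∩ φ.symm ⁻¹' W)) := by
  have hu : UniqueDiffOn ℝ (timeInterval T ×ˢ (φ.target ∩ φ.symm ⁻¹' W)) :=
    (uniqueDiffOn_timeInterval hT).prod h.open_image.uniqueDiffOn
  refine (((h.contDiffOn_gramFlow hH).continuousOn_fderivWithin hu (by simp)).clm_apply
    (continuousOn_const (c := ((0 : ℝ), v)))).congr fun p hp => ?_
  exact h.fderivWithin_gramFlow hH hp v

/-- `ψ` depends continuously on time and space, up to the initial time. -/
theorem continuousOn_psiAt (h : IsFrameOn φ e σ W) (D : ComplexConnection n r V) {T : EReal}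
    (hT : 0 < T) {H : ℝ → HermitianMetric n r V} (hH : SmoothFamily n T H) (v : Cn n) :
    ContinuousOn (fun p : ℝ × Cn n => psiAt D (H p.1) φ e v (φ.symm p.2))
      (timeInterval T ×ˢ (φ.target ∩ φ.symm ⁻¹' W)) := by
  have hG := h.contDiffOn_gramFlow hH
  have hA : ContinuousOn (fun p : ℝ × Cn n => connForm D φ e σ v p.2)
      (timeInterval T ×ˢ (φ.target ∩ φ.symm ⁻¹' W)) :=
    (h.contDiffOn_connForm D v).continuousOn.comp continuousOn_snd fun p hp => hp.2
  have hinv : ContinuousOn (fun p => (gramFlow H φ e p)⁻¹)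
      (timeInterval T ×ˢ (φ.target ∩ φ.symm ⁻¹' W)) :=
    (contDiffOn_matrix_inv hG (h.isUnit_gramFlow H)).continuousOn
  have hA' := (starL' ℝ : Matrix (Fin r) (Fin r) ℂ ≃L[ℝ] _).continuous.comp_continuousOn hA
  have h1 := (hinv.mul (((h.continuousOn_fderivWithin_gramFlow hT hH v).sub
    (hA'.mul hG.continuousOn)).sub (hG.continuousOn.mul hA))).const_smul (-1 / 2 : ℝ)
  refine h1.congr fun p hp => ?_
  have h2 := h.psiAt_eq D (H p.1) hp.2.2 v
  rw [φ.right_inv hp.2.1] at h2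
  exact h2

end IsFrameOn

end FrameFlow

/-! ### The logarithm of the relative endomorphism -/

section RelativeLog

set_option linter.unusedSectionVars false

variable {W : Type*} [AddCommGroup W] [Module ℂ W] [FiniteDimensional ℂ W]

theorem trace_of_eigenbasis {ι : Type*} [Fintype ι] [DecidableEq ι] (b : Module.Basis ι ℂ W)
    {f : Module.End ℂ W} {c : ι → ℂ} (h : ∀ i, f (b i) = c i • b i) :
    LinearMap.trace ℂ W f = ∑ i, c i := by
  rw [LinearMap.trace_eq_matrix_trace ℂ b f, Matrix.trace]
  refine Finset.sum_congr rfl fun i _ => ?_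
  simp [LinearMap.toMatrix_apply, h]

/-- The eigenvalues of `K⁻¹ H` are controlled by the norm of its logarithm. -/
theorem exists_relEnd_eigenbasis {K H : W →ₗ⋆[ℂ] W →ₗ[ℂ] ℂ} (hK : IsHermitianInner K)
    (hH : IsHermitianInner H) {C : ℝ} (hC : endNorm hK (logEnd hK hH) < C) :
    ∃ (b : Module.Basis (Fin (Module.finrank ℂ W)) ℂ W) (l : Fin (Module.finrank ℂ W) → ℝ),
      (∀ i j, K (b i) (b j) = if i = j then 1 else 0) ∧
      (∀ i, relEnd hK H (b i) = (l i : ℂ) • b i) ∧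
      ∀ i, Real.exp (-C) ≤ l i ∧ l i ≤ Real.exp C := by
  have hsa : IsSelfAdjointFor K (relEnd hK H) := by
    intro u w
    rw [relEnd, rieszEnd_spec, ← hK.conj_symm, rieszEnd_spec, hH.conj_symm]
  obtain ⟨b, l, hb, hl⟩ := hK.exists_eigenbasis hsa
  refine ⟨b, l, hb, hl, ?_⟩
  have hpos : ∀ i, 0 < l i := fun i => by
    have h1 := hH.pos (b i) (b.ne_zero i)
    rw [← rieszEnd_spec hK H, ← relEnd, hl] at h1
    simpa [hb] using h1
  have hs : ∀ i, logEnd hK hH (b i) = (Real.log (l i) : ℂ) • b i := fun i =>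
    logEnd_spec hK hH _ _ (hl i)
  -- The logarithm is diagonal in an orthonormal basis with real eigenvalues, hence self-adjoint, so
  -- the product with its adjoint has the eigenvalues `(log l_i)²`.
  have hss : ∀ i, (adjointFor hK (logEnd hK hH) * logEnd hK hH) (b i) =
      ((Real.log (l i) ^ 2 : ℝ) : ℂ) • b i := fun i => by
    refine hK.ext_right fun u => ?_
    rw [Module.End.mul_apply, adjointFor_spec, hs]
    have h1 : K (logEnd hK hH u) (b i) = (Real.log (l i) : ℂ) * K u (b i) := by
      have h2 : (K.flip (b i)).comp (logEnd hK hH) =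
          ((Real.log (l i) : ℝ) : ℂ) • K.flip (b i) := b.ext fun j => by
        simp only [LinearMap.comp_apply, LinearMap.flip_apply, hs, LinearMap.smul_apply,
          LinearMap.map_smulₛₗ, hb, Complex.conj_ofReal, smul_eq_mul]
        split_ifs with hji
        · rw [hji]
        · simp
      exact LinearMap.congr_fun h2 u
    rw [map_smul, map_smul, h1, smul_eq_mul, smul_eq_mul]
    push_cast
    ring
  intro i
  rw [endNorm, endInner, trace_of_eigenbasis b hss, Complex.re_sum] at hC
  simp only [Complex.ofReal_re] at hC
  have hC0 : 0 < C := (Real.sqrt_nonneg _).trans_lt hC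
  -- Each square is at most the trace, so `|log l_i| < C`.
  have h1 : Real.log (l i) ^ 2 < C ^ 2 :=
    lt_of_le_of_lt (Finset.single_le_sum (f := fun i => Real.log (l i) ^ 2)
      (fun j _ => sq_nonneg _) (Finset.mem_univ i)) ((Real.sqrt_lt' hC0).mp hC)
  have h2 := abs_lt.mp (abs_lt_of_sq_lt_sq h1 hC0.le)
  exact ⟨((Real.lt_log_iff_exp_lt (hpos i)).mp h2.1).le,
    ((Real.log_lt_iff_lt_exp (hpos i)).mp h2.2).le⟩

/-- In a `K`-orthonormal eigenbasis of `K⁻¹ H` the two quadratic forms are `∑ |u_i|²` and `∑ l_i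
|u_i|²`. -/
theorem inner_self_bounds {K H : W →ₗ⋆[ℂ] W →ₗ[ℂ] ℂ} (hK : IsHermitianInner K)
    (hH : IsHermitianInner H) {C : ℝ} (hC : endNorm hK (logEnd hK hH) < C) (u : W) :
    Real.exp (-C) * (K u u).re ≤ (H u u).re ∧ (H u u).re ≤ Real.exp C * (K u u).re := by
  obtain ⟨b, l, hb, hl, hlC⟩ := exists_relEnd_eigenbasis hK hH hC
  have hK' : (K u u).re = ∑ i, Complex.normSq (b.repr u i) := by
    conv_lhs => rw [← b.sum_repr u]
    simp only [map_sum, map_smul]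
    simp [hb, Complex.normSq_apply]
  have hH' : (H u u).re = ∑ i, l i * Complex.normSq (b.repr u i) := by
    rw [← rieszEnd_spec hK H, ← relEnd]
    conv_lhs => rw [← b.sum_repr u]
    simp only [map_sum, map_smul, hl]
    simp [hb, Complex.normSq_apply]
    exact Finset.sum_congr rfl fun i _ => by ring
  rw [hK', hH', Finset.mul_sum, Finset.mul_sum]
  exact ⟨Finset.sum_le_sum fun i _ => mul_le_mul_of_nonneg_right (hlC i).1 (Complex.normSq_nonneg _),
    Finset.sum_le_sum fun i _ => mul_le_mul_of_nonneg_right (hlC i).2 (Complex.normSq_nonneg _)⟩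

theorem trace_relEnd_bounds {K H : W →ₗ⋆[ℂ] W →ₗ[ℂ] ℂ} (hK : IsHermitianInner K)
    (hH : IsHermitianInner H) {C : ℝ} (hC : endNorm hK (logEnd hK hH) < C) :
    0 ≤ (LinearMap.trace ℂ W (relEnd hK H)).re ∧
      (LinearMap.trace ℂ W (relEnd hK H)).re ≤ Module.finrank ℂ W * Real.exp C := by
  obtain ⟨b, l, hb, hl, hlC⟩ := exists_relEnd_eigenbasis hK hH hC
  rw [trace_of_eigenbasis b hl, Complex.re_sum]
  simp only [Complex.ofReal_re]
  refine ⟨Finset.sum_nonneg fun i _ => (Real.exp_pos _).le.trans (hlC i).1, ?_⟩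
  refine (Finset.sum_le_sum fun i _ => (hlC i).2).trans ?_
  simp

end RelativeLog

/-! ### The energy density -/

section Energy

set_option linter.unusedSectionVars false

open scoped Matrix ComplexOrder

attribute [local instance] Matrix.frobeniusNormedRing Matrix.frobeniusNormedAlgebra
  normedStarGroup_matrix

variable {n r : ℕ} {X : Type*} [TopologicalSpace X] [ChartedSpace (Cn n) X]
  [IsManifold 𝓘(ℂ, Cn n) ω X]
  {V : X → Type*} [TopologicalSpace (TotalSpace (Fin r → ℂ) V)]
  [∀ x, AddCommGroup (V x)] [∀ x, Module ℂ (V x)] [∀ x, TopologicalSpace (V x)]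
  [∀ x, IsTopologicalAddGroup (V x)] [∀ x, ContinuousSMul ℝ (V x)]
  [FiberBundle (Fin r → ℂ) V] [VectorBundle ℝ (Fin r → ℂ) V] [VectorBundle ℂ (Fin r → ℂ) V]
  [ContMDiffVectorBundle ∞ (Fin r → ℂ) V 𝓘(ℝ, Cn n)]

/-- The energy density `|ψ_H|²`. -/
def energy (κ : KahlerMetric n X) (D : ComplexConnection n r V) (H : HermitianMetric n r V)
    (x : X) : ℝ :=
  haveI : FiniteDimensional ℂ (V x) := VectorBundle.finiteDimensional ℂ (Fin r → ℂ) V x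
  ∑ a, ∑ b, κ.inv (chartAt (Cn n) x) x a b *
    (endInner (H.isInner x) (psi D H x (coordField (chartAt (Cn n) x) (realBasis n a) x))
      (psi D H x (coordField (chartAt (Cn n) x) (realBasis n b) x))).re

theorem psiNorm_eq (κ : KahlerMetric n X) (D : ComplexConnection n r V) (H : HermitianMetric n r V)
    (x : X) : psiNorm κ D H x = √(energy κ D H x) := rfl

/-- The trace of `K⁻¹ H`. -/
def relTrace (K H : HermitianMetric n r V) (x : X) : ℝ :=
  haveI : FiniteDimensional ℂ (V x) := VectorBundle.finiteDimensional ℂ (Fin r → ℂ) V x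
  (LinearMap.trace ℂ (V x) (relEnd (K.isInner x) (H.inner x))).re

theorem relTrace_bounds {K H : HermitianMetric n r V} {C : ℝ} {x : X} (hC : logNorm K H x < C) :
    0 ≤ relTrace K H x ∧ relTrace K H x ≤ r * Real.exp C := by
  have : FiniteDimensional ℂ (V x) := VectorBundle.finiteDimensional ℂ (Fin r → ℂ) V x
  have h := trace_relEnd_bounds (K.isInner x) (H.isInner x) hC
  rwa [VectorBundle.finrank_eq ℂ (Fin r → ℂ) V x, Module.finrank_fin_fun] at h

section

variable {e : Trivialization (Fin r → ℂ) (π (Fin r → ℂ) V)} [MemTrivializationAtlas e]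

theorem relTrace_eq (K H : HermitianMetric n r V) {x : X} (hx : x ∈ e.baseSet) :
    relTrace K H x = reTr ((gramAt K e x)⁻¹ * gramAt H e x) := by
  have : FiniteDimensional ℂ (V x) := VectorBundle.finiteDimensional ℂ (Fin r → ℂ) V x
  have h : gramAt K e x * endMat e x (relEnd (K.isInner x) (H.inner x)) = gramAt H e x := by
    refine Matrix.ext fun i j => ?_
    rw [← gramAt_mul K hx, ← apply_symm hx, relEnd, rieszEnd_spec]
    rfl
  rw [relTrace, trace_eq hx, ← h, Matrix.nonsing_inv_mul_cancel_left _ _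
    ((Matrix.isUnit_iff_isUnit_det _).mp (gramAt_posDef K hx).isUnit), reTr]

theorem gramAt_sub_posSemidef {K H : HermitianMetric n r V} {x : X} (hx : x ∈ e.baseSet) {c d : ℝ}
    (h : ∀ u, c * (K.inner x u u).re ≤ d * (H.inner x u u).re) :
    (d • gramAt H e x - c • gramAt K e x).PosSemidef := by
  have him : ∀ (H : HermitianMetric n r V) (u : V x), (H.inner x u u).im = 0 := fun H u =>
    Complex.conj_eq_iff_im.mp ((H.isInner x).conj_symm u u)
  refine Matrix.PosSemidef.of_dotProduct_mulVec_nonneg ?_ fun a => ?_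
  · change star _ = _
    rw [star_sub, star_smul, star_smul, gramAt_star, gramAt_star, star_trivial, star_trivial]
  · rw [Matrix.sub_mulVec, Matrix.smul_mulVec, Matrix.smul_mulVec, dotProduct_sub,
      dotProduct_smul, dotProduct_smul, ← inner_symm H hx, ← inner_symm K hx, Complex.nonneg_iff]
    simp [him, h]

/-- This is `e^{-C} K ≤ H ≤ e^C K` in matrix form. It and `relTrace_bounds` are the two ways in
which the bound on the logarithm is used. -/
theorem logNorm_gramAt {K H : HermitianMetric n r V} {C : ℝ} {x : X} (hC : logNorm K H x < C)
    (hx : x ∈ e.baseSet) : (gramAt H e x - Real.exp (-C) • gramAt K e x).PosSemidef ∧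
      (Real.exp C • gramAt K e x - gramAt H e x).PosSemidef := by
  have : FiniteDimensional ℂ (V x) := VectorBundle.finiteDimensional ℂ (Fin r → ℂ) V x
  have h := inner_self_bounds (K.isInner x) (H.isInner x) hC
  constructor
  · simpa using gramAt_sub_posSemidef (K := K) (H := H) hx (c := Real.exp (-C)) (d := 1)
      fun u => by simpa using (h u).1
  · simpa using gramAt_sub_posSemidef (K := H) (H := K) hx (c := 1) (d := Real.exp C)
      fun u => by simpa using (h u).2

end

namespace IsFrameOn

variable {e : Trivialization (Fin r → ℂ) (π (Fin r → ℂ) V)} [MemTrivializationAtlas e]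
  {φ : OpenPartialHomeomorph X (Cn n)} {σ : Fin r → Π x, V x} {W : Set X}

/-- `energy` is defined with the preferred chart of each point, which varies with the point. Chart
independence of the contraction moves it to one fixed chart, and self-adjointness of `ψ` removes the
adjoint. -/
theorem energy_eq (h : IsFrameOn φ e σ W) (κ : KahlerMetric n X) (D : ComplexConnection n r V)
    (H : HermitianMetric n r V) {x : X} (hx : x ∈ W) :
    energy κ D H x = ∑ a, ∑ b, κ.inv φ x a b *
      reTr (psiAt D H φ e (realBasis n a) x * psiAt D H φ e (realBasis n b) x) := by
  have : FiniteDimensional ℂ (V x) := VectorBundle.finiteDimensional ℂ (Fin r → ℂ) V x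
  have hxb := h.sub_base hx
  let T : TangentSpace 𝓘(ℝ, Cn n) x →ₗ[ℝ] TangentSpace 𝓘(ℝ, Cn n) x →ₗ[ℝ] ℝ :=
    LinearMap.mk₂ ℝ (fun v w => (LinearMap.trace ℂ (V x) (psi D H x v * psi D H x w)).re)
      (fun v v' w => by simp [add_mul]) (fun c v w => by
        simp only [map_smul]
        rw [smul_mul_assoc, ← Complex.coe_smul, map_smul]
        simp) (fun v w w' => by simp [mul_add]) (fun c v w => by
        simp only [map_smul]
        rw [mul_smul_comm, ← Complex.coe_smul, map_smul]
        simp)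
  have h1 := κ.sum_inv_chart h.mem (h.sub_source hx) (IsManifold.chart_mem_maximalAtlas x)
    (mem_chart_source (Cn n) x) T
  have h2 : ∀ v w, (endInner (H.isInner x) (psi D H x v) (psi D H x w)).re = T v w := fun v w => by
    have : adjointFor (H.isInner x) (psi D H x v) = psi D H x v := LinearMap.ext fun w =>
      (H.isInner x).ext_right fun u => by
        rw [adjointFor_spec, (psi_spec D H x).selfAdjoint v]
    rw [endInner, this]
    rfl
  have h3 : ∀ v w, T v w = reTr (endMat e x (psi D H x v) * endMat e x (psi D H x w)) :=
    fun v w => by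
      rw [← endMat_mul hxb, reTr, ← trace_eq hxb]
      rfl
  simp only [energy, h2]
  simp only [smul_eq_mul] at h1
  rw [h1]
  simp only [h3, psiAt]

theorem energy_symm (h : IsFrameOn φ e σ W) (κ : KahlerMetric n X) (D : ComplexConnection n r V)
    {T : EReal} {H : ℝ → HermitianMetric n r V} (hH : SmoothFamily n T H) {p : ℝ × Cn n}
    (hp : p ∈ openTime T ×ˢ (φ.target ∩ φ.symm ⁻¹' W)) :
    energy κ D (H p.1) (φ.symm p.2) = localEnergy (realBasis n)
      (fun a b y => κ.inv φ (φ.symm y) a b) (gramFlow H φ e) (realConn D φ e σ) p := by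
  rw [h.energy_eq κ D _ hp.2.2]
  simp only [localEnergy, h.localPsi_eq D hH hp]

theorem relTrace_symm (h : IsFrameOn φ e σ W) (K : HermitianMetric n r V)
    (H : ℝ → HermitianMetric n r V) {p : ℝ × Cn n} (hp : p.2 ∈ φ.target ∩ φ.symm ⁻¹' W) :
    relTrace K (H p.1) (φ.symm p.2) = reTr ((gramAt K e (φ.symm p.2))⁻¹ * gramFlow H φ e p) :=
  relTrace_eq K (H p.1) (h.sub_base hp.2)

theorem continuousOn_energy_symm (h : IsFrameOn φ e σ W) (κ : KahlerMetric n X)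
    (D : ComplexConnection n r V) {T : EReal} (hT : 0 < T) {H : ℝ → HermitianMetric n r V}
    (hH : SmoothFamily n T H) :
    ContinuousOn (fun p : ℝ × Cn n => energy κ D (H p.1) (φ.symm p.2))
      (timeInterval T ×ˢ (φ.target ∩ φ.symm ⁻¹' W)) := by
  have h1 : ContinuousOn (fun p : ℝ × Cn n => ∑ a, ∑ b, κ.inv φ (φ.symm p.2) a b *
      reTr (psiAt D (H p.1) φ e (realBasis n a) (φ.symm p.2) *
        psiAt D (H p.1) φ e (realBasis n b) (φ.symm p.2)))
      (timeInterval T ×ˢ (φ.target ∩ φ.symm ⁻¹' W)) := by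
    refine continuousOn_finsetSum _ fun a _ => continuousOn_finsetSum _ fun b _ =>
      ContinuousOn.mul ?_ ?_
    · exact (κ.contDiffOn_inv h.mem a b).continuousOn.comp continuousOn_snd fun p hp => hp.2.1
    · exact (reTrL r).continuous.comp_continuousOn
        ((h.continuousOn_psiAt D hT hH _).mul (h.continuousOn_psiAt D hT hH _))
  exact h1.congr fun p hp => h.energy_eq κ D _ hp.2.2

theorem contDiffOn_inv_gramAt (h : IsFrameOn φ e σ W) (K : HermitianMetric n r V) :
    ContDiffOn ℝ ∞ (fun y => (gramAt K e (φ.symm y))⁻¹) (φ.target ∩ φ.symm ⁻¹' W) :=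
  contDiffOn_matrix_inv (h.contDiffOn_gramAt K) fun _ hy => h.isUnit_gramAt K hy.2

theorem continuousOn_relTrace_symm (h : IsFrameOn φ e σ W) (K : HermitianMetric n r V) {T : EReal}
    {H : ℝ → HermitianMetric n r V} (hH : SmoothFamily n T H) :
    ContinuousOn (fun p : ℝ × Cn n => relTrace K (H p.1) (φ.symm p.2))
      (timeInterval T ×ˢ (φ.target ∩ φ.symm ⁻¹' W)) := by
  have h1 : ContinuousOn (fun p : ℝ × Cn n => (gramAt K e (φ.symm p.2))⁻¹)
      (timeInterval T ×ˢ (φ.target ∩ φ.symm ⁻¹' W)) :=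
    (h.contDiffOn_inv_gramAt K).continuousOn.comp continuousOn_snd fun p hp => hp.2
  exact ((reTrL r).continuous.comp_continuousOn
    (h1.mul (h.contDiffOn_gramFlow hH).continuousOn)).congr fun p hp =>
      h.relTrace_symm K H hp.2

theorem continuousOn_of_symm (h : IsFrameOn φ e σ W) {S : Set ℝ} {f : ℝ → X → ℝ}
    (hf : ContinuousOn (fun p : ℝ × Cn n => f p.1 (φ.symm p.2))
      (S ×ˢ (φ.target ∩ φ.symm ⁻¹' W))) :
    ContinuousOn (fun p : ℝ × X => f p.1 p.2) (S ×ˢ W) := by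
  have h2 : ContinuousOn (fun p : ℝ × X => (p.1, φ p.2)) (S ×ˢ W) :=
    continuousOn_fst.prodMk ((φ.continuousOn.mono h.sub_source).comp continuousOn_snd
      fun p hp => hp.2)
  refine (hf.comp h2 fun p hp => ⟨hp.1, h.map_mem hp.2⟩).congr fun p hp => ?_
  simp only [Function.comp_apply, φ.left_inv (h.sub_source hp.2)]

end IsFrameOn

/-- Continuity is local, and the patches of `exists_isFrameOn` cover `X`. -/
theorem continuousOn_of_frames [T2Space X] {S : Set ℝ} {f : ℝ → X → ℝ}
    (hf : ∀ (e : Trivialization (Fin r → ℂ) (π (Fin r → ℂ) V)) [MemTrivializationAtlas e]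
      (φ : OpenPartialHomeomorph X (Cn n)) (σ : Fin r → Π x, V x) (W : Set X),
      IsFrameOn φ e σ W → ContinuousOn (fun p : ℝ × Cn n => f p.1 (φ.symm p.2))
        (S ×ˢ (φ.target ∩ φ.symm ⁻¹' W))) :
    ContinuousOn (fun p : ℝ × X => f p.1 p.2) (S ×ˢ Set.univ) := by
  intro p hp
  obtain ⟨σ, W, hx, h⟩ := exists_isFrameOn (n := n) (r := r) (V := V) p.2
  refine ((h.continuousOn_of_symm (hf _ _ _ _ h)) p ⟨hp.1, hx⟩).mono_of_mem_nhdsWithin ?_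
  filter_upwards [self_mem_nhdsWithin, mem_nhdsWithin_of_mem_nhds
    (continuous_snd.continuousAt.preimage_mem_nhds (h.open_W.mem_nhds hx))] with q hq hq'
  exact ⟨hq.1, hq'⟩

theorem continuousOn_energy [T2Space X] (κ : KahlerMetric n X) (D : ComplexConnection n r V)
    {T : EReal} (hT : 0 < T) {H : ℝ → HermitianMetric n r V} (hH : SmoothFamily n T H) :
    ContinuousOn (fun p : ℝ × X => energy κ D (H p.1) p.2) (timeInterval T ×ˢ Set.univ) :=
  continuousOn_of_frames (V := V) (f := fun t x => energy κ D (H t) x) fun _ _ _ _ _ h =>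
    h.continuousOn_energy_symm κ D hT hH

theorem continuousOn_relTrace [T2Space X] (K : HermitianMetric n r V)
    {T : EReal} {H : ℝ → HermitianMetric n r V} (hH : SmoothFamily n T H) :
    ContinuousOn (fun p : ℝ × X => relTrace K (H p.1) p.2) (timeInterval T ×ˢ Set.univ) :=
  continuousOn_of_frames (V := V) (f := fun t x => relTrace K (H t) x) fun _ _ _ _ _ h =>
    h.continuousOn_relTrace_symm K hH

theorem exists_energy_le [T2Space X] [CompactSpace X] (κ : KahlerMetric n X)
    (D : ComplexConnection n r V) (K : HermitianMetric n r V) :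
    ∃ C : ℝ, ∀ x, energy κ D K x ≤ C := by
  -- The constant family with value `K`, restricted to `t = 0`, reduces the claim to joint
  -- continuity.
  have h := continuousOn_energy κ D (T := ⊤) EReal.zero_lt_top (smoothFamily_const ⊤ K)
  have h1 : Continuous fun x : X => energy κ D K x := by
    rw [← continuousOn_univ]
    exact h.comp (f := fun x : X => ((0 : ℝ), x)) (Continuous.continuousOn (by fun_prop))
      fun x _ => ⟨⟨le_rfl, EReal.coe_lt_top 0⟩, trivial⟩
  obtain ⟨C, hC⟩ := (isCompact_range h1).bddAbove
  exact ⟨C, fun x => hC ⟨x, rfl⟩⟩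

end Energy

/-! ### Positive matrices -/

section PositiveMatrices

set_option linter.unusedSectionVars false

open scoped Matrix ComplexOrder

variable {𝕜 m : Type*} [RCLike 𝕜] [Fintype m] [DecidableEq m]

/-- With `D = B - A`, the identity `A⁻¹ - B⁻¹ = B⁻¹ D B⁻¹ + B⁻¹ D A⁻¹ D B⁻¹` writes the difference
as a sum of positive matrices. -/
theorem Matrix.PosDef.inv_sub_inv_posSemidef {A B : Matrix m m 𝕜} (hA : A.PosDef) (hB : B.PosDef)
    (h : (B - A).PosSemidef) : (A⁻¹ - B⁻¹).PosSemidef := by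
  have hB' : (B⁻¹).conjTranspose = B⁻¹ := hB.inv.1
  have hD' : (B - A).conjTranspose = B - A := h.1
  have h1 := h.conjTranspose_mul_mul_same B⁻¹
  have h2 := hA.inv.posSemidef.conjTranspose_mul_mul_same ((B - A) * B⁻¹)
  have h3 := h1.add h2
  rw [Matrix.conjTranspose_mul, hB', hD'] at h3
  have hAA : A⁻¹ * A = 1 := Matrix.nonsing_inv_mul _ ((Matrix.isUnit_iff_isUnit_det _).mp hA.isUnit)
  have hBB : B⁻¹ * B = 1 := Matrix.nonsing_inv_mul _ ((Matrix.isUnit_iff_isUnit_det _).mp hB.isUnit)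
  have hBB' : B * B⁻¹ = 1 := Matrix.mul_nonsing_inv _ ((Matrix.isUnit_iff_isUnit_det _).mp hB.isUnit)
  convert h3 using 1
  have e : (B - A) * B⁻¹ + (B - A) * A⁻¹ * ((B - A) * B⁻¹) = (B - A) * A⁻¹ := by
    have : (B - A) * A⁻¹ * ((B - A) * B⁻¹) =
        (B - A) * A⁻¹ * (B * B⁻¹) - (B - A) * (A⁻¹ * A) * B⁻¹ := by noncomm_ring
    rw [this, hAA, hBB']
    noncomm_ring
  have e2 : B⁻¹ * (B - A) * B⁻¹ + B⁻¹ * (B - A) * A⁻¹ * ((B - A) * B⁻¹) =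
      B⁻¹ * ((B - A) * B⁻¹ + (B - A) * A⁻¹ * ((B - A) * B⁻¹)) := by noncomm_ring
  have hAA' : A * A⁻¹ = 1 := Matrix.mul_nonsing_inv _ ((Matrix.isUnit_iff_isUnit_det _).mp hA.isUnit)
  rw [e2, e, ← mul_assoc, mul_sub, hBB, sub_mul, one_mul, mul_assoc, hAA', mul_one]

theorem Matrix.PosSemidef.sub_smul_mono {A : Matrix m m 𝕜} {c d : ℝ} (h : (A - c • 1).PosSemidef)
    (hdc : d ≤ c) : (A - d • 1).PosSemidef := by
  have := h.add (Matrix.PosSemidef.one.smul (sub_nonneg.mpr hdc))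
  rwa [sub_smul, sub_add_sub_cancel] at this

/-- A continuous family of positive definite matrices on a compact set is uniformly positive. -/
theorem exists_pos_sub_posSemidef {Y : Type*} [TopologicalSpace Y] {S : Set Y} (hS : IsCompact S)
    {P : Y → Matrix m m 𝕜} (hP : ∀ i j, ContinuousOn (fun x => P x i j) S)
    (hpd : ∀ x ∈ S, (P x).PosDef) : ∃ c : ℝ, 0 < c ∧ ∀ x ∈ S, (P x - c • 1).PosSemidef := by
  have hc : ContinuousOn (fun q : Y × (m → 𝕜) => RCLike.re (star q.2 ⬝ᵥ (P q.1 *ᵥ q.2)))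
      (S ×ˢ Metric.sphere 0 1) := by
    refine RCLike.continuous_re.comp_continuousOn ?_
    simp only [dotProduct, Matrix.mulVec, Pi.star_apply]
    have h2 : ∀ i, ContinuousOn (fun q : Y × (m → 𝕜) => q.2 i) (S ×ˢ Metric.sphere 0 1) :=
      fun i => Continuous.continuousOn (by fun_prop)
    refine continuousOn_finsetSum _ fun i _ => (h2 i).star.mul <|
      continuousOn_finsetSum _ fun j _ => ContinuousOn.mul ?_ (h2 j)
    exact (hP i j).comp continuousOn_fst fun q hq => hq.1
  obtain ⟨a, ha, hb⟩ := (hS.prod (isCompact_sphere (0 : m → 𝕜) 1)).exists_forall_le' hc (a := 0)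
    fun q hq => (hpd q.1 hq.1).re_dotProduct_pos (by
      rintro h0
      have := hq.2
      rw [h0] at this
      simp at this)
  -- The sphere is that of the sup norm, and `∑ |u_i|²` may exceed `‖u‖²` by a factor of the
  -- cardinality. The `+ 1` keeps the denominator positive for empty `m`.
  refine ⟨a / (Fintype.card m + 1), by positivity, fun x hx => ?_⟩
  refine Matrix.PosSemidef.of_dotProduct_mulVec_nonneg ?_ fun u => ?_
  · have h1 : (P x).conjTranspose = P x := (hpd x hx).1
    rw [Matrix.IsHermitian, Matrix.conjTranspose_sub, h1, Matrix.conjTranspose_smul,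
      Matrix.conjTranspose_one, star_trivial]
  · have hu : star u ⬝ᵥ u = ((∑ i, ‖u i‖ ^ 2 : ℝ) : 𝕜) := by
      simp only [dotProduct, Pi.star_apply, RCLike.star_def, RCLike.conj_mul]
      push_cast
      rfl
    have him : RCLike.im (star u ⬝ᵥ (P x *ᵥ u)) = 0 := (hpd x hx).1.im_star_dotProduct_mulVec_self u
    rw [Matrix.sub_mulVec, Matrix.smul_mulVec, Matrix.one_mulVec, dotProduct_sub, dotProduct_smul,
      hu, RCLike.nonneg_iff]
    simp only [map_sub, RCLike.smul_re, RCLike.smul_im, RCLike.ofReal_re, RCLike.ofReal_im, him,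
      mul_zero, sub_zero, and_true, sub_nonneg]
    have h1 : ∑ i, ‖u i‖ ^ 2 ≤ Fintype.card m * ‖u‖ ^ 2 := by
      refine (Finset.sum_le_sum fun i _ => pow_le_pow_left₀ (norm_nonneg _) (norm_le_pi_norm u i)
        2).trans ?_
      simp
    have h2 : a * ‖u‖ ^ 2 ≤ RCLike.re (star u ⬝ᵥ (P x *ᵥ u)) := by
      by_cases h0 : u = 0
      · simp [h0]
      have hn : ‖u‖ ≠ 0 := norm_ne_zero_iff.mpr h0
      have h3 := hb (x, ((‖u‖⁻¹ : ℝ) : 𝕜) • u) ⟨hx, by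
        simp [norm_smul, inv_mul_cancel₀ hn]⟩
      simp only [Matrix.mulVec_smul, star_smul, smul_dotProduct, dotProduct_smul, smul_eq_mul,
        RCLike.star_def, RCLike.conj_ofReal, RCLike.re_ofReal_mul] at h3
      have h4 := mul_le_mul_of_nonneg_right h3 (sq_nonneg ‖u‖)
      refine h4.trans (le_of_eq ?_)
      field_simp
    refine le_trans ?_ h2
    rw [div_mul_eq_mul_div, div_le_iff₀ (by positivity)]
    nlinarith [sq_nonneg ‖u‖]

end PositiveMatrices

/-! ### The maximum principle for the heat operator -/

section MaximumPrinciple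

variable {E : Type*} [NormedAddCommGroup E] [NormedSpace ℝ E] {ι : Type*} [Fintype ι]

theorem differentiableAt_fderiv {F : Type*} [NormedAddCommGroup F] [NormedSpace ℝ F] {f : F → ℝ}
    {p : F} (hf : ContDiffAt ℝ 2 f p) : DifferentiableAt ℝ (fderiv ℝ f) p :=
  ContDiffAt.differentiableAt (n := 1) (hf.fderiv_right (by norm_num)) (by simp)

theorem eventually_differentiableAt {F : Type*} [NormedAddCommGroup F] [NormedSpace ℝ F] {f : F → ℝ}
    {p : F} (hf : ContDiffAt ℝ 2 f p) : ∀ᶠ q in 𝓝 p, DifferentiableAt ℝ f q := by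
  filter_upwards [hf.eventually (by simp)] with q hq using hq.differentiableAt (by simp)

theorem fderiv_fderiv_apply {F : Type*} [NormedAddCommGroup F] [NormedSpace ℝ F] {f : F → ℝ}
    {p : F} (hf : ContDiffAt ℝ 2 f p) (w w' : F) :
    fderiv ℝ (fun q => fderiv ℝ f q w) p w' = fderiv ℝ (fderiv ℝ f) p w' w := by
  have h := ((ContinuousLinearMap.apply ℝ ℝ w).hasFDerivAt.comp p
    (differentiableAt_fderiv hf).hasFDerivAt).fderiv
  exact DFunLike.congr_fun h w'

theorem heatOp_eq_hessian {v : ι → E} {g : ι → ι → E → ℝ} {f : ℝ × E → ℝ} {p : ℝ × E}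
    (hf : ContDiffAt ℝ 2 f p) : heatOp v g f p =
      ∑ c, ∑ k, g c k p.2 * fderiv ℝ (fderiv ℝ f) p (0, v c) (0, v k) - fderiv ℝ f p (1, 0) := by
  simp only [heatOp, fderiv_fderiv_apply hf]

theorem heatOp_add_const_mul {v : ι → E} {g : ι → ι → E → ℝ} {f f' : ℝ × E → ℝ} {p : ℝ × E}
    (hf : ContDiffAt ℝ 2 f p) (hf' : ContDiffAt ℝ 2 f' p) (a : ℝ) :
    heatOp v g (fun q => f q + a * f' q) p = heatOp v g f p + a * heatOp v g f' p := by
  have h0 : ∀ q : ℝ × E, DifferentiableAt ℝ f q → DifferentiableAt ℝ f' q →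
      fderiv ℝ (fun q => f q + a * f' q) q = fderiv ℝ f q + a • fderiv ℝ f' q := fun q h h' =>
    (h.hasFDerivAt.add (h'.hasFDerivAt.const_mul a)).fderiv
  have h1 : fderiv ℝ (fun q => f q + a * f' q) =ᶠ[𝓝 p]
      fun q => fderiv ℝ f q + a • fderiv ℝ f' q := by
    filter_upwards [eventually_differentiableAt hf, eventually_differentiableAt hf'] with q h h'
    exact h0 q h h'
  have h2 := ((differentiableAt_fderiv hf).hasFDerivAt.add
    ((differentiableAt_fderiv hf').hasFDerivAt.const_smul a)).fderiv
  rw [heatOp_eq_hessian hf, heatOp_eq_hessian hf',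
    heatOp_eq_hessian (hf.add (contDiffAt_const.mul hf')), h1.fderiv_eq, h1.eq_of_nhds]
  have h3 : ∀ w w', fderiv ℝ (fun q => fderiv ℝ f q + a • fderiv ℝ f' q) p w w' =
      fderiv ℝ (fderiv ℝ f) p w w' + a * fderiv ℝ (fderiv ℝ f') p w w' := fun w w' =>
    DFunLike.congr_fun (DFunLike.congr_fun h2 w) w'
  simp only [h3, add_apply, smul_apply, smul_eq_mul, mul_add, Finset.sum_add_distrib, mul_sub,
    Finset.mul_sum]
  have h4 : ∀ c k, g c k p.2 * (a * fderiv ℝ (fderiv ℝ f') p (0, v c) (0, v k)) =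
      a * (g c k p.2 * fderiv ℝ (fderiv ℝ f') p (0, v c) (0, v k)) := fun c k => by ring
  simp only [h4]
  ring

/-- The second derivative of a function of one variable is nonpositive at a local maximum. -/
theorem IsLocalMax.deriv_deriv_nonpos {f : ℝ → ℝ} {x : ℝ} (h : IsLocalMax f x)
    (hc : ContinuousAt f x) : deriv (deriv f) x ≤ 0 := by
  -- A positive second derivative would make `x` a local minimum as well, so `f` would be constant
  -- near `x`.
  by_contra! h0
  have h1 : IsLocalMin f x := isLocalMin_of_deriv_deriv_pos h0 h.deriv_eq_zero hc
  have h2 : f =ᶠ[𝓝 x] fun _ => f x := by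
    filter_upwards [h, h1] with y hy hy'
    exact le_antisymm hy hy'
  have h3 : deriv f =ᶠ[𝓝 x] deriv fun _ => f x := h2.deriv
  rw [h3.deriv_eq] at h0
  simp at h0

/-- Restrict `f` to the line through `p` in the direction `w` and use the one-variable case. -/
theorem hessian_nonpos {F : Type*} [NormedAddCommGroup F] [NormedSpace ℝ F] {f : F → ℝ}
    {p w : F} (hf : ContDiffAt ℝ 2 f p) (h : ∀ᶠ s : ℝ in 𝓝 0, f (p + s • w) ≤ f p) :
    fderiv ℝ (fderiv ℝ f) p w w ≤ 0 := by
  have hl : ∀ s : ℝ, HasDerivAt (fun s : ℝ => p + s • w) w s := fun s => by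
    simpa using ((hasDerivAt_id s).smul_const w).const_add p
  have hl0 : Filter.Tendsto (fun s : ℝ => p + s • w) (𝓝 0) (𝓝 p) := by
    simpa using (hl 0).continuousAt.tendsto
  have h1 : deriv (fun s : ℝ => f (p + s • w)) =ᶠ[𝓝 0] fun s => fderiv ℝ f (p + s • w) w := by
    filter_upwards [hl0.eventually (eventually_differentiableAt hf)] with s hs
    exact (hs.hasFDerivAt.comp_hasDerivAt s (hl s)).deriv
  have h2 : deriv (deriv fun s : ℝ => f (p + s • w)) 0 = fderiv ℝ (fderiv ℝ f) p w w := by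
    rw [h1.deriv_eq]
    have h3 : HasFDerivAt (fderiv ℝ f) (fderiv ℝ (fderiv ℝ f) p) (p + (0 : ℝ) • w) := by
      rw [zero_smul, add_zero]
      exact (differentiableAt_fderiv hf).hasFDerivAt
    have h4 : HasDerivAt (fun s : ℝ => fderiv ℝ f (p + s • w)) (fderiv ℝ (fderiv ℝ f) p w) 0 :=
      h3.comp_hasDerivAt (0 : ℝ) (hl 0)
    have h5 : HasDerivAt (fun s : ℝ => fderiv ℝ f (p + s • w) w)
        (fderiv ℝ (fderiv ℝ f) p w w) 0 :=
      (ContinuousLinearMap.apply ℝ ℝ w).hasFDerivAt.comp_hasDerivAt (0 : ℝ) h4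
    exact h5.deriv
  rw [← h2]
  refine IsLocalMax.deriv_deriv_nonpos ?_ ?_
  · filter_upwards [h] with s hs
    simpa using hs
  · exact ContinuousAt.comp (by simpa using hf.continuousAt) (hl 0).continuousAt

/-- The difference quotients from the left are nonnegative. Only earlier times are compared, because
a maximum over `[0, t]` may lie at the final time. -/
theorem fderiv_time_nonneg {f : ℝ × E → ℝ} {p : ℝ × E} (hf : DifferentiableAt ℝ f p)
    (ht : ∀ᶠ s in 𝓝[<] p.1, f (s, p.2) ≤ f p) : 0 ≤ fderiv ℝ f p (1, 0) := by
  have h1 : HasDerivAt (fun s => f (s, p.2)) (fderiv ℝ f p (1, 0)) p.1 :=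
    hf.hasFDerivAt.comp_hasDerivAt p.1 ((hasDerivAt_id p.1).prodMk (hasDerivAt_const p.1 p.2))
  have h2 := (hasDerivAt_iff_tendsto_slope.mp h1).mono_left
    (nhdsWithin_mono p.1 (s := Set.Iio p.1) fun s hs => ne_of_lt hs)
  refine ge_of_tendsto h2 ?_
  filter_upwards [ht, self_mem_nhdsWithin] with s hs hs'
  rw [slope_def_field]
  exact div_nonneg_of_nonpos (sub_nonpos.mpr hs) (sub_nonpos.mpr (le_of_lt hs'))

/-- The parabolic maximum principle at a point. -/
theorem heatOp_nonpos {v : ι → E} {g : ι → ι → E → ℝ} {f : ℝ × E → ℝ} {p : ℝ × E}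
    (hf : ContDiffAt ℝ 2 f p) (hg : (Matrix.of fun a b => g a b p.2).PosSemidef)
    (hs : ∀ᶠ y in 𝓝 p.2, f (p.1, y) ≤ f p) (ht : ∀ᶠ s in 𝓝[<] p.1, f (s, p.2) ≤ f p) :
    heatOp v g f p ≤ 0 := by
  classical
  rw [heatOp_eq_hessian hf]
  have h1 := fderiv_time_nonneg (hf.differentiableAt (by simp)) ht
  have h2 : ∀ w : E, fderiv ℝ (fderiv ℝ f) p (0, w) (0, w) ≤ 0 := fun w => by
    refine hessian_nonpos hf ?_
    have hl : Filter.Tendsto (fun s : ℝ => p.2 + s • w) (𝓝 0) (𝓝 p.2) := by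
      have : ContinuousAt (fun s : ℝ => p.2 + s • w) 0 := by fun_prop
      simpa using this.tendsto
    filter_upwards [hl.eventually hs] with s hs
    convert hs using 2
    ext <;> simp
  -- A factorization `g = Sᵀ S` makes the contracted Hessian a sum of second derivatives along
  -- single vectors.
  obtain ⟨S, hS⟩ := hg.exists_eq_conjTranspose_mul_self
  have hS' : ∀ c k, g c k p.2 = ∑ l, S l c * S l k := fun c k => by
    have := congrFun (congrFun hS c) k
    simpa [Matrix.mul_apply] using this
  have h3 : ∑ c, ∑ k, g c k p.2 * fderiv ℝ (fderiv ℝ f) p (0, v c) (0, v k) =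
      ∑ l, fderiv ℝ (fderiv ℝ f) p (0, ∑ c, S l c • v c) (0, ∑ c, S l c • v c) := by
    have e : ∀ l, ((0 : ℝ), ∑ c, S l c • v c) = ∑ c, S l c • ((0 : ℝ), v c) := fun l => by
      ext <;> simp [Prod.fst_sum, Prod.snd_sum]
    simp only [e, map_sum, map_smul, sum_apply, smul_apply, hS', Finset.sum_mul, smul_eq_mul,
      Finset.mul_sum]
    rw [Finset.sum_comm_cycle]
    refine Finset.sum_congr rfl fun l _ => ?_
    rw [Finset.sum_comm]
    refine Finset.sum_congr rfl fun c _ => Finset.sum_congr rfl fun k _ => ?_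
    ring
  rw [h3]
  have h4 : ∑ l, fderiv ℝ (fderiv ℝ f) p (0, ∑ c, S l c • v c) (0, ∑ c, S l c • v c) ≤ 0 :=
    Finset.sum_nonpos fun l _ => h2 _
  linarith

end MaximumPrinciple

/-! ### Uniform local estimates -/

section CompactBounds

set_option linter.unusedSectionVars false

open scoped Matrix ComplexOrder

attribute [local instance] Matrix.frobeniusNormedRing Matrix.frobeniusNormedAlgebra
  normedStarGroup_matrix

theorem exists_norm_le_of_compact {Y ι F : Type*} [TopologicalSpace Y] [Finite ι]
    [SeminormedAddCommGroup F] {S : Set Y} (hS : IsCompact S) {f : ι → Y → F}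
    (hf : ∀ i, ContinuousOn (f i) S) : ∃ Λ : ℝ, 0 ≤ Λ ∧ ∀ i, ∀ x ∈ S, ‖f i x‖ ≤ Λ := by
  cases nonempty_fintype ι
  choose C hC using fun i => hS.exists_bound_of_continuousOn (hf i)
  refine ⟨∑ i, |C i|, Finset.sum_nonneg fun i _ => abs_nonneg _, fun i x hx => ?_⟩
  exact ((hC i x hx).trans (le_abs_self _)).trans
    (Finset.single_le_sum (f := fun i => |C i|) (fun j _ => abs_nonneg _) (Finset.mem_univ i))

/-- For `P = Bᴴ B` one has `‖P‖ ≤ ‖Bᴴ‖ ‖B‖ = ‖B‖² = tr P`. This turns upper bounds in the order of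
Hermitian matrices into norm bounds. -/
theorem norm_le_reTr {r : ℕ} {P : Matrix (Fin r) (Fin r) ℂ} (hP : P.PosSemidef) : ‖P‖ ≤ reTr P := by
  obtain ⟨B, rfl⟩ := hP.exists_eq_conjTranspose_mul_self
  have h1 : reTr (B.conjTranspose * B) = ‖B‖ ^ 2 := reTr_star_mul B
  have h2 : ‖B.conjTranspose‖ = ‖B‖ := norm_star B
  rw [h1]
  refine (norm_mul_le _ _).trans ?_
  rw [h2, sq]

theorem reTr_nonneg {r : ℕ} {P : Matrix (Fin r) (Fin r) ℂ} (hP : P.PosSemidef) : 0 ≤ reTr P :=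
  (norm_nonneg _).trans (norm_le_reTr hP)

variable {E : Type*} [NormedAddCommGroup E] [NormedSpace ℝ E] {ι : Type*} [Fintype ι]
  [DecidableEq ι] {r : ℕ}

theorem GeomBound.mono {v : ι → E} {g : ι → ι → E → ℝ} {A : ι → E → Matrix (Fin r) (Fin r) ℂ}
    {m m' Λ Λ' : ℝ} {x : E} (h : GeomBound v g A m Λ x) (hm : m' ≤ m) (hΛ : Λ ≤ Λ') :
    GeomBound v g A m' Λ' x where
  pos := h.pos.sub_smul_mono hm
  g_le a b := (h.g_le a b).trans hΛ
  dg_le c a b := (h.dg_le c a b).trans hΛ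
  ddg_le c k a b := (h.ddg_le c k a b).trans hΛ
  A_le a := (h.A_le a).trans hΛ
  dA_le c a := (h.dA_le c a).trans hΛ
  curv_le a b := (h.curv_le a b).trans hΛ
  dcurv_le c a b := (h.dcurv_le c a b).trans hΛ

theorem exists_geomBound {v : ι → E} {g : ι → ι → E → ℝ} {A : ι → E → Matrix (Fin r) (Fin r) ℂ}
    {U S : Set E} (hU : IsOpen U) (hS : IsCompact S) (hSU : S ⊆ U)
    (hg : ∀ a b, ContDiffOn ℝ ∞ (g a b) U) (hA : ∀ a, ContDiffOn ℝ ∞ (A a) U)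
    (hpos : ∀ x ∈ S, (Matrix.of fun a b => g a b x).PosDef) :
    ∃ m Λ : ℝ, 0 < m ∧ 0 ≤ Λ ∧ ∀ x ∈ S, GeomBound v g A m Λ x := by
  obtain ⟨m, hm, h0⟩ := exists_pos_sub_posSemidef (P := fun x => Matrix.of fun a b => g a b x) hS
    (fun a b => (hg a b).continuousOn.mono hSU) hpos
  obtain ⟨Λ₁, p1, h1⟩ := exists_norm_le_of_compact (f := fun i : ι × ι => g i.1 i.2) hS
    fun i => (hg i.1 i.2).continuousOn.mono hSU
  obtain ⟨Λ₂, p2, h2⟩ := exists_norm_le_of_compact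
    (f := fun (i : ι × ι × ι) x => fderiv ℝ (g i.2.1 i.2.2) x (v i.1)) hS
    fun i => (contDiffOn_fderiv_apply hU (hg i.2.1 i.2.2) (v i.1)).continuousOn.mono hSU
  obtain ⟨Λ₃, p3, h3⟩ := exists_norm_le_of_compact
    (f := fun (i : (ι × ι) × ι × ι) x =>
      fderiv ℝ (fun y => fderiv ℝ (g i.2.1 i.2.2) y (v i.1.2)) x (v i.1.1)) hS
    fun i => (contDiffOn_fderiv_apply hU
      (contDiffOn_fderiv_apply hU (hg i.2.1 i.2.2) (v i.1.2)) (v i.1.1)).continuousOn.mono hSU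
  obtain ⟨Λ₄, p4, h4⟩ := exists_norm_le_of_compact (f := A) hS
    fun i => (hA i).continuousOn.mono hSU
  obtain ⟨Λ₅, p5, h5⟩ := exists_norm_le_of_compact
    (f := fun (i : ι × ι) x => fderiv ℝ (A i.2) x (v i.1)) hS
    fun i => (contDiffOn_fderiv_apply hU (hA i.2) (v i.1)).continuousOn.mono hSU
  obtain ⟨Λ₆, p6, h6⟩ := exists_norm_le_of_compact
    (f := fun (i : ι × ι) x => localCurv v A i.1 i.2 x) hS
    fun i => (contDiffOn_localCurv hU hA i.1 i.2).continuousOn.mono hSU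
  obtain ⟨Λ₇, p7, h7⟩ := exists_norm_le_of_compact
    (f := fun (i : ι × ι × ι) x => localDCurv v A i.1 i.2.1 i.2.2 x) hS
    fun i => (contDiffOn_localDCurv hU hA i.1 i.2.1 i.2.2).continuousOn.mono hSU
  refine ⟨m, Λ₁ + Λ₂ + Λ₃ + Λ₄ + Λ₅ + Λ₆ + Λ₇, hm, by positivity, fun x hx =>
    ⟨h0 x hx, fun a b => ?_, fun c a b => ?_, fun c k a b => ?_, fun a => ?_, fun c a => ?_,
      fun a b => ?_, fun c a b => ?_⟩⟩
  · exact (h1 (a, b) x hx).trans (by linarith)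
  · exact (h2 (c, a, b) x hx).trans (by linarith)
  · exact (h3 ((c, k), a, b) x hx).trans (by linarith)
  · exact (h4 a x hx).trans (by linarith)
  · exact (h5 (c, a) x hx).trans (by linarith)
  · exact (h6 (a, b) x hx).trans (by linarith)
  · exact (h7 (c, a, b) x hx).trans (by linarith)

theorem localEnergy_le {v : ι → E} {g : ι → ι → E → ℝ} {A : ι → E → Matrix (Fin r) (Fin r) ℂ}
    {H : ℝ × E → Matrix (Fin r) (Fin r) ℂ} {Λ : ℝ} {p : ℝ × E} (hg : ∀ a b, |g a b p.2| ≤ Λ) :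
    localEnergy v g H A p ≤
      (Fintype.card ι * (Fintype.card ι * Λ)) * ‖fun a => localPsi v H A a p‖ ^ 2 := by
  have h : ∀ a b, g a b p.2 * reTr (localPsi v H A a p * localPsi v H A b p) ≤
      Λ * ‖fun a => localPsi v H A a p‖ ^ 2 := fun a b => by
    have h1 := abs_reTr_mul_le' (norm_le_pi_norm (fun a => localPsi v H A a p) a)
      (norm_le_pi_norm (fun a => localPsi v H A a p) b)
    refine (le_abs_self _).trans ?_
    rw [abs_mul, sq]
    exact mul_le_mul (hg a b) h1 (abs_nonneg _) ((abs_nonneg _).trans (hg a b))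
  refine (Finset.sum_le_sum fun a _ => Finset.sum_le_sum fun b _ => h a b).trans (le_of_eq ?_)
  simp only [Finset.sum_const, Finset.card_univ, nsmul_eq_mul]
  ring

end CompactBounds

/-! ### The maximum principle along the flow, on patches and then on all of `X`. -/

section LocalEstimate

set_option linter.unusedSectionVars false

open scoped Matrix ComplexOrder

attribute [local instance] Matrix.frobeniusNormedRing Matrix.frobeniusNormedAlgebra
  normedStarGroup_matrix

variable {n r : ℕ} {X : Type*} [TopologicalSpace X] [ChartedSpace (Cn n) X]
  [IsManifold 𝓘(ℂ, Cn n) ω X]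
  {V : X → Type*} [TopologicalSpace (TotalSpace (Fin r → ℂ) V)]
  [∀ x, AddCommGroup (V x)] [∀ x, Module ℂ (V x)] [∀ x, TopologicalSpace (V x)]
  [∀ x, IsTopologicalAddGroup (V x)] [∀ x, ContinuousSMul ℝ (V x)]
  [FiberBundle (Fin r → ℂ) V] [VectorBundle ℝ (Fin r → ℂ) V] [VectorBundle ℂ (Fin r → ℂ) V]
  [ContMDiffVectorBundle ∞ (Fin r → ℂ) V 𝓘(ℝ, Cn n)]

namespace IsFrameOn

variable {e : Trivialization (Fin r → ℂ) (π (Fin r → ℂ) V)} [MemTrivializationAtlas e]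
  {φ : OpenPartialHomeomorph X (Cn n)} {σ : Fin r → Π x, V x} {W : Set X}

/-- Estimates for the energy and the relative trace, uniform over all flows staying within a bounded
distance of `K`, over a compact subset of a coordinate patch. -/
theorem exists_heatOp_bounds (h : IsFrameOn φ e σ W) (κ : KahlerMetric n X)
    {D : ComplexConnection n r V} (hD : IsNHYM κ D) (K : HermitianMetric n r V) (C₁ : ℝ)
    {S : Set (Cn n)} (hS : IsCompact S) (hSU : S ⊆ φ.target ∩ φ.symm ⁻¹' W) :
    ∃ c C : ℝ, 0 < c ∧ 0 ≤ C ∧ ∀ (T : EReal) (H : ℝ → HermitianMetric n r V),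
      IsHeatFlow κ D T H → ∀ t ∈ openTime T, (∀ x, logNorm K (H t) x < C₁) → ∀ y ∈ S,
      ∃ Y : ℝ, 0 ≤ Y ∧
        -(C * (1 + Y)) ≤ heatOp (realBasis n) (fun a b y => κ.inv φ (φ.symm y) a b)
          (localEnergy (realBasis n) (fun a b y => κ.inv φ (φ.symm y) a b) (gramFlow H φ e)
            (realConn D φ e σ)) (t, y) ∧
        c * Y - C ≤ heatOp (realBasis n) (fun a b y => κ.inv φ (φ.symm y) a b)
          (fun q => reTr ((gramAt K e (φ.symm q.2))⁻¹ * gramFlow H φ e q)) (t, y) ∧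
        energy κ D (H t) (φ.symm y) ≤ C * Y := by
  have hgs : ∀ a b, ContDiffOn ℝ ∞ (fun y => κ.inv φ (φ.symm y) a b)
      (φ.target ∩ φ.symm ⁻¹' W) := fun a b => (κ.contDiffOn_inv h.mem a b).mono Set.inter_subset_left
  have hU := h.open_image
  obtain ⟨m₀, Λ₀, hm₀, hΛ₀, hgeom⟩ := exists_geomBound (v := realBasis n)
    (A := realConn D φ e σ) hU hS hSU hgs (fun a => h.contDiffOn_connForm D _)
    fun y hy => κ.inv_posDef h.mem (φ.map_target (hSU hy).1)
  have hKc := h.contDiffOn_gramAt K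
  have hKi := h.contDiffOn_inv_gramAt K
  obtain ⟨m₁, hm₁, hK₁⟩ := exists_pos_sub_posSemidef (P := fun y => gramAt K e (φ.symm y)) hS
    (fun i j => (hKc.matrix_apply i j).continuousOn.mono hSU)
    fun y hy => gramAt_posDef K (h.sub_base (hSU hy).2)
  obtain ⟨m₂, hm₂, hK₂⟩ := exists_pos_sub_posSemidef (P := fun y => (gramAt K e (φ.symm y))⁻¹) hS
    (fun i j => (hKi.matrix_apply i j).continuousOn.mono hSU)
    fun y hy => (gramAt_posDef K (h.sub_base (hSU hy).2)).inv
  obtain ⟨Λ₁, p1, h1⟩ := exists_norm_le_of_compact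
    (f := fun (_ : Unit) y => reTr (gramAt K e (φ.symm y))) hS
    fun _ => (reTrL r).continuous.comp_continuousOn (hKc.continuousOn.mono hSU)
  obtain ⟨Λ₂, p2, h2⟩ := exists_norm_le_of_compact
    (f := fun (_ : Unit) y => (gramAt K e (φ.symm y))⁻¹) hS fun _ => hKi.continuousOn.mono hSU
  obtain ⟨Λ₃, p3, h3⟩ := exists_norm_le_of_compact
    (f := fun a y => fderiv ℝ (fun y => (gramAt K e (φ.symm y))⁻¹) y (realBasis n a)) hS
    fun a => (contDiffOn_fderiv_apply hU hKi _).continuousOn.mono hSU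
  obtain ⟨Λ₄, p4, h4⟩ := exists_norm_le_of_compact
    (f := fun (i : (Fin 2 × Fin n) × (Fin 2 × Fin n)) y => fderiv ℝ (fun y =>
      fderiv ℝ (fun y => (gramAt K e (φ.symm y))⁻¹) y (realBasis n i.2)) y (realBasis n i.1)) hS
    fun a => (contDiffOn_fderiv_apply hU (contDiffOn_fderiv_apply hU hKi _) _).continuousOn.mono hSU
  -- `m` has to bound from below the inverse metric `g`, the matrix `H ≥ e^{-C₁} K`, its inverse
  -- `H⁻¹ ≥ e^{-C₁} K⁻¹`, and `K⁻¹`. All four are controlled on `S` without reference to the flow.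
  obtain ⟨m, hm, hmle0, hmle1, hmle2, hmle3⟩ : ∃ m : ℝ, 0 < m ∧ m ≤ m₀ ∧
      m ≤ Real.exp (-C₁) * m₁ ∧ m ≤ Real.exp (-C₁) * m₂ ∧ m ≤ m₂ := by
    refine ⟨min (min m₀ (Real.exp (-C₁) * m₁)) (min (Real.exp (-C₁) * m₂) m₂), ?_, ?_, ?_, ?_, ?_⟩
    · have := Real.exp_pos (-C₁)
      positivity
    · exact (min_le_left _ _).trans (min_le_left _ _)
    · exact (min_le_left _ _).trans (min_le_right _ _)
    · exact (min_le_right _ _).trans (min_le_left _ _)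
    · exact (min_le_right _ _).trans (min_le_right _ _)
  obtain ⟨Λ, hΛ, hΛle⟩ : ∃ Λ : ℝ, Λ = Λ₀ + Real.exp C₁ * Λ₁ + Λ₂ + Λ₃ + Λ₄ ∧ 0 ≤ Λ :=
    ⟨_, rfl, by positivity⟩
  have hΛ1 : 0 ≤ Real.exp C₁ * Λ₁ := by positivity
  obtain ⟨C₂, hC₂, hb⟩ := exists_heatOp_energy_bound (Cn n) (Fin 2 × Fin n) r hm hΛle
  obtain ⟨C₃, hC₃, hb'⟩ := exists_heatOp_trace_bound (Cn n) (Fin 2 × Fin n) r hm hΛle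
  refine ⟨2 * m ^ 3, C₂ + C₃ + (Fintype.card (Fin 2 × Fin n) * (Fintype.card (Fin 2 × Fin n) * Λ)),
    by positivity, by positivity, fun T H hH t ht hlog y hy => ?_⟩
  have hp : (t, y) ∈ openTime T ×ˢ (φ.target ∩ φ.symm ⁻¹' W) := ⟨ht, hSU hy⟩
  have hyb : φ.symm y ∈ e.baseSet := h.sub_base (hSU hy).2
  have hflow := h.localFlow hD hH
  have hG := (hgeom y hy).mono hmle0 (show Λ₀ ≤ Λ by linarith)
  obtain ⟨hl1, hl2⟩ := logNorm_gramAt (hlog (φ.symm y)) hyb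
  have hHpd := gramAt_posDef (H t) hyb
  have hKpd := gramAt_posDef K hyb
  have hHm : (gramFlow H φ e (t, y) - m • 1).PosSemidef := by
    have h5 := hl1.add ((hK₁ y hy).smul (Real.exp_pos (-C₁)).le)
    rw [smul_sub, smul_smul, sub_add_sub_cancel] at h5
    exact h5.sub_smul_mono hmle1
  have hHim : ((gramFlow H φ e (t, y))⁻¹ - m • 1).PosSemidef := by
    have h5 := hHpd.inv_sub_inv_posSemidef (hKpd.smul (Real.exp_pos C₁)) hl2
    have h6 : (Real.exp C₁ • gramAt K e (φ.symm y))⁻¹ =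
        Real.exp (-C₁) • (gramAt K e (φ.symm y))⁻¹ := by
      refine Matrix.inv_eq_left_inv ?_
      rw [smul_mul_smul_comm, ← Real.exp_add, neg_add_cancel, Real.exp_zero, one_smul,
        Matrix.nonsing_inv_mul _ ((Matrix.isUnit_iff_isUnit_det _).mp hKpd.isUnit)]
    rw [h6] at h5
    have h7 := h5.add ((hK₂ y hy).smul (Real.exp_pos (-C₁)).le)
    rw [smul_sub, smul_smul, sub_add_sub_cancel] at h7
    exact h7.sub_smul_mono hmle2
  -- `‖H‖ ≤ tr H ≤ e^{C₁} tr K`.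
  have hHΛ : ‖gramFlow H φ e (t, y)‖ ≤ Λ := by
    have h5 := reTr_nonneg hl2
    rw [reTr_sub, reTr_smul] at h5
    have h6 := mul_le_mul_of_nonneg_left ((le_abs_self _).trans (h1 () y hy)) (Real.exp_pos C₁).le
    have h7 := norm_le_reTr hHpd.posSemidef
    exact h7.trans (by linarith)
  -- `Y` is the squared sup norm of the coordinate components of `ψ`; it dominates the energy
  -- density up to a constant on `S`.
  refine ⟨‖fun a => localPsi (realBasis n) (gramFlow H φ e) (realConn D φ e σ) a (t, y)‖ ^ 2,
    sq_nonneg _, ?_, ?_, ?_⟩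
  · refine le_trans ?_ (hb _ _ _ _ _ _ hflow (t, y) hp hG hHm hHim)
    refine neg_le_neg (mul_le_mul_of_nonneg_right ?_ (by positivity))
    have : 0 ≤ (Fintype.card (Fin 2 × Fin n) * (Fintype.card (Fin 2 × Fin n) * Λ) : ℝ) := by
      positivity
    linarith
  · refine le_trans ?_ (hb' _ _ _ _ _ _ _ hflow hKi (t, y) hp hG hHm
      ((hK₂ y hy).sub_smul_mono hmle3) hHΛ ((h2 () y hy).trans (by linarith))
      (fun a => (h3 a y hy).trans (by linarith))
      fun c a => (h4 (c, a) y hy).trans (by linarith))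
    have : 0 ≤ (Fintype.card (Fin 2 × Fin n) * (Fintype.card (Fin 2 × Fin n) * Λ) : ℝ) := by
      positivity
    linarith
  · have h5 := h.energy_symm κ D hH.smooth hp
    refine (le_of_eq h5).trans ((localEnergy_le hG.g_le).trans ?_)
    exact mul_le_mul_of_nonneg_right (by linarith) (sq_nonneg _)

/-- At a space-time maximum of `|ψ|² + a tr (K⁻¹ H)` the energy density is bounded. -/
theorem exists_energy_bound_at_max (h : IsFrameOn φ e σ W) (κ : KahlerMetric n X)
    {D : ComplexConnection n r V} (hD : IsNHYM κ D) (K : HermitianMetric n r V) (C₁ : ℝ)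
    {S : Set (Cn n)} (hS : IsCompact S) (hSU : S ⊆ φ.target ∩ φ.symm ⁻¹' W) :
    ∃ c C : ℝ, 0 < c ∧ 0 ≤ C ∧ ∀ (T : EReal) (H : ℝ → HermitianMetric n r V),
      IsHeatFlow κ D T H → ∀ t ∈ openTime T, (∀ x, logNorm K (H t) x < C₁) → ∀ y ∈ S,
      ∀ a : ℝ, C + 1 ≤ a * c →
      (∀ s, 0 < s → s ≤ t → ∀ x, energy κ D (H s) x + a * relTrace K (H s) x ≤
        energy κ D (H t) (φ.symm y) + a * relTrace K (H t) (φ.symm y)) →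
      energy κ D (H t) (φ.symm y) ≤ C * (C + a * C) := by
  obtain ⟨c, C, hc, hC, hb⟩ := h.exists_heatOp_bounds κ hD K C₁ hS hSU
  refine ⟨c, C, hc, hC, fun T H hH t ht hlog y hy a ha hmax => ?_⟩
  obtain ⟨Y, hY, h1, h2, h3⟩ := hb T H hH t ht hlog y hy
  have hp : (t, y) ∈ openTime T ×ˢ (φ.target ∩ φ.symm ⁻¹' W) := ⟨ht, hSU hy⟩
  have hflow := h.localFlow hD hH
  have ho := (isOpen_openTime T).prod h.open_image
  have hs2 : ContDiffOn ℝ ∞ (fun q : ℝ × Cn n => reTr ((gramAt K e (φ.symm q.2))⁻¹ *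
      gramFlow H φ e q)) (openTime T ×ˢ (φ.target ∩ φ.symm ⁻¹' W)) :=
    (reTrL r).contDiff.comp_contDiffOn (((h.contDiffOn_inv_gramAt K).comp contDiff_snd.contDiffOn
      fun q hq => hq.2).mul hflow.smooth_H)
  have hs1 : ContDiffOn ℝ ∞ (localEnergy (realBasis n) (fun a b y => κ.inv φ (φ.symm y) a b)
      (gramFlow H φ e) (realConn D φ e σ)) (openTime T ×ˢ (φ.target ∩ φ.symm ⁻¹' W)) :=
    ContDiffOn.sum fun a _ => ContDiffOn.sum fun b _ =>
      ((hflow.smooth_g a b).comp contDiff_snd.contDiffOn fun q hq => hq.2).mul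
        ((reTrL r).contDiff.comp_contDiffOn ((hflow.smooth_psi a).mul (hflow.smooth_psi b)))
  have hc1 := (hs1.contDiffAt (ho.mem_nhds hp)).of_le (m := 2) ENat.LEInfty.out
  have hc2 := (hs2.contDiffAt (ho.mem_nhds hp)).of_le (m := 2) ENat.LEInfty.out
  have heq : ∀ q ∈ openTime T ×ˢ (φ.target ∩ φ.symm ⁻¹' W),
      localEnergy (realBasis n) (fun a b y => κ.inv φ (φ.symm y) a b) (gramFlow H φ e)
        (realConn D φ e σ) q + a * reTr ((gramAt K e (φ.symm q.2))⁻¹ * gramFlow H φ e q) =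
      energy κ D (H q.1) (φ.symm q.2) + a * relTrace K (H q.1) (φ.symm q.2) := fun q hq => by
    rw [h.energy_symm κ D hH.smooth hq, h.relTrace_symm K H hq.2]
  -- The value at the maximum is compared with nearby points at the same time and with slightly
  -- earlier positive times at the same point, all inside the patch.
  have hnon := heatOp_nonpos (v := realBasis n) (g := fun a b y => κ.inv φ (φ.symm y) a b)
    (hc1.add (contDiffAt_const.mul hc2))
    (κ.inv_posDef h.mem (φ.map_target (hSU hy).1)).posSemidef
    (by
      filter_upwards [h.open_image.mem_nhds (hSU hy)] with z hz
      exact (heq (t, z) ⟨ht, hz⟩).trans_le ((hmax t ht.1 le_rfl _).trans (heq (t, y) hp).ge))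
    (by
      filter_upwards [self_mem_nhdsWithin, mem_nhdsWithin_of_mem_nhds (lt_mem_nhds ht.1)]
        with s hs hs0
      have hsT : s ∈ openTime T := ⟨hs0, (EReal.coe_lt_coe_iff.mpr hs).trans ht.2⟩
      exact (heq (s, y) ⟨hsT, hSU hy⟩).trans_le
        ((hmax s hs0 (le_of_lt hs) _).trans (heq (t, y) hp).ge))
  rw [heatOp_add_const_mul hc1 hc2] at hnon
  have ha0 : 0 ≤ a := by
    by_contra! h0
    nlinarith
  have h4 := mul_le_mul_of_nonneg_left h2 ha0
  -- In `0 ≥ -C (1 + Y) + a (c Y - C)` the coefficient of `Y` is at least `1`, because `a c ≥ C +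
  -- 1`.
  have h5 : Y ≤ C + a * C := by nlinarith
  exact h3.trans (mul_le_mul_of_nonneg_left h5 hC)

end IsFrameOn

/-- Carries the estimate from a compact set of coordinates to a neighbourhood in `X`, so that
finitely many such neighbourhoods suffice. -/
theorem exists_nhds_energy_bound [T2Space X] (κ : KahlerMetric n X)
    {D : ComplexConnection n r V} (hD : IsNHYM κ D) (K : HermitianMetric n r V) (C₁ : ℝ) (x₀ : X) :
    ∃ N ∈ 𝓝 x₀, ∃ c C : ℝ, 0 < c ∧ 0 ≤ C ∧ ∀ (T : EReal) (H : ℝ → HermitianMetric n r V),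
      IsHeatFlow κ D T H → ∀ t ∈ openTime T, (∀ x, logNorm K (H t) x < C₁) → ∀ x ∈ N,
      ∀ a : ℝ, C + 1 ≤ a * c →
      (∀ s, 0 < s → s ≤ t → ∀ z, energy κ D (H s) z + a * relTrace K (H s) z ≤
        energy κ D (H t) x + a * relTrace K (H t) x) →
      energy κ D (H t) x ≤ C * (C + a * C) := by
  obtain ⟨σ, W, hx, h⟩ := exists_isFrameOn (n := n) (r := r) (V := V) x₀
  obtain ⟨S, hS, hxS, hSU⟩ := exists_compact_subset h.open_image (h.map_mem hx)
  obtain ⟨c, C, hc, hC, hb⟩ := h.exists_energy_bound_at_max κ hD K C₁ hS hSU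
  refine ⟨(chartAt (Cn n) x₀).source ∩ chartAt (Cn n) x₀ ⁻¹' interior S,
    ((chartAt (Cn n) x₀).isOpen_inter_preimage isOpen_interior).mem_nhds
      ⟨mem_chart_source _ x₀, hxS⟩, c, C, hc, hC, fun T H hH t ht hlog x hxN a ha hmax => ?_⟩
  have := hb T H hH t ht hlog _ (interior_subset hxN.2) a ha
  rw [(chartAt (Cn n) x₀).left_inv hxN.1] at this
  exact this hmax

/-- The energy density is bounded along every heat flow within bounded distance of its initial
metric. -/
theorem exists_energy_bound [T2Space X] [CompactSpace X] (κ : KahlerMetric n X)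
    {D : ComplexConnection n r V} (hD : IsNHYM κ D) (K : HermitianMetric n r V) (C₁ : ℝ) :
    ∃ R : ℝ, ∀ (T : EReal), 0 < T → ∀ H : ℝ → HermitianMetric n r V, IsHeatFlow κ D T H →
      H 0 = K → (∀ t ∈ timeInterval T, ∀ x, logNorm K (H t) x < C₁) →
      ∀ t ∈ timeInterval T, ∀ x, energy κ D (H t) x ≤ R := by
  choose N hN c C hc hC hb using exists_nhds_energy_bound κ hD K C₁
  obtain ⟨F, hF⟩ := CompactSpace.elim_nhds_subcover N hN
  obtain ⟨R₀, hR₀⟩ := exists_energy_le κ D K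
  have hq : ∀ z, 0 ≤ (C z + 1) / c z := fun z => div_nonneg (by linarith [hC z]) (hc z).le
  -- A single weight `a` has to serve all patches; the sum of the finitely many ratios dominates
  -- each of them.
  obtain ⟨a, ha0, ha⟩ : ∃ a : ℝ, 0 ≤ a ∧ ∀ z ∈ F, C z + 1 ≤ a * c z := by
    refine ⟨∑ z ∈ F, (C z + 1) / c z, Finset.sum_nonneg fun z _ => hq z, fun z hz => ?_⟩
    rw [← div_le_iff₀ (hc z)]
    exact Finset.single_le_sum (f := fun z => (C z + 1) / c z) (fun z _ => hq z) hz
  have hB : ∀ z, 0 ≤ C z * (C z + a * C z) := fun z => by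
    have := hC z
    positivity
  -- The terms are the initial energy, the bounds at a maximum at positive time over all patches,
  -- and the largest possible value of `a tr (K⁻¹ H)`.
  refine ⟨|R₀| + ∑ z ∈ F, C z * (C z + a * C z) + a * (r * Real.exp C₁),
    fun T hT H hH h0 hlog t ht x => ?_⟩
  have hsub : Set.Icc 0 t ⊆ timeInterval T := fun s hs =>
    ⟨hs.1, (EReal.coe_le_coe_iff.mpr hs.2).trans_lt ht.2⟩
  have hu : ContinuousOn (fun p : ℝ × X => energy κ D (H p.1) p.2 + a * relTrace K (H p.1) p.2)
      (Set.Icc 0 t ×ˢ Set.univ) :=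
    ((continuousOn_energy κ D hT hH.smooth).add
      (continuousOn_const.mul (continuousOn_relTrace K hH.smooth))).mono
        (Set.prod_mono hsub subset_rfl)
  -- The maximum is taken over the compact set `[0, t] × X`, so `T = ∞` causes no difficulty;
  -- nothing in the bound depends on `t`.
  obtain ⟨⟨t₀, x₀⟩, hm, hmax⟩ := (isCompact_Icc.prod isCompact_univ).exists_isMaxOn
    ⟨(t, x), ⟨ht.1, le_rfl⟩, Set.mem_univ x⟩ hu
  have hmax' : ∀ s ∈ Set.Icc 0 t, ∀ z, energy κ D (H s) z + a * relTrace K (H s) z ≤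
      energy κ D (H t₀) x₀ + a * relTrace K (H t₀) x₀ := fun s hs z =>
    isMaxOn_iff.mp hmax (s, z) ⟨hs, Set.mem_univ z⟩
  have ht₀ : t₀ ∈ Set.Icc 0 t := hm.1
  have h1 := hmax' t ⟨ht.1, le_rfl⟩ x
  have h2 := mul_nonneg ha0 (relTrace_bounds (hlog t ht x)).1
  have h3 := mul_le_mul_of_nonneg_left (relTrace_bounds (hlog t₀ (hsub ht₀) x₀)).2 ha0
  have h4 : energy κ D (H t₀) x₀ ≤ |R₀| + ∑ z ∈ F, C z * (C z + a * C z) := by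
    have hsum : 0 ≤ ∑ z ∈ F, C z * (C z + a * C z) := Finset.sum_nonneg fun z _ => hB z
    -- At time zero the metric is `K`; at positive times the local estimate around `x₀` applies.
    rcases eq_or_lt_of_le ht₀.1 with h0' | h0'
    · have : t₀ = 0 := h0'.symm
      rw [this, h0]
      linarith [hR₀ x₀, le_abs_self R₀]
    · obtain ⟨z, hz, hxz⟩ : ∃ z ∈ F, x₀ ∈ N z := by
        have : x₀ ∈ ⋃ z ∈ F, N z := hF ▸ Set.mem_univ x₀
        simpa using this
      have h5 := hb z T H hH t₀ ⟨h0', (hsub ht₀).2⟩ (hlog t₀ (hsub ht₀)) x₀ hxz a (ha z hz)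
        fun s hs hst => hmax' s ⟨hs.le, hst.trans ht₀.2⟩
      have h6 := Finset.single_le_sum (f := fun z => C z * (C z + a * C z)) (fun z _ => hB z) hz
      linarith [abs_nonneg R₀]
  linarith

end LocalEstimate

end

theorem proposition4p10 {n r : ℕ} {X : Type*} [TopologicalSpace X] [T2Space X] [CompactSpace X]
    [ChartedSpace (Cn n) X] [IsManifold 𝓘(ℂ, Cn n) ω X]
    {V : X → Type*} [TopologicalSpace (TotalSpace (Fin r → ℂ) V)]
    [∀ x, AddCommGroup (V x)] [∀ x, Module ℂ (V x)] [∀ x, TopologicalSpace (V x)]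
    [∀ x, IsTopologicalAddGroup (V x)] [∀ x, ContinuousSMul ℝ (V x)]
    [FiberBundle (Fin r → ℂ) V] [VectorBundle ℝ (Fin r → ℂ) V] [VectorBundle ℂ (Fin r → ℂ) V]
    [ContMDiffVectorBundle ∞ (Fin r → ℂ) V 𝓘(ℝ, Cn n)]
    (κ : KahlerMetric n X) (D : ComplexConnection n r V) (hD : IsNHYM κ D)
    (K : HermitianMetric n r V) (C₁ : ℝ) (hC₁ : 0 < C₁) :
    ∃ C₂ : ℝ, 0 < C₂ ∧ ∀ T : EReal, 0 < T → ∀ H : ℝ → HermitianMetric n r V,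
      IsHeatFlow κ D T H → H 0 = K →
      (⨆ t ∈ timeInterval T, ⨆ x : X, (logNorm K (H t) x : EReal)) < (C₁ : EReal) →
      (⨆ t ∈ timeInterval T, ⨆ x : X, (psiNorm κ D (H t) x : EReal)) < (C₂ : EReal) := by
  obtain ⟨R, hR⟩ := exists_energy_bound κ hD K C₁
  -- The supremum is at most `√R`; the extra `1` makes the inequality strict and the constant
  -- positive.
  refine ⟨√R + 1, by positivity, fun T hT H hH h0 hsup => ?_⟩
  have hlog : ∀ t ∈ timeInterval T, ∀ x, logNorm K (H t) x < C₁ := fun t ht x => by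
    have h1 : (logNorm K (H t) x : EReal) < C₁ :=
      ((le_iSup (fun x => (logNorm K (H t) x : EReal)) x).trans
        (le_iSup₂ (f := fun t (_ : t ∈ timeInterval T) =>
          ⨆ x : X, (logNorm K (H t) x : EReal)) t ht)).trans_lt hsup
    exact_mod_cast h1
  refine lt_of_le_of_lt (b := ((√R : ℝ) : EReal)) ?_ (EReal.coe_lt_coe_iff.mpr (lt_add_one _))
  refine iSup₂_le fun t ht => iSup_le fun x => EReal.coe_le_coe_iff.mpr ?_
  rw [psiNorm_eq]
  exact Real.sqrt_le_sqrt (hR T hT H hH h0 hlog t ht x)
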